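/- Let $\tau\in\mathbb C$ with $\operatorname{Im}\tau>0$, $\varpi=\arg\tau\in\,]0,\pi[$, $q=e^{2i\pi\tau}$. Use coordinates $(z,y)\in\mathbb C^*\times\mathbb C$, put $\xi=1/y$, and let $F_{1,0,0}(z,\xi)=(qz,\xi-1)$. Let $F$ be an injective holomorphic map from an open neighborhood $\tilde U$ of $\tilde C=\{y=0\}=\{\xi=\infty\}$ in $\mathbb C^*\times\mathbb C$ to $\mathbb C^*\times\mathbb C$, with $F(z,0)=(qz,0)$. Assume that $F$ is formally conjugate to $F_{1,0,0}$ by a formal diffeomorphism tangent to the identity along $\tilde C$, $$\hat\Psi(z,\xi)=\Big(z+\sum_{n\ge1}a_n(z)\xi^{-n},\ \xi+\sum_{n\ge0}b_n(z)\xi^{-n}\Big),\qquad a_n,b_n\in\mathcal O(\mathbb C^*),\qquad \hat\Psi\circ F=F_{1,0,0}\circ\hat\Psi,$$ the last identity being one of formal power series in $\xi^{-1}$. Consider the intervals $$I_1=]-\varpi,\pi-\varpi[,\quad I_2=]-\pi,0[,\quad I_3=I_1+\pi,\quad I_4=I_2+\pi.$$ For $I=]\theta_1,\theta_2[$ and $c,\varepsilon>0$,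 $R\ge 0$ write $I_\varepsilon=]\theta_1+\varepsilon,\theta_2-\varepsilon[$ and $$S(I,R;c)=\{(z,\xi):\ \arg\xi\in I,\ |\xi|>R,\ e^{-c}<|z|<e^{c}\}.$$ An open set $S\subset\{(z,\xi):\ z\ne0,\ \xi\neq 0,\ \arg\xi\in I\}$ is transversely sectorial of opening $I$ if for all $c,\varepsilon>0$ there is $R>0$ with $S(I_\varepsilon,R;c)\subset S$. Then for each $i\in\{1,2,3,4\}$ there are a transversely sectorial open set $S_i\subset\tilde U\setminus\tilde C$ of opening $I_i$ and a holomorphic map $\Psi_i:S_i\to\mathbb C^*\times\mathbb C$, biholomorphic onto its image, such that: 1. $\Psi_i$ is asymptotic to $\hat\Psi$ along $\{\xi=\infty\}$: for every integer $m\ge0$ and all $c,\varepsilon>0$ there are $C,R>0$ such that $S((I_i)_\varepsilon,R;c)\subset S_i$ and, on this sector, each component of $\Psi_i$ differs from the truncation at order $\xi^{-m}$ of the corresponding component of $\hat\Psi$ by at most $C|\xi|^{-m-1}$; 2. $\Psi_i\circ F=F_{1,0,0}\circ\Psi_i$ at every point $p\in S_i$ with $F(p)\in S_i$; 3. $\Psi_i$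 induces an injective map between the quotients by $F$ and by $F_{1,0,0}$: there is an open neighborhood $V\subset\tilde U$ of $\tilde C$ with $S_i\subset V$ such that for all $p,p'\in S_i$ and $k\ge0$, one has $F_{1,0,0}^{k}(\Psi_i(p))=\Psi_i(p')$ if and only if $p'=F^{k}(p)$ with $p,F(p),\dots,F^{k}(p)\in V\setminus\tilde C$. -/

import Mathlib

open Filter Asymptotics

namespace EllipticNbhd

noncomputable section

/-! Coordinates: `(z, y)` with `z ≠ 0` near the curve `{y = 0}`, and `(z, ξ)` with `ξ = 1 / y`,
so that the curve is `{ξ = ∞}`. -/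

/-- A representative of a germ of diffeomorphism of `(ℂ* × ℂ, {y = 0})` inducing `z ↦ q z` on
`{y = 0}`, written in the coordinates `(z, y)`: an injective holomorphic map from an open
neighborhood `U` of `ℂ* × {0}` in `ℂ* × ℂ` to `ℂ* × ℂ`. -/
structure NbhdDiffeo (q : ℂ) where
  /-- the domain, a neighborhood of `{y = 0}` -/
  U : Set (ℂ × ℂ)
  /-- the map, in the coordinates `(z, y)`; only its values on `U` matter -/
  toFun : ℂ × ℂ → ℂ × ℂ
  isOpen_U : IsOpen U
  ne_zero_of_mem : ∀ p ∈ U, p.1 ≠ 0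
  curve_subset : ∀ z : ℂ, z ≠ 0 → (z, (0 : ℂ)) ∈ U
  holo : DifferentiableOn ℂ toFun U
  inj : Set.InjOn toFun U
  map_ne_zero : ∀ p ∈ U, (toFun p).1 ≠ 0
  map_curve : ∀ z : ℂ, z ≠ 0 → toFun (z, 0) = (q * z, 0)

/-- The part outside the curve of a set given in the coordinates `(z, y)`, rewritten in the
coordinates `(z, ξ)`. -/
def xiDomain (V : Set (ℂ × ℂ)) : Set (ℂ × ℂ) :=
  {p | p.2 ≠ 0 ∧ (p.1, p.2⁻¹) ∈ V}

/-- The map `F` rewritten in the coordinates `(z, ξ)`; meaningful on `xiDomain F.U`. -/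
def NbhdDiffeo.xi {q : ℂ} (F : NbhdDiffeo q) (p : ℂ × ℂ) : ℂ × ℂ :=
  ((F.toFun (p.1, p.2⁻¹)).1, ((F.toFun (p.1, p.2⁻¹)).2)⁻¹)

/-- The model map `F_{1,0,0}(z, ξ) = (q z, ξ - 1)`. -/
def modelMap (q : ℂ) (p : ℂ × ℂ) : ℂ × ℂ :=
  (q * p.1, p.2 - 1)

/-- A formal diffeomorphism tangent to the identity along the curve,
`(z + ∑_{n ≥ 1} aₙ(z) ξ⁻ⁿ, ξ + ∑_{n ≥ 0} bₙ(z) ξ⁻ⁿ)` with `aₙ`, `bₙ` holomorphic on `ℂ*`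
(equivalently `(z + ∑_{n ≥ 1} aₙ yⁿ, y + ∑_{n ≥ 2} cₙ yⁿ)`). -/
structure FormalDiffeo where
  a : ℕ → ℂ → ℂ
  b : ℕ → ℂ → ℂ
  holo_a : ∀ n, DifferentiableOn ℂ (a n) {0}ᶜ
  holo_b : ∀ n, DifferentiableOn ℂ (b n) {0}ᶜ
  a_zero : ∀ z : ℂ, z ≠ 0 → a 0 z = 0

/-- The partial sum `∑_{n ≤ N} cₙ(z) ξ⁻ⁿ`. -/
def partialSum (c : ℕ → ℂ → ℂ) (N : ℕ) (p : ℂ × ℂ) : ℂ :=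
  ∑ n ∈ Finset.range (N + 1), c n p.1 * (p.2⁻¹) ^ n

/-- The truncation at order `N` of a formal diffeomorphism. -/
def FormalDiffeo.trunc (P : FormalDiffeo) (N : ℕ) (p : ℂ × ℂ) : ℂ × ℂ :=
  (p.1 + partialSum P.a N p, p.2 + partialSum P.b N p)

/-- The identity `P ∘ F = F_{1,0,0} ∘ P` between formal power series in `ξ⁻¹` with coefficients
depending on `z ∈ ℂ*`: for every `N`, both sides agree modulo `ξ^{-(N+1)}`. Modulo
`ξ^{-(N+1)}` they depend on `P` only through its truncation at order `N`. -/
def FormalDiffeo.Conjugates (P : FormalDiffeo) {q : ℂ} (F : NbhdDiffeo q) : Prop :=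
  ∀ N : ℕ, ∀ z : ℂ, z ≠ 0 →
    (fun ξ : ℂ => P.trunc N (F.xi (z, ξ)) - modelMap q (P.trunc N (z, ξ)))
      =O[Bornology.cobounded ℂ] (fun ξ : ℂ => (ξ⁻¹) ^ (N + 1))

/-- `ξ ≠ 0` and some determination of `arg ξ` lies in the open interval `]θ₁, θ₂[`. -/
def ArgMem (θ₁ θ₂ : ℝ) (ξ : ℂ) : Prop :=
  ξ ≠ 0 ∧ ∃ θ : ℝ, θ₁ < θ ∧ θ < θ₂ ∧ ξ = (‖ξ‖ : ℂ) * Complex.exp ((θ : ℂ) * Complex.I)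

/-- The sector `{arg ξ ∈ ]θ₁, θ₂[, |ξ| > R, e^{-c} < |z| < e^c}`. -/
def sector (θ₁ θ₂ R c : ℝ) : Set (ℂ × ℂ) :=
  {p | ArgMem θ₁ θ₂ p.2 ∧ R < ‖p.2‖ ∧ Real.exp (-c) < ‖p.1‖ ∧ ‖p.1‖ < Real.exp c}

/-- Transversely sectorial open sets of opening `]θ₁, θ₂[`. -/
def IsTransverselySectorial (θ₁ θ₂ : ℝ) (S : Set (ℂ × ℂ)) : Prop :=
  IsOpen S ∧ (∀ p ∈ S, p.1 ≠ 0 ∧ ArgMem θ₁ θ₂ p.2) ∧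
    ∀ c > 0, ∀ ε > 0, ∃ R > 0, sector (θ₁ + ε) (θ₂ - ε) R c ⊆ S

/-- `f` has the asymptotic expansion `∑ cₙ(z) ξ⁻ⁿ` along `{ξ = ∞}` on the transversely sectorial
set `S` of opening `]θ₁, θ₂[`. -/
def HasAsymptoticExpansion (θ₁ θ₂ : ℝ) (S : Set (ℂ × ℂ)) (f : ℂ × ℂ → ℂ) (c : ℕ → ℂ → ℂ) :
    Prop :=
  ∀ m : ℕ, ∀ r > 0, ∀ ε > 0, ∃ C > 0, ∃ R > 0,
    sector (θ₁ + ε) (θ₂ - ε) R r ⊆ S ∧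
    ∀ p ∈ sector (θ₁ + ε) (θ₂ - ε) R r, ‖f p - partialSum c m p‖ ≤ C / ‖p.2‖ ^ (m + 1)

/-- `Ψ`, defined on `S`, is a sectorial biholomorphism (onto its image in `ℂ* × ℂ`) of opening
`]θ₁, θ₂[`, asymptotic to the formal diffeomorphism `P`. -/
structure IsSectorialBiholo (θ₁ θ₂ : ℝ) (P : FormalDiffeo) (S : Set (ℂ × ℂ))
    (Ψ : ℂ × ℂ → ℂ × ℂ) : Prop where
  sectorial : IsTransverselySectorial θ₁ θ₂ S
  holo : DifferentiableOn ℂ Ψ S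
  inj : Set.InjOn Ψ S
  ne_zero : ∀ p ∈ S, (Ψ p).1 ≠ 0
  asympt_fst : HasAsymptoticExpansion θ₁ θ₂ S (fun p => (Ψ p).1 - p.1) P.a
  asympt_snd : HasAsymptoticExpansion θ₁ θ₂ S (fun p => (Ψ p).2 - p.2) P.b

/-- `p'` is the `k`-th iterate of `p` under `F`, the whole orbit segment staying in `V`
(`V` in the coordinates `(z, y)`, the points in the coordinates `(z, ξ)`). -/
def OrbitIn {q : ℂ} (F : NbhdDiffeo q) (V : Set (ℂ × ℂ)) (k : ℕ) (p p' : ℂ × ℂ) : Prop :=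
  (∀ j ≤ k, F.xi^[j] p ∈ xiDomain V) ∧ F.xi^[k] p = p'

/-- `Ψ` induces an injective map from the image of `S` in the quotient of a neighborhood of the
curve by `F` to the quotient of `ℂ* × ℂ` by the model map: for some neighborhood `V` of the curve,
two points of `S` lie on one `F`-orbit in `V` exactly when their images lie on one orbit of the
model map, with the same number of iterations. -/
def DescendsInjectively {q : ℂ} (F : NbhdDiffeo q) (S : Set (ℂ × ℂ)) (Ψ : ℂ × ℂ → ℂ × ℂ) :
    Prop :=
  ∃ V : Set (ℂ × ℂ), IsOpen V ∧ V ⊆ F.U ∧ (∀ z : ℂ, z ≠ 0 → (z, (0 : ℂ)) ∈ V) ∧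
    S ⊆ xiDomain V ∧
    ∀ p ∈ S, ∀ p' ∈ S, ∀ k : ℕ, OrbitIn F V k p p' ↔ (modelMap q)^[k] (Ψ p) = Ψ p'

/-- The lower ends `-ϖ, -π, π - ϖ, 0` of the four intervals
`I₁ = ]-ϖ, π - ϖ[`, `I₂ = ]-π, 0[`, `I₃ = I₁ + π`, `I₄ = I₂ + π` for `arg ξ`,
with `ϖ = arg τ`. Each interval has length `π`. -/
def intervalStart (τ : ℂ) : Fin 4 → ℝ :=
  ![-τ.arg, -Real.pi, Real.pi - τ.arg, 0]

end

end EllipticNbhd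

/-! Sectorial normalization of a germ of neighborhood diffeomorphism along `ℂ*`.

On the universal covering `(t, ξ) ↦ (exp (2 π i t), ξ)` the model map becomes the translation
`shift : (t, ξ) ↦ (t + τ, ξ - 1)`. For each of the four intervals there is a pair `(lam, mu)` such
that `level = Im (lam ξ + mu t)` is invariant both under `shift` and under `(t, ξ) ↦ (t + 1, ξ)`,
and that `arg ξ` lies in the interval exactly when `Im (lam ξ) > 0`. All the analysis takes place
at large depth `level` over strips `|Im t| < (n + 1) Im τ`, without uniformity in `n`: sets that
contain all such points are called `Deep`, and estimates valid there `DeepBigO`.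

The Borel–Ritt theorem (`exists_borelRitt`), which holds uniformly up to the boundary of the
half-plane, replaces the formal conjugacy by a holomorphic map `Ph` with the same expansion. It
conjugates the lifted germ to `shift + f`, where `f` is flat, that is, smaller than every power of
`1 / ξ` (`exists_lifts`). To remove `f` one looks for `g` with `g ∘ shift - g = f ∘ (id + g)`, for
then `id + g` conjugates `shift` to `shift + f`.

The linear equation `G ∘ shift - G = h` has an explicit solution. The function `level` is constant
on the leaves of a holomorphic foliation invariant under `shift`: the leaves `τ ξ + t = const`
when `mu = ±1`, and the leaves `ξ = const` when `mu = 0`, where the translates `ξ + n` by all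
integers are taken together. Integrating `h` over the line `Im t = c` of the leaf of `x`, against
a periodic Cauchy kernel, gives a function of `x` that is invariant under `shift` and jumps by `h`
when the line crosses the point (`Solver`, `exists_solver`). The integral over the line just below
the point is the solution `G`, because a line just below `shift x` lies just above `x`. If `t` has
negative imaginary part the line above serves as well, up to the residue, so that only values of `h` at the same depth
and in the same strip are needed. There is thus no loss of domain, and Picard iteration solves the
nonlinear equation on a whole domain `dom R` (`exists_fixedPoint`). Flatness passes to `g`.
Composing the inverse of `id + g` with `Ph` gives the map `Ψ`, with inverse `Θ`, of
`exists_normalization`; both commute with `t ↦ t + 1`, so that they descend to the sectors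
`cover '' (Θ '' dom R)` (`SectorChart`).

It remains to compare orbits. If the images of two points lie on one orbit of the model map, the
segment of that orbit stays in `dom R`, because the admissible heights at a given depth form an
interval; hence it is the image of an orbit segment of the germ
(`SectorChart.orbitIn_of_iterate`). Conversely, the neighborhood `V` of the curve is so thin that
along an orbit of the germ in `V` the height `Im t` increases and the total variation of the depth
is bounded by that of the arctangent of the height (`FormalDiffeo.Conjugates.exists_nbhd`). An
orbit segment whose end point is a little deeper than necessary thus never leaves the domain of
the chart (`SectorChart.iterate_of_orbitIn`). -/

namespace EllipticNbhd

open Complex Metric Set MeasureTheory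
open scoped Topology Interval

/-! ### Holomorphic functions of two variables -/

section Slices

variable {E : Type*} [NormedAddCommGroup E] [NormedSpace ℂ E]

theorem differentiableAt_slice_fst {f : ℂ × ℂ → E} {U : Set (ℂ × ℂ)} (hU : IsOpen U)
    (hf : DifferentiableOn ℂ f U) (p : ℂ × ℂ) (hp : p ∈ U) :
    DifferentiableAt ℂ (fun t => f (t, p.2)) p.1 :=
  DifferentiableAt.comp (g := f) p.1 (hf.differentiableAt (hU.mem_nhds hp)) (by fun_prop)

theorem differentiableAt_slice_snd {f : ℂ × ℂ → E} {U : Set (ℂ × ℂ)} (hU : IsOpen U)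
    (hf : DifferentiableOn ℂ f U) (p : ℂ × ℂ) (hp : p ∈ U) :
    DifferentiableAt ℂ (fun u => f (p.1, u)) p.2 :=
  DifferentiableAt.comp (g := f) p.2 (hf.differentiableAt (hU.mem_nhds hp)) (by fun_prop)

/-- An integral of holomorphic functions of one variable with an integrable bound is holomorphic in
that variable. -/
theorem differentiableAt_integral_one {α : Type*} [MeasurableSpace α] {μ : Measure α}
    {f : ℂ → α → E} {z : ℂ} {V : Set ℂ} (hV : V ∈ 𝓝 z) {b : α → ℝ} (hb : Integrable b μ)
    (hm : ∀ w ∈ V, AEStronglyMeasurable (f w) μ)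
    (hd : ∀ a, DifferentiableOn ℂ (fun w => f w a) V) (hfb : ∀ w ∈ V, ∀ a, ‖f w a‖ ≤ b a) :
    DifferentiableAt ℂ (fun w => ∫ a, f w a ∂μ) z := by
  obtain ⟨r, hr, hrV⟩ := Metric.mem_nhds_iff.1 hV
  have hda : ∀ a, ∀ w ∈ ball z r, DifferentiableAt ℂ (fun w => f w a) w := fun a w hw =>
    (hd a).differentiableAt (mem_of_superset (isOpen_ball.mem_nhds hw) hrV)
  -- the derivative is a limit of difference quotients, hence measurable
  have hmz : AEStronglyMeasurable (fun a => deriv (fun w => f w a) z) μ := by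
    have hx : Tendsto (fun n : ℕ => ((1 / (n + 1) : ℝ) : ℂ)) atTop (𝓝 0) := by
      have := (continuous_ofReal.tendsto 0).comp tendsto_one_div_add_atTop_nhds_zero_nat
      simpa [Function.comp_def] using this
    have hx' : Tendsto (fun n : ℕ => ((1 / (n + 1) : ℝ) : ℂ)) atTop (𝓝[≠] 0) := by
      refine tendsto_nhdsWithin_iff.2 ⟨hx, Eventually.of_forall fun n => ?_⟩
      simp only [mem_compl_iff, mem_singleton_iff, ofReal_eq_zero]
      positivity
    obtain ⟨N, hN⟩ := (hx.eventually (ball_mem_nhds (0 : ℂ) hr)).exists_forall_of_atTop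
    refine aestronglyMeasurable_of_tendsto_ae atTop (f := fun n a =>
      (((1 / ((n + N : ℕ) + 1) : ℝ) : ℂ))⁻¹ • (f (z + ((1 / ((n + N : ℕ) + 1) : ℝ) : ℂ)) a - f z a))
      (fun n => ?_) (Eventually.of_forall fun a => ?_)
    · refine ((hm _ (hrV ?_)).sub (hm _ (hrV (mem_ball_self hr)))).const_smul _
      have := hN (n + N) (by omega)
      simpa [dist_eq_norm] using this
    · have h1 := ((hda a z (mem_ball_self hr)).hasDerivAt.tendsto_slope_zero).comp hx'
      exact h1.comp (tendsto_add_atTop_nat N)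
  refine (hasDerivAt_integral_of_dominated_loc_of_deriv_le (F := f)
    (F' := fun w a => deriv (fun w => f w a) w) (s := ball z (r / 2)) (x₀ := z)
    (bound := fun a => b a / (r / 2)) (ball_mem_nhds _ (by positivity))
    ?_ ?_ hmz ?_ ?_ ?_).2.differentiableAt
  · filter_upwards [hV] with w hw using hm w hw
  · exact hb.mono' (hm z (mem_of_mem_nhds hV))
      (Eventually.of_forall fun a => hfb z (mem_of_mem_nhds hV) a)
  · -- the Cauchy estimate bounds the derivative
    refine Eventually.of_forall fun a w hw => ?_
    have hsub : closedBall w (r / 2) ⊆ ball z r := fun y hy => by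
      have := dist_triangle y w z
      rw [mem_closedBall] at hy
      rw [mem_ball] at hw ⊢
      linarith
    refine Complex.norm_deriv_le_of_forall_mem_sphere_norm_le (by positivity) ?_ ?_
    · refine DifferentiableOn.diffContOnCl ?_
      rw [closure_ball _ (by positivity)]
      exact fun y hy => (hda a y (hsub hy)).differentiableWithinAt
    · exact fun y hy => hfb y (hrV (hsub (sphere_subset_closedBall hy))) a
  · exact hb.div_const _
  · exact Eventually.of_forall fun a w hw =>
      (hda a w (ball_subset_ball (by linarith) hw)).hasDerivAt

variable [CompleteSpace E]

/-- The derivative in the first variable of a continuous function that is holomorphic in the first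
variable is jointly continuous, by the Cauchy estimate. -/
theorem continuousAt_deriv_fst {f : ℂ × ℂ → E} {U : Set (ℂ × ℂ)} (hU : IsOpen U)
    (hc : ContinuousOn f U) (h1 : ∀ p ∈ U, DifferentiableAt ℂ (fun t => f (t, p.2)) p.1)
    {p : ℂ × ℂ} (hp : p ∈ U) :
    ContinuousAt (fun v : ℂ × ℂ => deriv (fun t => f (t, v.2)) v.1) p := by
  obtain ⟨r, hr, hrU⟩ := Metric.nhds_basis_closedBall.mem_iff.1 (hU.mem_nhds hp)
  have hmem : ∀ t u, dist t p.1 ≤ r → dist u p.2 ≤ r → (t, u) ∈ U := fun t u ht hu =>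
    hrU (by rw [mem_closedBall, Prod.dist_eq]; exact max_le ht hu)
  have hdiff : ∀ u, dist u p.2 ≤ r → DifferentiableOn ℂ (fun t => f (t, u)) (ball p.1 r) :=
    fun u hu t ht => (h1 (t, u) (hmem t u (le_of_lt ht) hu)).differentiableWithinAt
  have hcd : ContinuousAt (deriv (fun t => f (t, p.2))) p.1 :=
    (((hdiff p.2 (by simpa using hr.le)).analyticAt (ball_mem_nhds _ hr)).deriv).continuousAt
  have huc : UniformContinuousOn f (closedBall p r) :=
    (isCompact_closedBall p r).uniformContinuousOn_of_continuous (hc.mono hrU)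
  rw [Metric.continuousAt_iff] at hcd ⊢
  intro ε hε
  obtain ⟨δ1, hδ1, H1⟩ := hcd (ε / 2) (half_pos hε)
  obtain ⟨δ2, hδ2, H2⟩ := Metric.uniformContinuousOn_iff.1 huc (ε / 4 * (r / 2)) (by positivity)
  refine ⟨min (min δ1 δ2) (r / 2), by positivity, fun v hv => ?_⟩
  have hv' := hv
  rw [Prod.dist_eq] at hv
  simp only [lt_min_iff, max_lt_iff] at hv
  obtain ⟨⟨hv1, hv2⟩, hv3⟩ := hv
  have hv2r : dist v.2 p.2 ≤ r := by linarith
  have hd : ∀ u, dist u p.2 ≤ r → DifferentiableAt ℂ (fun t => f (t, u)) v.1 := fun u hu =>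
    h1 (v.1, u) (hmem v.1 u (by linarith) hu)
  have key : ‖deriv (fun t => f (t, v.2)) v.1 - deriv (fun t => f (t, p.2)) v.1‖ ≤ ε / 4 := by
    rw [← deriv_fun_sub (hd _ hv2r) (hd p.2 (by simpa using hr.le))]
    have := Complex.norm_deriv_le_of_forall_mem_sphere_norm_le (c := v.1) (R := r / 2)
      (C := ε / 4 * (r / 2)) (f := fun t => f (t, v.2) - f (t, p.2)) (by positivity) ?_ ?_
    · rwa [mul_div_cancel_right₀ _ (by positivity)] at this
    · refine DifferentiableOn.diffContOnCl ?_
      rw [closure_ball _ (by positivity)]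
      intro t ht
      have ht' : dist t p.1 ≤ r := by
        have := dist_triangle t v.1 p.1
        rw [mem_closedBall] at ht
        linarith
      exact ((h1 (t, v.2) (hmem _ _ ht' hv2r)).sub
        (h1 (t, p.2) (hmem _ _ ht' (by simpa using hr.le)))).differentiableWithinAt
    · intro t ht
      have ht' : dist t p.1 ≤ r := by
        have := dist_triangle t v.1 p.1
        rw [mem_sphere] at ht
        linarith
      rw [← dist_eq_norm]
      refine (H2 (t, v.2) ?_ (t, p.2) ?_ ?_).le
      · rw [mem_closedBall, Prod.dist_eq]; exact max_le ht' hv2r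
      · rw [mem_closedBall, Prod.dist_eq]; exact max_le ht' (by simpa using hr.le)
      · rw [Prod.dist_eq]; simpa using hv2.2
  have := H1 hv1.1
  calc dist (deriv (fun t => f (t, v.2)) v.1) (deriv (fun t => f (t, p.2)) p.1)
      ≤ dist (deriv (fun t => f (t, v.2)) v.1) (deriv (fun t => f (t, p.2)) v.1)
        + dist (deriv (fun t => f (t, p.2)) v.1) (deriv (fun t => f (t, p.2)) p.1) :=
        dist_triangle _ _ _
    _ ≤ ε / 4 + dist (deriv (fun t => f (t, p.2)) v.1) (deriv (fun t => f (t, p.2)) p.1) := by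
        gcongr; rw [dist_eq_norm]; exact key
    _ < ε := by linarith

/-- **Osgood's lemma**: a continuous, separately holomorphic function of two variables is
holomorphic. -/
theorem differentiableOn_of_slices {f : ℂ × ℂ → E} {U : Set (ℂ × ℂ)} (hU : IsOpen U)
    (hc : ContinuousOn f U) (h1 : ∀ p ∈ U, DifferentiableAt ℂ (fun t => f (t, p.2)) p.1)
    (h2 : ∀ p ∈ U, DifferentiableAt ℂ (fun u => f (p.1, u)) p.2) :
    DifferentiableOn ℂ f U := by
  intro p hp
  have c1 := continuousAt_deriv_fst hU hc h1 hp
  have hU' : IsOpen (Prod.swap ⁻¹' U : Set (ℂ × ℂ)) := hU.preimage continuous_swap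
  have c2' := continuousAt_deriv_fst (f := f ∘ Prod.swap) (p := p.swap) hU'
    (hc.comp continuous_swap.continuousOn (fun x hx => hx)) (fun q hq => h2 q.swap hq) (by simpa)
  have c2 : ContinuousAt (fun v : ℂ × ℂ => deriv (fun u => f (v.1, u)) v.2) p :=
    ContinuousAt.comp (f := Prod.swap) (g := fun v : ℂ × ℂ =>
      deriv (fun t => (f ∘ Prod.swap) (t, v.2)) v.1) (by simpa using c2')
      continuous_swap.continuousAt
  have := hasStrictFDerivAt_uncurry_coprod (𝕜 := ℂ) (u := p) (f := fun t u => f (t, u))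
    (f₁ := fun t u => ContinuousLinearMap.toSpanSingleton ℂ (deriv (fun t => f (t, u)) t))
    (f₂ := fun t u => ContinuousLinearMap.toSpanSingleton ℂ (deriv (fun u => f (t, u)) u))
    (by filter_upwards [hU.mem_nhds hp] with v hv using (h1 v hv).hasDerivAt.hasFDerivAt)
    (by filter_upwards [hU.mem_nhds hp] with v hv using (h2 v hv).hasDerivAt.hasFDerivAt)
    (by exact (ContinuousLinearMap.toSpanSingletonCLE (𝕜 := ℂ)
      (E := E)).continuous.continuousAt.comp c1)
    (by exact (ContinuousLinearMap.toSpanSingletonCLE (𝕜 := ℂ)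
      (E := E)).continuous.continuousAt.comp c2)
  exact this.hasFDerivAt.differentiableAt.differentiableWithinAt

/-- A locally uniform limit of holomorphic functions of two variables is holomorphic. -/
theorem differentiableOn_of_tendstoLocallyUniformlyOn {ι : Type*} {l : Filter ι} [l.NeBot]
    {f : ι → ℂ × ℂ → E} {g : ℂ × ℂ → E} {U : Set (ℂ × ℂ)} (hU : IsOpen U)
    (hf : ∀ i, DifferentiableOn ℂ (f i) U) (h : TendstoLocallyUniformlyOn f g l U) :
    DifferentiableOn ℂ g U := by
  refine differentiableOn_of_slices hU
    (h.continuousOn (Eventually.of_forall fun i => (hf i).continuousOn).frequently) ?_ ?_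
  · intro p hp
    have hV : IsOpen ((fun t => (t, p.2)) ⁻¹' U : Set ℂ) := hU.preimage (by fun_prop)
    have h' := h.comp (fun t : ℂ => (t, p.2)) (t := (fun t => (t, p.2)) ⁻¹' U) (fun t ht => ht)
      (by fun_prop)
    exact (h'.differentiableOn (Eventually.of_forall fun i t ht =>
      (differentiableAt_slice_fst hU (hf i) (t, p.2) ht).differentiableWithinAt) hV).differentiableAt
      (hV.mem_nhds hp)
  · intro p hp
    have hV : IsOpen ((fun t => (p.1, t)) ⁻¹' U : Set ℂ) := hU.preimage (by fun_prop)
    have h' := h.comp (fun t : ℂ => (p.1, t)) (t := (fun t => (p.1, t)) ⁻¹' U) (fun t ht => ht)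
      (by fun_prop)
    exact (h'.differentiableOn (Eventually.of_forall fun i t ht =>
      (differentiableAt_slice_snd hU (hf i) (p.1, t) ht).differentiableWithinAt) hV).differentiableAt
      (hV.mem_nhds hp)

/-- An integral of holomorphic functions of two variables with an integrable bound is
holomorphic. -/
theorem differentiableOn_integral {α : Type*} [MeasurableSpace α] {μ : Measure α}
    {f : ℂ × ℂ → α → E} {U : Set (ℂ × ℂ)} (hU : IsOpen U) {b : α → ℝ} (hb : Integrable b μ)
    (hm : ∀ w ∈ U, AEStronglyMeasurable (f w) μ)
    (hd : ∀ a, DifferentiableOn ℂ (fun w => f w a) U) (hfb : ∀ w ∈ U, ∀ a, ‖f w a‖ ≤ b a) :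
    DifferentiableOn ℂ (fun w => ∫ a, f w a ∂μ) U := by
  refine differentiableOn_of_slices hU ?_ ?_ ?_
  · exact continuousOn_of_dominated hm (fun w hw => Eventually.of_forall (hfb w hw)) hb
      (Eventually.of_forall fun a => (hd a).continuousOn)
  · intro p hp
    have hV : IsOpen ((fun t => (t, p.2)) ⁻¹' U : Set ℂ) := hU.preimage (by fun_prop)
    exact differentiableAt_integral_one (f := fun t a => f (t, p.2) a) (hV.mem_nhds hp) hb
      (fun w hw => hm _ hw) (fun a t ht =>
        (differentiableAt_slice_fst hU (hd a) (t, p.2) ht).differentiableWithinAt)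
      (fun w hw a => hfb _ hw a)
  · intro p hp
    have hV : IsOpen ((fun t => (p.1, t)) ⁻¹' U : Set ℂ) := hU.preimage (by fun_prop)
    exact differentiableAt_integral_one (f := fun t a => f (p.1, t) a) (hV.mem_nhds hp) hb
      (fun w hw => hm _ hw) (fun a t ht =>
        (differentiableAt_slice_snd hU (hd a) (p.1, t) ht).differentiableWithinAt)
      (fun w hw a => hfb _ hw a)

end Slices

/-! ### The Schwarz lemma and the Cauchy formula for rectangles -/

section OneVariable

variable {E : Type*} [NormedAddCommGroup E] [NormedSpace ℂ E] [CompleteSpace E]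

/-- A Schwarz lemma of order `k` on a punctured disc. It turns pointwise order statements into
bounds that are uniform in parameters. -/
theorem norm_le_of_isBigO_pow {f : ℂ → E} {r M : ℝ} {k : ℕ}
    (hd : DifferentiableOn ℂ f (ball 0 r \ {0})) (hb : ∀ y ∈ ball (0 : ℂ) r, y ≠ 0 → ‖f y‖ ≤ M)
    (ho : f =O[𝓝[≠] 0] (fun y => y ^ k)) {y : ℂ} (hy : y ∈ ball (0 : ℂ) r) (hy0 : y ≠ 0) :
    ‖f y‖ ≤ M * (‖y‖ / r) ^ k := by
  have hr : 0 < r := nonempty_ball.1 ⟨y, hy⟩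
  obtain _ | n := k
  · simpa using hb y hy hy0
  have hM : 0 ≤ M := (norm_nonneg _).trans (hb y hy hy0)
  have hpow : ∀ m : ℕ, Tendsto (fun y : ℂ => y ^ (m + 1)) (𝓝[≠] 0) (𝓝 0) := fun m => by
    have : Continuous (fun y : ℂ => y ^ (m + 1)) := by fun_prop
    simpa using (this.tendsto 0).mono_left nhdsWithin_le_nhds
  have hf0 : Tendsto f (𝓝[≠] 0) (𝓝 0) := ho.trans_tendsto (hpow n)
  -- the singularity at the origin is removable, with value `0`
  set g : ℂ → E := Function.update f 0 0 with hg
  have hgf : ∀ y, y ≠ 0 → g y = f y := fun y hy => by simp [hg, hy]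
  have hg0 : g 0 = 0 := by simp [hg]
  have hgc : ContinuousAt g 0 := continuousAt_update_same.2 hf0
  have hgd : DifferentiableOn ℂ g (ball 0 r) :=
    (Complex.differentiableOn_compl_singleton_and_continuousAt_iff (ball_mem_nhds _ hr)).1
      ⟨hd.congr fun y hy => hgf y (by simpa using hy.2), hgc⟩
  have h := Complex.dist_le_mul_div_pow_of_mapsTo_ball_of_isLittleO (n := n) (R₂ := M) hgd ?_ ?_ hy
  · rw [hg0, dist_zero_right, dist_zero_right, hgf y hy0] at h
    exact h
  · intro z hz
    rw [hg0, mem_closedBall, dist_zero_right]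
    rcases eq_or_ne z 0 with rfl | hz0
    · simpa [hg0] using hM
    · rw [hgf z hz0]; exact hb z hz hz0
  · simp only [hg0, sub_zero]
    have h1 : (fun y : ℂ => y ^ (n + 1)) =o[𝓝 0] (fun w : ℂ => ‖w‖ ^ n) := by
      have := (isLittleO_pow_pow (𝕜 := ℂ) (Nat.lt_succ_self n)).norm_right
      simpa using this
    refine IsBigO.trans_isLittleO ?_ h1
    have h2 : g =O[𝓝[≠] 0] (fun y => y ^ (n + 1)) :=
      ho.congr' (by filter_upwards [self_mem_nhdsWithin] with z hz using (hgf z hz).symm)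
        EventuallyEq.rfl
    rw [isBigO_iff] at h2 ⊢
    obtain ⟨C, hC⟩ := h2
    refine ⟨C, ?_⟩
    rw [eventually_nhdsWithin_iff] at hC
    filter_upwards [hC] with z hz
    rcases eq_or_ne z 0 with rfl | hz0
    · simp [hg0]
    · exact hz hz0

/-- The winding number of a rectangle around the origin. -/
theorem integral_boundary_rect_inv {a b c d : ℝ} (ha : a < 0) (hb : 0 < b) (hc : c < 0)
    (hd : 0 < d) :
    (∫ x : ℝ in a..b, (x + c * I : ℂ)⁻¹) - (∫ x : ℝ in a..b, (x + d * I : ℂ)⁻¹) +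
      I * (∫ y : ℝ in c..d, (b + y * I : ℂ)⁻¹) - I * (∫ y : ℝ in c..d, (a + y * I : ℂ)⁻¹) =
      2 * Real.pi * I := by
  have hor : ∀ e : ℝ, e ≠ 0 → (∫ x : ℝ in a..b, (x + e * I : ℂ)⁻¹) =
      log (b + e * I) - log (a + e * I) := by
    intro e he
    refine intervalIntegral.integral_eq_sub_of_hasDerivAt (f := fun x : ℝ => log (x + e * I))
      (fun x _ => ?_) ?_
    · have h1 : HasDerivAt (fun x : ℝ => (x + e * I : ℂ)) 1 x :=
        (hasDerivAt_id x).ofReal_comp.add_const _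
      have h2 := h1.clog_real (by rw [mem_slitPlane_iff]; right; simpa using he)
      simpa using h2
    · refine (ContinuousOn.inv₀ (by fun_prop) fun x _ h => he ?_).intervalIntegrable
      simpa using congrArg Complex.im h
  -- the sign `s` moves the vertical side off the branch cut of the logarithm
  have hver : ∀ s e : ℝ, 0 < s * e → s ^ 2 = 1 → I * (∫ y : ℝ in c..d, (e + y * I : ℂ)⁻¹) =
      log (s * (e + d * I)) - log (s * (e + c * I)) := by
    intro s e he hs
    have hs0 : (s : ℂ) ≠ 0 := by
      intro h; rw [ofReal_eq_zero] at h; simp [h] at hs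
    rw [← intervalIntegral.integral_const_mul]
    refine intervalIntegral.integral_eq_sub_of_hasDerivAt
      (f := fun y : ℝ => log (s * (e + y * I))) (fun x _ => ?_) ?_
    · have h1 : HasDerivAt (fun y : ℝ => (s * (e + y * I) : ℂ)) (s * I) x := by
        have := (((hasDerivAt_id x).ofReal_comp.mul_const I).const_add (e : ℂ)).const_mul (s : ℂ)
        simpa using this
      have h2 := h1.clog_real (by rw [mem_slitPlane_iff]; left; simpa using he)
      rwa [mul_div_mul_left _ _ hs0, div_eq_mul_inv] at h2
    · refine (ContinuousOn.mul continuousOn_const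
        (ContinuousOn.inv₀ (by fun_prop) fun x _ h => ?_)).intervalIntegrable
      have : e = 0 := by simpa using congrArg Complex.re h
      simp [this] at he
  have h1 := hver 1 b (by simpa using hb) (by norm_num)
  have h2 := hver (-1) a (by linarith) (by norm_num)
  have hl1 : log (-(a + d * I)) = log (a + d * I) - Real.pi * I := by
    rw [log, log, arg_neg_eq_arg_sub_pi_of_im_pos (by simpa using hd), norm_neg]
    push_cast; ring
  have hl2 : log (-(a + c * I)) = log (a + c * I) + Real.pi * I := by
    rw [log, log, arg_neg_eq_arg_add_pi_of_im_neg (by simpa using hc), norm_neg]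
    push_cast; ring
  rw [hor c hc.ne, hor d hd.ne', h1, h2]
  push_cast
  rw [neg_one_mul, neg_one_mul, one_mul, one_mul, hl1, hl2]
  ring

/-- The **Cauchy integral formula** for a rectangle. -/
theorem integral_boundary_rect_sub_inv_smul {f : ℂ → E} {t : ℂ} {a b c d : ℝ} (ha : a < t.re)
    (hb : t.re < b) (hc : c < t.im) (hd : t.im < d)
    (hf : DifferentiableOn ℂ f ([[a, b]] ×ℂ [[c, d]])) :
    (∫ x : ℝ in a..b, (x + c * I - t)⁻¹ • f (x + c * I)) -
      (∫ x : ℝ in a..b, (x + d * I - t)⁻¹ • f (x + d * I)) +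
      I • (∫ y : ℝ in c..d, (b + y * I - t)⁻¹ • f (b + y * I)) -
      I • (∫ y : ℝ in c..d, (a + y * I - t)⁻¹ • f (a + y * I)) = (2 * Real.pi * I : ℂ) • f t := by
  have hab : a < b := ha.trans hb
  have hcd : c < d := hc.trans hd
  have hnhds : [[a, b]] ×ℂ [[c, d]] ∈ 𝓝 t := by
    rw [uIcc_of_le hab.le, uIcc_of_le hcd.le]
    refine mem_of_superset ((isOpen_Ioo.reProdIm isOpen_Ioo).mem_nhds
      (show t ∈ Ioo a b ×ℂ Ioo c d from ⟨⟨ha, hb⟩, ⟨hc, hd⟩⟩)) ?_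
    exact fun z hz => ⟨Ioo_subset_Icc_self hz.1, Ioo_subset_Icc_self hz.2⟩
  have hds : DifferentiableOn ℂ (dslope f t) ([[a, b]] ×ℂ [[c, d]]) :=
    (differentiableOn_dslope hnhds).2 hf
  -- split off the pole: `f s / (s - t) = dslope f t s + f t / (s - t)`
  have h0 := Complex.integral_boundary_rect_eq_zero_of_differentiableOn (dslope f t)
    (a + c * I) (b + d * I) (by simpa using hds)
  simp only [add_re, ofReal_re, mul_re, I_re, mul_zero, ofReal_im, I_im, mul_one, sub_self, add_zero,
    add_im, mul_im, zero_add] at h0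
  have hsplit : ∀ s : ℂ, s ≠ t → (s - t)⁻¹ • f s = dslope f t s + (s - t)⁻¹ • f t := by
    intro s hs
    rw [dslope_of_ne _ hs, slope_def_module, ← smul_add, sub_add_cancel]
  have hhor : ∀ e : ℝ, e ∈ [[c, d]] → e ≠ t.im →
      (∫ x : ℝ in a..b, (x + e * I - t)⁻¹ • f (x + e * I)) =
      (∫ x : ℝ in a..b, dslope f t (x + e * I)) + (∫ x : ℝ in a..b, (x + e * I - t)⁻¹) • f t := by
    intro e he het
    have hne : ∀ x : ℝ, (x + e * I : ℂ) ≠ t := fun x h => het (by simpa using congrArg Complex.im h)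
    rw [← intervalIntegral.integral_smul_const, ← intervalIntegral.integral_add]
    · exact intervalIntegral.integral_congr fun x _ => hsplit _ (hne x)
    · refine (hds.continuousOn.comp (by fun_prop) fun x hx => ?_).intervalIntegrable
      rw [mem_reProdIm]; simpa using ⟨hx, he⟩
    · refine (ContinuousOn.smul (ContinuousOn.inv₀ (by fun_prop) fun x _ => ?_)
        continuousOn_const).intervalIntegrable
      exact sub_ne_zero.2 (hne x)
  have hver : ∀ e : ℝ, e ∈ [[a, b]] → e ≠ t.re →
      (∫ y : ℝ in c..d, (e + y * I - t)⁻¹ • f (e + y * I)) =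
      (∫ y : ℝ in c..d, dslope f t (e + y * I)) + (∫ y : ℝ in c..d, (e + y * I - t)⁻¹) • f t := by
    intro e he het
    have hne : ∀ x : ℝ, (e + x * I : ℂ) ≠ t := fun x h => het (by simpa using congrArg Complex.re h)
    rw [← intervalIntegral.integral_smul_const, ← intervalIntegral.integral_add]
    · exact intervalIntegral.integral_congr fun x _ => hsplit _ (hne x)
    · refine (hds.continuousOn.comp (by fun_prop) fun x hx => ?_).intervalIntegrable
      rw [mem_reProdIm]; simpa using ⟨he, hx⟩
    · refine (ContinuousOn.smul (ContinuousOn.inv₀ (by fun_prop) fun x _ => ?_)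
        continuousOn_const).intervalIntegrable
      exact sub_ne_zero.2 (hne x)
  have hw := integral_boundary_rect_inv (a := a - t.re) (b := b - t.re) (c := c - t.im)
    (d := d - t.im) (by linarith) (by linarith) (by linarith) (by linarith)
  have hshift : ∀ e : ℝ, (∫ x : ℝ in (a - t.re)..(b - t.re), (x + (e - t.im : ℝ) * I : ℂ)⁻¹) =
      ∫ x : ℝ in a..b, (x + e * I - t)⁻¹ := by
    intro e
    rw [← intervalIntegral.integral_comp_sub_right (fun x : ℝ => (x + (e - t.im : ℝ) * I : ℂ)⁻¹)]
    refine intervalIntegral.integral_congr fun x _ => ?_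
    congr 1
    apply Complex.ext <;> simp
  have hshift' : ∀ e : ℝ, (∫ x : ℝ in (c - t.im)..(d - t.im), ((e - t.re : ℝ) + x * I : ℂ)⁻¹) =
      ∫ x : ℝ in c..d, (e + x * I - t)⁻¹ := by
    intro e
    rw [← intervalIntegral.integral_comp_sub_right (fun x : ℝ => ((e - t.re : ℝ) + x * I : ℂ)⁻¹)]
    refine intervalIntegral.integral_congr fun x _ => ?_
    congr 1
    apply Complex.ext <;> simp
  rw [hshift, hshift, hshift', hshift'] at hw
  rw [hhor c left_mem_uIcc hc.ne, hhor d right_mem_uIcc hd.ne', hver b right_mem_uIcc hb.ne',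
    hver a left_mem_uIcc ha.ne, ← hw]
  simp only [smul_add, add_smul, sub_smul, mul_smul]
  rw [← sub_eq_zero] at h0 ⊢
  rw [← h0]
  abel

end OneVariable

/-! ### Inversion of perturbations of the identity -/

section NearIdentity

variable {E : Type*} [NormedAddCommGroup E] [NormedSpace ℂ E]

/-- By the Schwarz lemma, a holomorphic map bounded by `B` is Lipschitz with constant `2 B / r` at
points at distance `r` from the boundary. -/
theorem norm_sub_le_of_bound {F : Type*} [NormedAddCommGroup F] [NormedSpace ℂ F] {g : E → F}
    {x y : E} {r B : ℝ} (hg : DifferentiableOn ℂ g (ball x r)) (hb : ∀ w ∈ ball x r, ‖g w‖ ≤ B)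
    (hy : y ∈ ball x r) : ‖g y - g x‖ ≤ 2 * B / r * ‖y - x‖ := by
  have hr : 0 < r := nonempty_ball.1 ⟨y, hy⟩
  have := Complex.dist_le_div_mul_dist_of_mapsTo_ball (R₂ := 2 * B) hg (fun w hw => by
    rw [mem_closedBall, dist_eq_norm]
    have := norm_sub_le (g w) (g x)
    linarith [hb w hw, hb x (mem_ball_self hr)]) hy
  simpa [dist_eq_norm] using this

/-- A holomorphic perturbation `id + g` of the identity with `‖g‖ ≤ 1 / 8` on an open set has a
holomorphic inverse at the points whose unit ball lies in that set. -/
theorem exists_inverse_near_id [CompleteSpace E] {Ω : Set E} {g : E → E}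
    (hg : DifferentiableOn ℂ g Ω) (hb : ∀ x ∈ Ω, ‖g x‖ ≤ 1 / 8) :
    ∃ J : E → E,
      (∀ y, closedBall y 1 ⊆ Ω → ‖J y - y‖ ≤ 1 / 8 ∧ J y + g (J y) = y) ∧
      (∀ x, ball x (1 / 2) ⊆ Ω → closedBall (x + g x) 1 ⊆ Ω → J (x + g x) = x) ∧
      DifferentiableOn ℂ J (interior {y | closedBall y 1 ⊆ Ω}) := by
  have hlip : ∀ x y, ball x (1 / 2) ⊆ Ω → y ∈ ball x (1 / 2) →
      ‖g y - g x‖ ≤ 1 / 2 * ‖y - x‖ := fun x y hx hy => by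
    have := norm_sub_le_of_bound (hg.mono hx) (fun w hw => hb w (hx hw)) hy
    norm_num at this ⊢
    exact this
  have hinj : ∀ x y, ball x (1 / 2) ⊆ Ω → y ∈ Ω → x + g x = y + g y → y = x := by
    intro x y hx hy h
    have h1 : y - x = g x - g y := by
      rw [sub_eq_sub_iff_add_eq_add, ← h, add_comm]
    have hxΩ : x ∈ Ω := hx (mem_ball_self (by norm_num))
    have h2 : ‖y - x‖ ≤ 1 / 4 := by
      rw [h1]
      have := norm_sub_le (g x) (g y)
      linarith [hb x hxΩ, hb y hy]
    have h3 := hlip x y hx (by rw [mem_ball, dist_eq_norm]; linarith)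
    rw [norm_sub_rev, ← h1] at h3
    have : ‖y - x‖ = 0 := le_antisymm (by linarith) (norm_nonneg _)
    exact sub_eq_zero.1 (norm_eq_zero.1 this)
  have hsub : ∀ y, closedBall y 1 ⊆ Ω → ∀ x, ‖x - y‖ ≤ 1 / 8 → ball x (1 / 2) ⊆ Ω := by
    intro y hy x hx w hw
    refine hy ?_
    have := dist_triangle w x y
    rw [mem_ball] at hw
    rw [mem_closedBall]
    rw [← dist_eq_norm] at hx
    linarith
  have hex : ∀ y, closedBall y 1 ⊆ Ω → ∃ x, ‖x - y‖ ≤ 1 / 8 ∧ x + g x = y := by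
    intro y hy
    -- the inverse at `y` is the fixed point of the contraction `x ↦ y - g x`
    have hmaps : MapsTo (fun x => y - g x) (closedBall y (1 / 8)) (closedBall y (1 / 8)) := by
      intro x hx
      have hx' : x ∈ Ω := hy (closedBall_subset_closedBall (by norm_num) hx)
      simpa [mem_closedBall, dist_eq_norm] using hb x hx'
    have hcw : ContractingWith (1 / 2) (hmaps.restrict _ _ _) := by
      refine ⟨by rw [← NNReal.coe_lt_coe]; norm_num, LipschitzWith.of_dist_le_mul ?_⟩
      rintro ⟨x, hx⟩ ⟨w, hw⟩
      rw [mem_closedBall, dist_eq_norm] at hx hw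
      rw [Subtype.dist_eq, Subtype.dist_eq]
      simp only [MapsTo.val_restrict_apply, dist_eq_norm, sub_sub_sub_cancel_left]
      have := hlip x w (hsub y hy x hx) (by
        rw [mem_ball, dist_eq_norm]
        have := norm_sub_le (w - y) (x - y)
        rw [sub_sub_sub_cancel_right] at this
        linarith)
      rw [norm_sub_rev x w]
      simpa using this
    obtain ⟨x, hx, hfix, -⟩ := hcw.exists_fixedPoint' isClosed_closedBall.isComplete hmaps
      (x := y) (mem_closedBall_self (by norm_num)) (edist_ne_top _ _)
    refine ⟨x, by simpa [dist_eq_norm] using hx, ?_⟩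
    have : y - g x = x := hfix
    exact (sub_eq_iff_eq_add.1 this).symm
  choose! J hJ using hex
  refine ⟨J, hJ, fun x hx hy => ?_, ?_⟩
  · have h := hJ _ hy
    exact hinj x _ hx (hsub _ hy _ h.1 (mem_ball_self (by norm_num))) h.2.symm
  · intro y hy
    have hy1 : closedBall y 1 ⊆ Ω := interior_subset hy
    have hb1 := hsub _ hy1 _ (hJ y hy1).1
    have hnear : ∀ᶠ w in 𝓝 y, closedBall w 1 ⊆ Ω := mem_interior_iff_mem_nhds.1 hy
    have hcont : ContinuousAt J y := by
      rw [Metric.continuousAt_iff]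
      intro ε hε
      obtain ⟨δ, hδ, H⟩ := Metric.eventually_nhds_iff.1 hnear
      refine ⟨min (min δ (1 / 8)) (ε / 2), by positivity, fun w hw => ?_⟩
      simp only [lt_min_iff] at hw
      obtain ⟨⟨hw1, hw2⟩, hw3⟩ := hw
      have hJw := hJ w (H hw1)
      have hJy := hJ y hy1
      have e1 : J w - J y = (w - y) - (g (J w) - g (J y)) := by
        have := hJw.2; have h2 := hJy.2
        rw [← sub_eq_zero]
        rw [← sub_eq_zero] at this h2
        calc _ = (J w + g (J w) - w) - (J y + g (J y) - y) := by abel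
          _ = 0 := by rw [this, h2, sub_zero]
      have hclose : ‖J w - J y‖ < 1 / 2 := by
        have : J w - J y = (J w - w) - (J y - y) + (w - y) := by abel
        rw [this]
        have h1 := norm_add_le ((J w - w) - (J y - y)) (w - y)
        have h2 := norm_sub_le (J w - w) (J y - y)
        rw [dist_eq_norm] at hw2
        linarith [hJw.1, hJy.1]
      have h3 := hlip (J y) (J w) hb1 (by rwa [mem_ball, dist_eq_norm])
      have h4 := norm_sub_le (w - y) (g (J w) - g (J y))
      rw [← e1] at h4
      rw [dist_eq_norm] at hw3 ⊢
      linarith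
    have hgd : DifferentiableAt ℂ g (J y) :=
      hg.differentiableAt (mem_of_superset (ball_mem_nhds _ (by norm_num)) hb1)
    have hn : ‖fderiv ℂ g (J y)‖ ≤ 1 / 2 := by
      have := Complex.norm_fderiv_le_div_of_mapsTo_ball (R₂ := 1 / 4) (hg.mono hb1) (fun w hw => by
        rw [mem_closedBall, dist_eq_norm]
        have := norm_sub_le (g w) (g (J y))
        linarith [hb w (hb1 hw), hb _ (hb1 (mem_ball_self (x := J y) (by norm_num)))]) (by norm_num)
      norm_num at this ⊢
      exact this
    set u : (E →L[ℂ] E)ˣ := Units.oneSub (-fderiv ℂ g (J y)) (by rw [norm_neg]; linarith) with hu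
    have hder : HasFDerivAt (fun x => x + g x)
        ((ContinuousLinearEquiv.unitsEquiv ℂ E u : E ≃L[ℂ] E) : E →L[ℂ] E) (J y) := by
      have h := (hasFDerivAt_id (𝕜 := ℂ) (J y)).add hgd.hasFDerivAt
      have hval : ((ContinuousLinearEquiv.unitsEquiv ℂ E u : E ≃L[ℂ] E) : E →L[ℂ] E) =
          ContinuousLinearMap.id ℂ E + fderiv ℂ g (J y) := by
        ext v
        have : (u : E →L[ℂ] E) v = v + fderiv ℂ g (J y) v := by simp [hu]
        simpa using this
      rw [hval]
      exact h
    refine (HasFDerivAt.of_local_left_inverse hcont hder ?_).differentiableAt.differentiableWithinAt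
    filter_upwards [hnear] with w hw using (hJ w hw).2

end NearIdentity

/-! ### Invariant domains on the covering -/

section Domains

/-- The four pairs `(lam, mu)`, one for each interval, such that the imaginary part of
`lam * ξ + mu * t` is invariant under `(t, ξ) ↦ (t + 1, ξ)` and `(t, ξ) ↦ (t + τ, ξ - 1)`. -/
def IsDirection (τ lam : ℂ) (mu : ℝ) : Prop :=
  (mu = 0 ∧ (lam = 1 ∨ lam = -1)) ∨ ((mu = 1 ∨ mu = -1) ∧ lam = mu * τ)

/-- The depth `Im (lam ξ + mu t)` of a point `(t, ξ)` in the half-plane attached to a direction. -/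
def level (lam : ℂ) (mu : ℝ) (x : ℂ × ℂ) : ℝ := (lam * x.2 + mu * x.1).im

/-- The lift of the model map to the coordinates `(t, ξ)`, where `z = exp (2 π i t)`. -/
def shift (τ : ℂ) (x : ℂ × ℂ) : ℂ × ℂ := (x.1 + τ, x.2 - 1)

/-- The line `Im t = c` is admissible at depth `v` for the profile `R`: its points of depth `v`
belong to `dom τ lam mu R`. -/
def Adm (τ : ℂ) (R : ℕ → ℝ) (c v : ℝ) : Prop := ∃ n : ℕ, |c| < (n + 1) * τ.im ∧ R n < v

/-- The points `(t, ξ)` of depth greater than `R n` in the strip `|Im t| < (n + 1) Im τ`, for some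
`n`. The profile `R` governs how deep the points of each strip have to be. -/
def dom (τ lam : ℂ) (mu : ℝ) (R : ℕ → ℝ) : Set (ℂ × ℂ) :=
  {x | Adm τ R x.1.im (level lam mu x)}

variable {τ lam : ℂ} {mu : ℝ} {R : ℕ → ℝ}

theorem continuous_level : Continuous (level lam mu) := by
  unfold level; fun_prop

theorem isOpen_dom : IsOpen (dom τ lam mu R) := by
  have : dom τ lam mu R =
      ⋃ n : ℕ, {x | |x.1.im| < (n + 1) * τ.im} ∩ {x | R n < level lam mu x} := by
    ext x; simp [dom, Adm]
  rw [this]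
  refine isOpen_iUnion fun n => IsOpen.inter ?_ ?_
  · exact isOpen_lt (by fun_prop) continuous_const
  · exact isOpen_lt continuous_const continuous_level

theorem level_add_one (x : ℂ × ℂ) : level lam mu (x.1 + 1, x.2) = level lam mu x := by
  simp [level]

theorem level_shift (hd : IsDirection τ lam mu) (x : ℂ × ℂ) :
    level lam mu (shift τ x) = level lam mu x := by
  obtain ⟨rfl, rfl | rfl⟩ | ⟨rfl | rfl, rfl⟩ := hd <;> simp [level, shift] <;> ring

theorem IsDirection.ne_zero (hτ : 0 < τ.im) (hd : IsDirection τ lam mu) : lam ≠ 0 := by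
  have h0 : τ ≠ 0 := fun h => by simp [h] at hτ
  obtain ⟨rfl, rfl | rfl⟩ | ⟨rfl | rfl, rfl⟩ := hd <;> simp [h0]

theorem IsDirection.abs_mu_le (hd : IsDirection τ lam mu) : |mu| ≤ 1 := by
  obtain ⟨rfl, rfl | rfl⟩ | ⟨rfl | rfl, rfl⟩ := hd <;> simp

theorem mem_dom_add_one {x : ℂ × ℂ} :
    (x.1 + 1, x.2) ∈ dom τ lam mu R ↔ x ∈ dom τ lam mu R := by
  simp [dom, level_add_one]

/-- `R n` exceeds twice the width of the `n`-th strip, so that `ξ` is comparable with the depth. -/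
def Steep (τ : ℂ) (R : ℕ → ℝ) : Prop := ∀ n : ℕ, 2 * ((n + 1) * τ.im) + 2 ≤ R n

theorem Adm.le_level (hR : Steep τ R) {c v : ℝ} (h : Adm τ R c v) : 2 * |c| + 2 ≤ v := by
  obtain ⟨n, h1, h2⟩ := h
  linarith [hR n]

/-- The right-hand sides for which the difference equation is solved: holomorphic functions on
`dom R`, `1`-periodic in `t`, and bounded by `A |ξ|⁻²`, which makes their integrals over lines
converge. -/
structure Nice (τ lam : ℂ) (mu : ℝ) (R : ℕ → ℝ) (h : ℂ × ℂ → ℂ × ℂ) (A : ℝ) : Prop where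
  nonneg : 0 ≤ A
  holo : DifferentiableOn ℂ h (dom τ lam mu R)
  period : ∀ x ∈ dom τ lam mu R, h (x.1 + 1, x.2) = h x
  bound : ∀ x ∈ dom τ lam mu R, ‖h x‖ ≤ A / ‖x.2‖ ^ 2

end Domains

/-! ### The periodic kernel -/

section Kernel

/-- The `1`-periodic kernel with simple poles of residue `-1 / (2 π i)` at the integers, which is
bounded at both ends of the cylinder `ℂ / ℤ`. -/
noncomputable def ker (x : ℂ) : ℂ := (exp (-(2 * Real.pi * I * x)) - 1)⁻¹

theorem ker_add_one (x : ℂ) : ker (x + 1) = ker x := by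
  unfold ker
  congr 2
  rw [show -(2 * Real.pi * I * (x + 1)) = -(2 * Real.pi * I * x) - 2 * Real.pi * I by ring,
    Complex.exp_periodic.sub_eq]

theorem ker_add_int (x : ℂ) (n : ℤ) : ker (x + n) = ker x := by
  have h : Function.Periodic ker 1 := ker_add_one
  simpa using h.int_mul n x

theorem exp_sub_one_ne_zero {x : ℂ} (h : ∀ n : ℤ, x ≠ n) :
    exp (-(2 * Real.pi * I * x)) - 1 ≠ 0 := by
  intro h0
  obtain ⟨n, hn⟩ := Complex.exp_eq_one_iff.1 (sub_eq_zero.1 h0)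
  refine h (-n) ?_
  have h2 : (2 * Real.pi * I : ℂ) ≠ 0 := by simp [Real.pi_ne_zero]
  apply mul_left_cancel₀ h2
  push_cast
  linear_combination -hn

theorem differentiableAt_ker {x : ℂ} (h : ∀ n : ℤ, x ≠ n) : DifferentiableAt ℂ ker x := by
  unfold ker
  exact DifferentiableAt.inv (by fun_prop) (exp_sub_one_ne_zero h)

/-- The kernel is bounded away from its poles: by periodicity and compactness near the real axis,
and because it tends to `0` and `-1` as `Im x` tends to `+∞` and `-∞`. -/
theorem exists_norm_ker_le {d : ℝ} (hd : 0 < d) :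
    ∃ C > 0, ∀ x : ℂ, (∀ n : ℤ, d ≤ ‖x - n‖) → ‖ker x‖ ≤ C := by
  have hcompact : IsCompact ((Icc (-1) 1 ×ℂ Icc (-1) 1) ∩ {x : ℂ | ∀ n : ℤ, d ≤ ‖x - n‖}) := by
    refine (isCompact_Icc.reProdIm isCompact_Icc).inter_right ?_
    rw [ofPred_forall]
    exact isClosed_iInter fun n => isClosed_le continuous_const (by fun_prop)
  obtain ⟨C, hC⟩ := hcompact.exists_bound_of_continuousOn (f := ker) fun x hx =>
    (differentiableAt_ker fun n hn => by
      have := hx.2 n; rw [hn] at this; simp at this; linarith).continuousAt.continuousWithinAt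
  refine ⟨max C 2, by positivity, fun x hx => ?_⟩
  have hred : ker x = ker (x - ⌊x.re⌋) := by
    have := ker_add_int (x - ⌊x.re⌋) ⌊x.re⌋
    rwa [sub_add_cancel] at this
  by_cases him : |x.im| ≤ 1
  · rw [hred]
    refine (hC _ ⟨?_, fun n => ?_⟩).trans (le_max_left _ _)
    · rw [abs_le] at him
      have h1 := Int.fract_nonneg x.re
      have h2 := Int.fract_lt_one x.re
      refine ⟨⟨?_, ?_⟩, ⟨?_, ?_⟩⟩ <;> simp <;> linarith
    · have := hx (⌊x.re⌋ + n)
      push_cast at this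
      rwa [sub_sub]
  · refine le_trans ?_ (le_max_right _ _)
    have hn : ‖exp (-(2 * Real.pi * I * x))‖ = Real.exp (2 * Real.pi * x.im) := by
      rw [norm_exp]; simp
    have hpi := Real.pi_gt_three
    have hlow : 1 / 2 ≤ ‖exp (-(2 * Real.pi * I * x)) - 1‖ := by
      rw [not_le, lt_abs] at him
      rcases him with h | h
      · have h1 := norm_sub_norm_le (exp (-(2 * Real.pi * I * x))) 1
        rw [hn, norm_one] at h1
        have h2 := Real.add_one_le_exp (2 * Real.pi * x.im)
        nlinarith
      · have hsmall : Real.exp (2 * Real.pi * x.im) ≤ 1 / 2 := by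
          have h2 := Real.add_one_le_exp (-(2 * Real.pi * x.im))
          rw [Real.exp_neg] at h2
          have h3 : 2 ≤ (Real.exp (2 * Real.pi * x.im))⁻¹ := by nlinarith
          rw [one_div]
          exact (le_inv_comm₀ (by norm_num) (Real.exp_pos _)).1 h3
        have h1 := norm_sub_norm_le 1 (exp (-(2 * Real.pi * I * x)))
        rw [hn, norm_one, norm_sub_rev] at h1
        linarith
    unfold ker
    rw [norm_inv]
    exact inv_le_of_inv_le₀ (by norm_num) (by linarith)

end Kernel

/-! ### Integrals over lines in a foliation -/

section Paths

/-- The line `Im s = c` lies strictly between the line `Im s = Im t` and one of its translates by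
`± τ`. -/
def Off (τ : ℂ) (c : ℝ) (x : ℂ × ℂ) : Prop :=
  (c < x.1.im ∧ x.1.im < c + τ.im) ∨ (x.1.im < c ∧ c < x.1.im + τ.im)

/-- Quantitative form of `Off`, with a margin `d`. -/
def OffBy (τ : ℂ) (d c : ℝ) (x : ℂ × ℂ) : Prop :=
  (c + d ≤ x.1.im ∧ x.1.im ≤ c + τ.im - d) ∨ (x.1.im + d ≤ c ∧ c ≤ x.1.im + τ.im - d)

variable {τ lam : ℂ} {mu : ℝ}

theorem OffBy.off {d c : ℝ} (hd : 0 < d) {x : ℂ × ℂ} (h : OffBy τ d c x) : Off τ c x := by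
  rcases h with h | h
  · left; constructor <;> linarith [h.1, h.2]
  · right; constructor <;> linarith [h.1, h.2]

theorem Off.eventually_offBy {c : ℝ} {x : ℂ × ℂ} (h : Off τ c x) :
    ∃ d > 0, ∀ᶠ y in 𝓝 x, OffBy τ d c y := by
  have hcont : Continuous (fun y : ℂ × ℂ => y.1.im) := by fun_prop
  rcases h with ⟨h1, h2⟩ | ⟨h1, h2⟩
  · obtain ⟨d, hd0, hd⟩ := exists_between (lt_min (sub_pos.2 h1) (sub_pos.2 h2))
    rw [lt_min_iff] at hd
    refine ⟨d, hd0, ?_⟩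
    filter_upwards [hcont.continuousAt.eventually (lt_mem_nhds (show c + d < x.1.im by linarith)),
      hcont.continuousAt.eventually (gt_mem_nhds (show x.1.im < c + τ.im - d by linarith))]
      with y h3 h4 using Or.inl ⟨h3.le, h4.le⟩
  · obtain ⟨d, hd0, hd⟩ := exists_between (lt_min (sub_pos.2 h1) (sub_pos.2 h2))
    rw [lt_min_iff] at hd
    refine ⟨d, hd0, ?_⟩
    filter_upwards [hcont.continuousAt.eventually (gt_mem_nhds (show x.1.im < c - d by linarith)),
      hcont.continuousAt.eventually (lt_mem_nhds (show c - τ.im + d < x.1.im by linarith))]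
      with y h3 h4 using Or.inr ⟨by linarith, by linarith⟩

/-- A kernel `k c x` and a path `γ c x` with real parameter, attached to each line `Im t = c` and
each point `x`. The path lies on that line, at the depth of `x`, and `ξ` grows linearly along it
(`decay`), so that the integral of `k • h ∘ γ` converges for right-hand sides `h` of order `|ξ|⁻²`.
-/
structure PathData (τ lam : ℂ) (mu : ℝ) (k : ℝ → ℂ × ℂ → ℝ → ℂ)
    (γ : ℝ → ℂ × ℂ → ℝ → ℂ × ℂ) : Prop where
  im_eq : ∀ c x s, (γ c x s).1.im = c
  level_eq : ∀ c x s, level lam mu (γ c x s) = level lam mu x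
  diff_path : ∀ c s, Differentiable ℂ (fun x => γ c x s)
  diff_ker : ∀ c s x, Off τ c x → DifferentiableAt ℂ (fun x => k c x s) x
  bound_ker : ∀ d > 0, ∃ C > 0, ∀ c x s, OffBy τ d c x → ‖k c x s‖ ≤ C
  meas : ∀ R c x, ∀ h : ℂ × ℂ → ℂ × ℂ, Off τ c x → ContinuousOn h (dom τ lam mu R) →
    Adm τ R c (level lam mu x) → AEStronglyMeasurable (fun s => k c x s • h (γ c x s))
  decay : ∃ M > 0, ∃ a : ℂ × ℂ → ℝ, Continuous a ∧ ∀ c x s, 2 * |c| + 2 ≤ level lam mu x →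
    1 / ‖(γ c x s).2‖ ^ 2 ≤ M / (1 + (a x + s) ^ 2)

/-- The integral of `k • h ∘ γ` over the line `Im t = c`. -/
noncomputable def lineInt (k : ℝ → ℂ × ℂ → ℝ → ℂ) (γ : ℝ → ℂ × ℂ → ℝ → ℂ × ℂ) (c : ℝ)
    (h : ℂ × ℂ → ℂ × ℂ) (x : ℂ × ℂ) : ℂ × ℂ :=
  ∫ s : ℝ, k c x s • h (γ c x s)

theorem integrable_inv_one_add_add_sq (a : ℝ) : Integrable (fun s : ℝ => (1 + (a + s) ^ 2)⁻¹) :=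
  integrable_inv_one_add_sq.comp_add_left a

theorem integral_inv_one_add_add_sq (a : ℝ) : ∫ s : ℝ, (1 + (a + s) ^ 2)⁻¹ = Real.pi := by
  rw [integral_add_left_eq_self (fun s : ℝ => (1 + s ^ 2)⁻¹) a, integral_univ_inv_one_add_sq]

variable {k : ℝ → ℂ × ℂ → ℝ → ℂ} {γ : ℝ → ℂ × ℂ → ℝ → ℂ × ℂ} {R : ℕ → ℝ} {h h' : ℂ × ℂ → ℂ × ℂ}
  {A A' : ℝ}

theorem PathData.mem_dom (P : PathData τ lam mu k γ) {c : ℝ} {x : ℂ × ℂ} (s : ℝ)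
    (hc : Adm τ R c (level lam mu x)) : γ c x s ∈ dom τ lam mu R := by
  change Adm _ _ _ _
  rw [P.im_eq, P.level_eq]
  exact hc

theorem PathData.integrable (P : PathData τ lam mu k γ) (hR : Steep τ R)
    (hh : Nice τ lam mu R h A) {c : ℝ} {x : ℂ × ℂ} (hc : Adm τ R c (level lam mu x))
    (ho : Off τ c x) : Integrable (fun s => k c x s • h (γ c x s)) := by
  obtain ⟨d, hd0, hd⟩ := ho.eventually_offBy
  obtain ⟨C, hC0, hC⟩ := P.bound_ker d hd0
  obtain ⟨M, hM0, a, -, hM⟩ := P.decay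
  refine ((integrable_inv_one_add_add_sq (a x)).const_mul (C * A * M)).mono'
    (P.meas R c x h ho hh.holo.continuousOn hc) (Eventually.of_forall fun s => ?_)
  rw [norm_smul]
  have h1 := hC c x s hd.self_of_nhds
  have h2 := hh.bound _ (P.mem_dom s hc)
  have h3 := hM c x s (hc.le_level hR)
  have hA := hh.nonneg
  calc ‖k c x s‖ * ‖h (γ c x s)‖ ≤ C * (A * (1 / ‖(γ c x s).2‖ ^ 2)) := by
        rw [mul_one_div]; gcongr
    _ ≤ C * (A * (M / (1 + (a x + s) ^ 2))) := by gcongr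
    _ = C * A * M * (1 + (a x + s) ^ 2)⁻¹ := by ring

theorem PathData.lineInt_sub (P : PathData τ lam mu k γ) (hR : Steep τ R)
    (hh : Nice τ lam mu R h A) (hh' : Nice τ lam mu R h' A') {c : ℝ} {x : ℂ × ℂ}
    (hc : Adm τ R c (level lam mu x)) (ho : Off τ c x) :
    lineInt k γ c (h - h') x = lineInt k γ c h x - lineInt k γ c h' x := by
  unfold lineInt
  rw [← integral_sub (P.integrable hR hh hc ho) (P.integrable hR hh' hc ho)]
  simp [smul_sub]

/-- A bound for the integral over the line halfway to the translate of the point, in terms of the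
values of `h` on that line at the depth of the point only. -/
theorem PathData.exists_norm_lineInt_le (P : PathData τ lam mu k γ) (hτ : 0 < τ.im) :
    ∃ C > 0, ∀ (h : ℂ × ℂ → ℂ × ℂ) (A c : ℝ) (x : ℂ × ℂ), 0 ≤ A → 2 * |c| + 2 ≤ level lam mu x →
      |x.1.im - c| = τ.im / 2 →
      (∀ y : ℂ × ℂ, y.1.im = c → level lam mu y = level lam mu x → ‖h y‖ ≤ A / ‖y.2‖ ^ 2) →
      ‖lineInt k γ c h x‖ ≤ C * A := by
  obtain ⟨C, hC0, hC⟩ := P.bound_ker (τ.im / 2) (half_pos hτ)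
  obtain ⟨M, hM0, a, -, hM⟩ := P.decay
  refine ⟨C * M * Real.pi, by positivity, fun h A c x hA hl hc hh => ?_⟩
  have hoff : OffBy τ (τ.im / 2) c x := by
    rcases abs_eq (half_pos hτ).le |>.1 hc with h1 | h1
    · left; constructor <;> linarith
    · right; constructor <;> linarith
  calc ‖lineInt k γ c h x‖ ≤ ∫ s : ℝ, C * A * M * (1 + (a x + s) ^ 2)⁻¹ := by
        refine norm_integral_le_of_norm_le ((integrable_inv_one_add_add_sq (a x)).const_mul _)
          (Eventually.of_forall fun s => ?_)
        rw [norm_smul]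
        have h1 := hC c x s hoff
        have h2 := hh _ (P.im_eq c x s) (P.level_eq c x s)
        have h3 := hM c x s hl
        calc ‖k c x s‖ * ‖h (γ c x s)‖ ≤ C * (A * (1 / ‖(γ c x s).2‖ ^ 2)) := by
              rw [mul_one_div]; gcongr
          _ ≤ C * (A * (M / (1 + (a x + s) ^ 2))) := by gcongr
          _ = C * A * M * (1 + (a x + s) ^ 2)⁻¹ := by ring
    _ = C * M * Real.pi * A := by
        rw [integral_const_mul, integral_inv_one_add_add_sq]; ring

theorem PathData.differentiableAt_lineInt (P : PathData τ lam mu k γ) (hR : Steep τ R)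
    (hh : Nice τ lam mu R h A) {c : ℝ} {x : ℂ × ℂ} (hc : Adm τ R c (level lam mu x))
    (ho : Off τ c x) : DifferentiableAt ℂ (lineInt k γ c h) x := by
  obtain ⟨d, hd0, hd⟩ := ho.eventually_offBy
  obtain ⟨C, hC0, hC⟩ := P.bound_ker d hd0
  obtain ⟨M, hM0, a, ha, hM⟩ := P.decay
  obtain ⟨n, hn1, hn2⟩ := hc
  have hev : ∀ᶠ y in 𝓝 x, OffBy τ d c y ∧ R n < level lam mu y ∧ |a y - a x| < 1 := by
    refine hd.and (Eventually.and ?_ ?_)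
    · exact continuous_level.continuousAt.eventually (lt_mem_nhds hn2)
    · have := Metric.continuousAt_iff.1 (ha.continuousAt (x := x)) 1 one_pos
      exact Metric.eventually_nhds_iff.2 (by simpa [Real.dist_eq] using this)
  obtain ⟨U, hUsub, hUo, hxU⟩ := _root_.mem_nhds_iff.1 hev
  have hadm : ∀ y ∈ U, Adm τ R c (level lam mu y) := fun y hy => ⟨n, hn1, (hUsub hy).2.1⟩
  have hA := hh.nonneg
  refine DifferentiableOn.differentiableAt (s := U) ?_ (hUo.mem_nhds hxU)
  refine differentiableOn_integral (f := fun y s => k c y s • h (γ c y s)) hUo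
    ((integrable_inv_one_add_add_sq (a x)).const_mul (C * A * M * 3)) ?_ ?_ ?_
  · exact fun y hy => P.meas R c y h ((hUsub hy).1.off hd0) hh.holo.continuousOn (hadm y hy)
  · intro s y hy
    refine DifferentiableAt.differentiableWithinAt (DifferentiableAt.smul
      (P.diff_ker c s y ((hUsub hy).1.off hd0)) ?_)
    exact DifferentiableAt.comp (g := h) y
      (hh.holo.differentiableAt (isOpen_dom.mem_nhds (P.mem_dom s (hadm y hy)))) (P.diff_path c s y)
  · intro y hy s
    rw [norm_smul]
    have h1 := hC c y s (hUsub hy).1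
    have h2 := hh.bound _ (P.mem_dom s (hadm y hy))
    have h3 := hM c y s ((hadm y hy).le_level hR)
    -- a dominating function independent of `y`
    have h4 : (1 + (a y + s) ^ 2)⁻¹ ≤ 3 * (1 + (a x + s) ^ 2)⁻¹ := by
      have h5 := (hUsub hy).2.2
      rw [abs_lt] at h5
      rw [← div_eq_mul_inv, ← one_div, div_le_div_iff₀ (by positivity) (by positivity)]
      nlinarith [sq_nonneg ((a y + s) + (a y - a x)), sq_nonneg (a y - a x)]
    calc ‖k c y s‖ * ‖h (γ c y s)‖ ≤ C * (A * (1 / ‖(γ c y s).2‖ ^ 2)) := by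
          rw [mul_one_div]; gcongr
      _ ≤ C * (A * (M / (1 + (a y + s) ^ 2))) := by gcongr
      _ = C * A * M * (1 + (a y + s) ^ 2)⁻¹ := by ring
      _ ≤ C * A * M * (3 * (1 + (a x + s) ^ 2)⁻¹) := by gcongr
      _ = C * A * M * 3 * (1 + (a x + s) ^ 2)⁻¹ := by ring

end Paths

/-! ### The two foliations -/

section Concrete

variable {τ lam : ℂ} {mu : ℝ}

theorem OffBy.dist_le {d c : ℝ} {x : ℂ × ℂ} (hd : 0 ≤ d) (h : OffBy τ d c x) (n : ℤ) :
    d ≤ |c - x.1.im - n * τ.im| := by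
  have hτ : 0 ≤ τ.im := by rcases h with h | h <;> linarith [h.1, h.2]
  rcases h with ⟨h1, h2⟩ | ⟨h1, h2⟩
  · rcases le_or_gt 0 n with hn | hn
    · have : (0 : ℝ) ≤ n := by exact_mod_cast hn
      rw [_root_.le_abs]; right; nlinarith
    · have : (n : ℝ) ≤ -1 := by exact_mod_cast (by omega : n ≤ -1)
      rw [_root_.le_abs]; left; nlinarith
  · rcases le_or_gt n 0 with hn | hn
    · have : (n : ℝ) ≤ 0 := by exact_mod_cast hn
      rw [_root_.le_abs]; left; nlinarith
    · have : (1 : ℝ) ≤ n := by exact_mod_cast hn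
      rw [_root_.le_abs]; right; nlinarith

theorem Off.ne {c : ℝ} {x : ℂ × ℂ} (h : Off τ c x) (n : ℤ) : c - x.1.im - n * τ.im ≠ 0 := by
  obtain ⟨d, hd0, hd⟩ := h.eventually_offBy
  intro h0
  have := hd.self_of_nhds.dist_le hd0.le n
  rw [h0, abs_zero] at this
  linarith

/-- The kernel on the leaves `τ ξ + t = const`, which are invariant under
`(t, ξ) ↦ (t + τ, ξ - 1)`. -/
noncomputable def slantKer (τ : ℂ) (c : ℝ) (x : ℂ × ℂ) (s : ℝ) : ℂ :=
  ker ((s + c * I - x.1) / τ) / τ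

/-- The line `Im t = c` in the leaf `τ ξ + t = const` through `x`. -/
noncomputable def slantPath (τ : ℂ) (c : ℝ) (x : ℂ × ℂ) (s : ℝ) : ℂ × ℂ :=
  (s + c * I, x.2 + (x.1 - (s + c * I)) / τ)

/-- The kernel on the leaves `ξ = const`. The model map permutes the leaves `ξ + n`, and on each
leaf the line `Im t = c` is a closed curve of the quotient by `t ↦ t + 1`. The real parameter is cut
into unit segments, the `n`-th of which runs around the closed curve on the leaf `ξ + n`. -/
noncomputable def flatKer (τ : ℂ) (c : ℝ) (x : ℂ × ℂ) (s : ℝ) : ℂ :=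
  ker (s + c * I - x.1 + ⌊s⌋ * τ)

/-- The path that runs once around the closed curve `Im t = c` on each leaf `ξ + n`. -/
noncomputable def flatPath (c : ℝ) (x : ℂ × ℂ) (s : ℝ) : ℂ × ℂ := (s + c * I, x.2 + ⌊s⌋)

theorem slant_arg_ne (hτ : 0 < τ.im) {c : ℝ} {x : ℂ × ℂ} (h : Off τ c x) (s : ℝ) (n : ℤ) :
    (s + c * I - x.1) / τ ≠ n := by
  have h0 : τ ≠ 0 := fun h => by simp [h] at hτ
  intro h1
  rw [div_eq_iff h0] at h1
  have := congrArg Complex.im h1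
  simp at this
  exact h.ne n (by linarith)

theorem flat_arg_ne {c : ℝ} {x : ℂ × ℂ} (h : Off τ c x) (s : ℝ) (m n : ℤ) :
    (s + c * I - x.1 + m * τ : ℂ) ≠ n := by
  intro h1
  have := congrArg Complex.im h1
  simp at this
  exact h.ne (-m) (by push_cast; linarith)

theorem pathData_slant (hτ : 0 < τ.im) (hmu : mu = 1 ∨ mu = -1) :
    PathData τ (mu * τ) mu (slantKer τ) (slantPath τ) := by
  have h0 : τ ≠ 0 := fun h => by simp [h] at hτ
  have hlev : ∀ c x s, level (mu * τ) mu (slantPath τ c x s) = level (mu * τ) mu x := by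
    intro c x s
    unfold level slantPath
    congr 1
    field_simp
    ring
  refine ⟨fun c x s => by simp [slantPath], hlev, fun c s => ?_, fun c s x h => ?_, fun d hd => ?_,
    fun R c x h ho hh hc => ?_, ?_⟩
  · unfold slantPath; fun_prop
  · have : DifferentiableAt ℂ (fun x : ℂ × ℂ => ker ((s + c * I - x.1) / τ)) x :=
      DifferentiableAt.comp (g := ker) x (differentiableAt_ker (slant_arg_ne hτ h s)) (by fun_prop)
    simpa [slantKer, div_eq_mul_inv] using this.mul_const τ⁻¹
  · obtain ⟨C, hC0, hC⟩ := exists_norm_ker_le (d := d / ‖τ‖) (div_pos hd (norm_pos_iff.2 h0))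
    refine ⟨C / ‖τ‖, div_pos hC0 (norm_pos_iff.2 h0), fun c x s ho => ?_⟩
    unfold slantKer
    rw [norm_div]
    gcongr
    refine hC _ fun n => ?_
    have h1 : (s + c * I - x.1) / τ - n = (s + c * I - x.1 - n * τ) / τ := by field_simp
    rw [h1, norm_div]
    gcongr
    refine (ho.dist_le hd.le n).trans (le_trans (le_of_eq ?_) (abs_im_le_norm _))
    simp
  · have h1 : Continuous (fun s : ℝ => ker ((s + c * I - x.1) / τ)) :=
      continuous_iff_continuousAt.2 fun s => ContinuousAt.comp (g := ker)
        (f := fun s : ℝ => (s + c * I - x.1) / τ)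
        (differentiableAt_ker (slant_arg_ne hτ ho s)).continuousAt (by fun_prop)
    have h2 : Continuous (fun s => h (slantPath τ c x s)) := by
      refine hh.comp_continuous (by unfold slantPath; fun_prop) fun s => ?_
      change Adm _ _ _ _
      rw [hlev]
      simpa [slantPath] using hc
    exact ((h1.div_const τ).smul h2).aestronglyMeasurable
  · refine ⟨‖τ‖ ^ 2, by positivity, fun x => -(τ * x.2 + x.1).re, by fun_prop, fun c x s hl => ?_⟩
    have h1 : ‖τ‖ ^ 2 * ‖(slantPath τ c x s).2‖ ^ 2 =
        ((τ * x.2 + x.1).re - s) ^ 2 + ((τ * x.2 + x.1).im - c) ^ 2 := by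
      rw [← mul_pow, ← norm_mul]
      have : τ * (slantPath τ c x s).2 = (τ * x.2 + x.1) - (s + c * I) := by
        unfold slantPath; field_simp; ring
      rw [this, Complex.sq_norm, normSq_apply]
      simp; ring
    have h2 : 1 ≤ ((τ * x.2 + x.1).im - c) ^ 2 := by
      have h3 : level (mu * τ) mu x = mu * (τ * x.2 + x.1).im := by
        unfold level
        rw [show (mu * τ * x.2 + mu * x.1 : ℂ) = mu * (τ * x.2 + x.1) by ring]
        simp
      rw [h3] at hl
      have h4 := neg_abs_le c
      have h5 := le_abs_self c
      rcases hmu with rfl | rfl <;> nlinarith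
    have hpos : 0 < ‖(slantPath τ c x s).2‖ ^ 2 := by
      by_contra hneg
      have : ‖(slantPath τ c x s).2‖ ^ 2 = 0 := le_antisymm (not_lt.1 hneg) (by positivity)
      rw [this] at h1
      nlinarith [sq_nonneg ((τ * x.2 + x.1).re - s)]
    rw [div_le_div_iff₀ hpos (by positivity), h1]
    nlinarith

theorem pathData_flat (hlam : lam = 1 ∨ lam = -1) :
    PathData τ lam 0 (flatKer τ) flatPath := by
  have hlev : ∀ c x s, level lam 0 (flatPath c x s) = level lam 0 x := by
    intro c x s
    rcases hlam with rfl | rfl <;> simp [level, flatPath]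
  refine ⟨fun c x s => by simp [flatPath], hlev, fun c s => ?_, fun c s x h => ?_, fun d hd => ?_,
    fun R c x h ho hh hc => ?_, ?_⟩
  · unfold flatPath; fun_prop
  · unfold flatKer
    exact DifferentiableAt.comp (g := ker) x (differentiableAt_ker (flat_arg_ne h s _))
      (by fun_prop)
  · obtain ⟨C, hC0, hC⟩ := exists_norm_ker_le hd
    refine ⟨C, hC0, fun c x s ho => hC _ fun n => ?_⟩
    refine (ho.dist_le hd.le (-⌊s⌋)).trans (le_trans (le_of_eq ?_) (abs_im_le_norm _))
    simp
  · have hcont : Continuous (fun p : ℝ × ℤ => ker (p.1 + c * I - x.1 + p.2 * τ) •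
        h (p.1 + c * I, x.2 + p.2)) := by
      rw [continuous_prod_of_discrete_right]
      intro m
      have h1 : Continuous (fun s : ℝ => ker (s + c * I - x.1 + m * τ)) :=
        continuous_iff_continuousAt.2 fun s => ContinuousAt.comp (g := ker)
          (f := fun s : ℝ => s + c * I - x.1 + m * τ)
          (differentiableAt_ker (flat_arg_ne ho s m)).continuousAt (by fun_prop)
      have h2 : Continuous (fun s : ℝ => h (s + c * I, x.2 + m)) := by
        refine hh.comp_continuous (by fun_prop) fun s => ?_
        change Adm _ _ _ _
        have : level lam 0 (s + c * I, x.2 + m) = level lam 0 x := by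
          rcases hlam with rfl | rfl <;> simp [level]
        rw [this]
        simpa using hc
      exact h1.smul h2
    have := hcont.stronglyMeasurable.comp_measurable
      (g := fun s : ℝ => (s, ⌊s⌋)) (measurable_id.prodMk Int.measurable_floor)
    exact this.aestronglyMeasurable
  · refine ⟨3, by positivity, fun x => x.2.re, by fun_prop, fun c x s hl => ?_⟩
    have h1 : ‖(flatPath c x s).2‖ ^ 2 = (x.2.re + ⌊s⌋) ^ 2 + x.2.im ^ 2 := by
      rw [Complex.sq_norm, normSq_apply]
      simp [flatPath]; ring
    have h2 : 1 ≤ x.2.im ^ 2 := by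
      have h4 := abs_nonneg c
      rcases hlam with rfl | rfl <;> simp [level] at hl <;> nlinarith
    have h5 := Int.floor_le s
    have h6 := Int.lt_floor_add_one s
    rw [h1, div_le_div_iff₀ (by positivity) (by positivity)]
    nlinarith [sq_nonneg ((x.2.re + ⌊s⌋) - (s - ⌊s⌋)), sq_nonneg (s - ⌊s⌋)]

end Concrete

/-! ### Jump relations -/

section Jump

variable {τ lam : ℂ} {mu : ℝ} {R : ℕ → ℝ} {h : ℂ × ℂ → ℂ × ℂ} {A : ℝ}

/-- Path data whose integral is invariant under `(t, ξ) ↦ (t + 1, ξ)` and under the model map, and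
jumps by the right-hand side when the line of integration crosses the point. -/
structure Solver (τ lam : ℂ) (mu : ℝ) (k : ℝ → ℂ × ℂ → ℝ → ℂ) (γ : ℝ → ℂ × ℂ → ℝ → ℂ × ℂ) : Prop
    extends PathData τ lam mu k γ where
  period : ∀ R h A c x, Nice τ lam mu R h A → Adm τ R c (level lam mu x) →
    lineInt k γ c h (x.1 + 1, x.2) = lineInt k γ c h x
  shift_eq : ∀ R h A c x, Nice τ lam mu R h A → Adm τ R c (level lam mu x) →
    lineInt k γ c h (shift τ x) = lineInt k γ c h x
  jump : ∀ R h A c c' x, Steep τ R → Nice τ lam mu R h A → Adm τ R c (level lam mu x) →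
    Adm τ R c' (level lam mu x) → x ∈ dom τ lam mu R → x.1.im - τ.im < c → c < x.1.im →
    x.1.im < c' → c' < x.1.im + τ.im → lineInt k γ c' h x - lineInt k γ c h x = h x

/-- The entire function `(exp (-2 π i x) - 1) / x`, with its value at `0`. -/
noncomputable def kerDen : ℂ → ℂ := dslope (fun x => exp (-(2 * Real.pi * I * x)) - 1) 0

theorem differentiable_kerDen : Differentiable ℂ kerDen := by
  rw [← differentiableOn_univ]
  exact (Complex.differentiableOn_dslope univ_mem).2
    (Differentiable.differentiableOn (by fun_prop))

theorem kerDen_zero : kerDen 0 = -(2 * Real.pi * I) := by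
  unfold kerDen
  rw [dslope_same]
  have h1 : HasDerivAt (fun x : ℂ => -(2 * Real.pi * I * x)) (-(2 * Real.pi * I * 1)) 0 :=
    ((hasDerivAt_id (0 : ℂ)).const_mul (2 * Real.pi * I : ℂ)).neg
  have h2 := (h1.cexp.sub_const 1).deriv
  simpa using h2

theorem ker_eq (x : ℂ) (hx : x ≠ 0) : ker x = x⁻¹ * (kerDen x)⁻¹ := by
  unfold kerDen ker
  rw [dslope_of_ne _ hx, slope_def_field]
  simp only [mul_zero, neg_zero, exp_zero, sub_self, sub_zero]
  rw [inv_div, ← mul_div_assoc, inv_mul_cancel₀ hx, one_div]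

theorem kerDen_ne_zero {x : ℂ} (hx : ∀ n : ℤ, n ≠ 0 → x ≠ n) : kerDen x ≠ 0 := by
  rcases eq_or_ne x 0 with rfl | h0
  · rw [kerDen_zero]; simp [Real.pi_ne_zero]
  · unfold kerDen
    rw [dslope_of_ne _ h0, slope_def_field]
    simp only [mul_zero, neg_zero, exp_zero, sub_self, sub_zero]
    refine div_ne_zero (exp_sub_one_ne_zero fun n hn => ?_) h0
    rcases eq_or_ne n 0 with rfl | hn0
    · simp at hn; exact h0 hn
    · exact hx n hn0 hn

theorem two_pi_smul_kerDen_zero (v : ℂ × ℂ) :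
    (2 * Real.pi * I : ℂ) • ((kerDen 0)⁻¹ • v) = -v := by
  have : (2 * Real.pi * I : ℂ) ≠ 0 := by simp [Real.pi_ne_zero]
  rw [smul_smul, kerDen_zero, inv_neg, mul_neg, mul_inv_cancel₀ this, neg_one_smul]

/-- Between two admissible lines every line is admissible. -/
theorem Adm.between {c c' y v : ℝ} (hc : Adm τ R c v) (hc' : Adm τ R c' v) (hy : y ∈ Icc c c') :
    Adm τ R y v := by
  have : |y| ≤ |c| ∨ |y| ≤ |c'| := by
    rcases le_total 0 y with h0 | h0
    · right; rw [abs_of_nonneg h0]; exact hy.2.trans (le_abs_self _)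
    · left; rw [abs_of_nonpos h0]; exact (neg_le_neg hy.1).trans (neg_le_abs _)
  rcases this with h | h
  · obtain ⟨n, h1, h2⟩ := hc; exact ⟨n, h.trans_lt h1, h2⟩
  · obtain ⟨n, h1, h2⟩ := hc'; exact ⟨n, h.trans_lt h1, h2⟩

/-- The Cauchy formula for the rectangle between the two lines, whose vertical sides tend to
infinity: the only pole is at `t`. -/
theorem slantPath_jump (hτ : 0 < τ.im) (hmu : mu = 1 ∨ mu = -1) {c c' : ℝ} {x : ℂ × ℂ}
    (hR : Steep τ R) (hh : Nice τ (mu * τ) mu R h A) (hc : Adm τ R c (level (mu * τ) mu x))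
    (hc' : Adm τ R c' (level (mu * τ) mu x)) (h1 : x.1.im - τ.im < c) (h2 : c < x.1.im)
    (h3 : x.1.im < c') (h4 : c' < x.1.im + τ.im) :
    lineInt (slantKer τ) (slantPath τ) c' h x - lineInt (slantKer τ) (slantPath τ) c h x = h x := by
  have h0 : τ ≠ 0 := fun h => by simp [h] at hτ
  have P := pathData_slant hτ hmu
  -- the integrand without its pole at `t`
  set f : ℂ → ℂ × ℂ := fun w => (kerDen ((w - x.1) / τ))⁻¹ • h (w, x.2 + (x.1 - w) / τ) with hf
  have hQ : ∀ a b : ℝ, (a + b * I : ℂ) ≠ x.1 → (a + b * I - x.1 : ℂ)⁻¹ • f (a + b * I) =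
      slantKer τ b x a • h (slantPath τ b x a) := by
    intro a b hab
    simp only [hf, smul_smul, slantKer, slantPath]
    rw [ker_eq _ (div_ne_zero (sub_ne_zero.2 hab) h0)]
    congr 1
    have := sub_ne_zero.2 hab
    field_simp
  have hadm : ∀ y ∈ Icc c c', Adm τ R y (level (mu * τ) mu x) := fun y hy => hc.between hc' hy
  have hfd : ∀ w : ℂ, w.im ∈ Icc c c' → DifferentiableAt ℂ f w := by
    intro w hw
    have hk : DifferentiableAt ℂ (fun w => kerDen ((w - x.1) / τ)) w :=
      DifferentiableAt.comp (g := kerDen) w (differentiable_kerDen _) (by fun_prop)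
    refine DifferentiableAt.smul (hk.inv (kerDen_ne_zero fun n hn hwn => ?_)) ?_
    · rw [div_eq_iff h0] at hwn
      have := congrArg Complex.im hwn
      simp at this
      rcases lt_or_gt_of_ne hn with hn | hn
      · have : (n : ℝ) ≤ -1 := by exact_mod_cast (by omega : n ≤ -1)
        nlinarith [hw.1, hw.2]
      · have : (1 : ℝ) ≤ n := by exact_mod_cast hn
        nlinarith [hw.1, hw.2]
    · refine DifferentiableAt.comp (g := h) w (hh.holo.differentiableAt (isOpen_dom.mem_nhds ?_))
        (by fun_prop)
      have := P.mem_dom w.re (hadm _ hw)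
      simpa [slantPath, re_add_im] using this
  obtain ⟨M, hM0, a, -, hM⟩ := P.decay
  set d : ℝ := min (min (c - (x.1.im - τ.im)) (x.1.im + τ.im - c')) 1 with hd
  have hd0 : 0 < d := by
    simp only [hd, lt_min_iff]; exact ⟨⟨by linarith, by linarith⟩, one_pos⟩
  obtain ⟨C, hC0, hC⟩ := exists_norm_ker_le (d := d / ‖τ‖) (div_pos hd0 (norm_pos_iff.2 h0))
  -- the integrand is small on distant vertical sides
  have hside : ∀ e : ℝ, 1 ≤ |e - x.1.re| →
      ‖∫ y : ℝ in c..c', (e + y * I - x.1 : ℂ)⁻¹ • f (e + y * I)‖ ≤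
      C / ‖τ‖ * A * (M * (1 + (a x + e) ^ 2)⁻¹) * |c' - c| := by
    intro e he
    refine intervalIntegral.norm_integral_le_of_norm_le_const fun y hy => ?_
    rw [uIoc_of_le (h2.trans h3).le] at hy
    have hy' : y ∈ Icc c c' := Ioc_subset_Icc_self hy
    have hne : (e + y * I : ℂ) ≠ x.1 := fun h => by
      have : e = x.1.re := by simpa using congrArg Complex.re h
      rw [this] at he; simp at he; linarith
    rw [hQ e y hne, norm_smul]
    have hA := hh.nonneg
    have e1 : ‖slantKer τ y x e‖ ≤ C / ‖τ‖ := by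
      unfold slantKer
      rw [norm_div]
      gcongr
      refine hC _ fun n => ?_
      have h1 : (e + y * I - x.1) / τ - n = (e + y * I - x.1 - n * τ) / τ := by field_simp
      rw [h1, norm_div]
      gcongr
      rcases eq_or_ne n 0 with rfl | hn
      · refine ((min_le_right _ _).trans he).trans (le_trans (le_of_eq ?_) (abs_re_le_norm _))
        simp
      · refine le_trans ?_ (abs_im_le_norm _)
        have hsim : (e + y * I - x.1 - n * τ : ℂ).im = y - x.1.im - n * τ.im := by simp
        rw [hsim]
        have d1 : d ≤ c - (x.1.im - τ.im) := (min_le_left _ _).trans (min_le_left _ _)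
        have d2 : d ≤ x.1.im + τ.im - c' := (min_le_left _ _).trans (min_le_right _ _)
        rcases lt_or_gt_of_ne hn with hn | hn
        · have : (n : ℝ) ≤ -1 := by exact_mod_cast (by omega : n ≤ -1)
          rw [le_abs]; left; nlinarith [hy'.1, hy'.2]
        · have : (1 : ℝ) ≤ n := by exact_mod_cast hn
          rw [le_abs]; right; nlinarith [hy'.1, hy'.2]
    have e2 := hh.bound _ (P.mem_dom e (hadm y hy'))
    have e3 := hM y x e ((hadm y hy').le_level hR)
    calc ‖slantKer τ y x e‖ * ‖h (slantPath τ y x e)‖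
        ≤ C / ‖τ‖ * (A * (1 / ‖(slantPath τ y x e).2‖ ^ 2)) := by rw [mul_one_div]; gcongr
      _ ≤ C / ‖τ‖ * (A * (M / (1 + (a x + e) ^ 2))) := by gcongr
      _ = C / ‖τ‖ * A * (M * (1 + (a x + e) ^ 2)⁻¹) := by ring
  have hzero : ∀ σ : ℝ, (σ = 1 ∨ σ = -1) → Tendsto (fun N : ℝ => I •
      ∫ y : ℝ in c..c', (((x.1.re + σ * N : ℝ) : ℂ) + y * I - x.1 : ℂ)⁻¹ •
        f ((x.1.re + σ * N : ℝ) + y * I)) atTop (𝓝 0) := by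
    intro σ hσ
    rw [← smul_zero I]
    refine Tendsto.const_smul ?_ I
    refine squeeze_zero_norm' (a := fun N : ℝ => C / ‖τ‖ * A *
      (M * (1 + (a x + (x.1.re + σ * N)) ^ 2)⁻¹) * |c' - c|) ?_ ?_
    · filter_upwards [eventually_ge_atTop 1] with N hN
      refine hside _ ?_
      rcases hσ with rfl | rfl <;> simp <;> exact hN.trans (le_abs_self _)
    · have : Tendsto (fun N : ℝ => (1 + (a x + (x.1.re + σ * N)) ^ 2)⁻¹) atTop (𝓝 0) := by
        refine tendsto_inv_atTop_zero.comp (tendsto_atTop_add_const_left _ _ ?_)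
        have h7 : Tendsto (fun N : ℝ => N + (a x + x.1.re) * σ) atTop atTop :=
          tendsto_atTop_add_const_right _ _ tendsto_id
        refine ((tendsto_pow_atTop two_ne_zero).comp (tendsto_abs_atTop_atTop.comp h7)).congr
          fun N => ?_
        simp only [Function.comp_apply, sq_abs]
        rcases hσ with rfl | rfl <;> ring
      simpa using (((this.const_mul M).const_mul (C / ‖τ‖ * A)).mul_const |c' - c|)
  have hrect : ∀ N : ℝ, 0 < N →
      (∫ s : ℝ in (x.1.re + (-1) * N)..(x.1.re + 1 * N), slantKer τ c x s • h (slantPath τ c x s)) -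
      (∫ s : ℝ in (x.1.re + (-1) * N)..(x.1.re + 1 * N),
        slantKer τ c' x s • h (slantPath τ c' x s)) +
      I • (∫ y : ℝ in c..c', (((x.1.re + 1 * N : ℝ) : ℂ) + y * I - x.1 : ℂ)⁻¹ •
        f ((x.1.re + 1 * N : ℝ) + y * I)) -
      I • (∫ y : ℝ in c..c', (((x.1.re + (-1) * N : ℝ) : ℂ) + y * I - x.1 : ℂ)⁻¹ •
        f ((x.1.re + (-1) * N : ℝ) + y * I)) = -h x := by
    intro N hN
    have := integral_boundary_rect_sub_inv_smul (f := f) (t := x.1) (a := x.1.re + (-1) * N)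
      (b := x.1.re + 1 * N) (by linarith) (by linarith) h2 h3 (fun w hw => by
        rw [uIcc_of_le (h2.trans h3).le] at hw
        exact (hfd w hw.2).differentiableWithinAt)
    have hft : (2 * Real.pi * I : ℂ) • f x.1 = -h x := by
      simp only [hf, sub_self, zero_div, add_zero]
      exact two_pi_smul_kerDen_zero _
    rw [hft] at this
    rw [← this]
    congr 3
    · refine intervalIntegral.integral_congr fun s _ => (hQ s c fun h => ?_).symm
      have : c = x.1.im := by simpa using congrArg Complex.im h
      linarith
    · refine intervalIntegral.integral_congr fun s _ => (hQ s c' fun h => ?_).symm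
      have : c' = x.1.im := by simpa using congrArg Complex.im h
      linarith
  have hbot : Tendsto (fun N : ℝ => x.1.re + (-1) * N) atTop atBot :=
    tendsto_atBot_add_const_left _ _ (tendsto_neg_atTop_atBot.congr fun N => by ring)
  have htop : Tendsto (fun N : ℝ => x.1.re + 1 * N) atTop atTop :=
    tendsto_atTop_add_const_left _ _ (tendsto_id.congr fun N => by simp)
  have hoff : Off τ c x := Or.inl ⟨h2, by linarith⟩
  have hoff' : Off τ c' x := Or.inr ⟨h3, by linarith⟩
  have l1 := intervalIntegral_tendsto_integral (P.integrable hR hh hc hoff) hbot htop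
  have l2 := intervalIntegral_tendsto_integral (P.integrable hR hh hc' hoff') hbot htop
  have l3 := ((l1.sub l2).add (hzero 1 (Or.inl rfl))).sub (hzero (-1) (Or.inr rfl))
  have l4 := tendsto_nhds_unique l3 (Tendsto.congr' (f₁ := fun _ => -h x) (by
    filter_upwards [eventually_gt_atTop 0] with N hN using (hrect N hN).symm) tendsto_const_nhds)
  unfold lineInt
  rw [add_zero, sub_zero] at l4
  rw [← neg_sub, l4, neg_neg]

theorem solver_slant (hτ : 0 < τ.im) (hmu : mu = 1 ∨ mu = -1) :
    Solver τ (mu * τ) mu (slantKer τ) (slantPath τ) := by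
  have h0 : τ ≠ 0 := fun h => by simp [h] at hτ
  have P := pathData_slant hτ hmu
  refine ⟨P, fun R h A c x hh hc => ?_, fun R h A c x hh hc => ?_,
    fun R h A c c' x hR hh hc hc' _ h1 h2 h3 h4 =>
      slantPath_jump hτ hmu hR hh hc hc' h1 h2 h3 h4⟩
  · unfold lineInt
    rw [← integral_add_right_eq_self (fun s : ℝ => slantKer τ c (x.1 + 1, x.2) s •
      h (slantPath τ c (x.1 + 1, x.2) s)) 1]
    refine integral_congr_ae (Eventually.of_forall fun s => ?_)
    have e1 : slantKer τ c (x.1 + 1, x.2) (s + 1) = slantKer τ c x s := by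
      unfold slantKer
      push_cast
      congr 3
      ring
    have e2 : slantPath τ c (x.1 + 1, x.2) (s + 1) =
        ((slantPath τ c x s).1 + 1, (slantPath τ c x s).2) := by
      unfold slantPath
      push_cast
      refine Prod.ext ?_ ?_ <;> simp only <;> ring
    simp only [e1, e2]
    rw [hh.period _ (P.mem_dom s hc)]
  · unfold lineInt
    refine integral_congr_ae (Eventually.of_forall fun s => ?_)
    have e1 : slantKer τ c (shift τ x) s = slantKer τ c x s := by
      unfold slantKer shift
      rw [← ker_add_one]
      congr 2
      simp only
      field_simp
      ring
    have e2 : slantPath τ c (shift τ x) s = slantPath τ c x s := by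
      unfold slantPath shift
      refine Prod.ext rfl ?_
      simp only
      field_simp
      ring
    simp only [e1, e2]

theorem Nice.period_int (hh : Nice τ lam mu R h A) {x : ℂ × ℂ} (hx : x ∈ dom τ lam mu R) (n : ℤ) :
    h (x.1 + n, x.2) = h x := by
  have hmem : ∀ n : ℤ, (x.1 + n, x.2) ∈ dom τ lam mu R := fun n => by
    have hl : level lam mu (x.1 + n, x.2) = level lam mu x := by simp [level]
    change Adm _ _ _ _
    rw [hl]
    simpa using (show Adm _ _ _ _ from hx)
  induction n using Int.induction_on with
  | zero => simp
  | succ n ih =>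
    rw [← ih, ← hh.period _ (hmem n)]
    push_cast
    congr 2
    ring
  | pred n ih =>
    rw [← ih, ← hh.period _ (hmem _)]
    push_cast
    congr 2
    ring

/-- The line integral is the sum over `n` of the integrals over one turn of the closed curve
`Im t = c` on the leaf `ξ + n`. -/
theorem flatPath_hasSum (hlam : lam = 1 ∨ lam = -1) {c : ℝ} {x : ℂ × ℂ} (hR : Steep τ R)
    (hh : Nice τ lam 0 R h A) (hc : Adm τ R c (level lam 0 x)) (ho : Off τ c x) :
    HasSum (fun n : ℤ => ∫ s : ℝ in (0 : ℝ)..1, ker (s + c * I - x.1 + n * τ) •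
      h (s + c * I, x.2 + n)) (lineInt (flatKer τ) flatPath c h x) := by
  have P := pathData_flat (τ := τ) hlam
  have hs := (P.integrable hR hh hc ho).hasSum_intervalIntegral_comp_add_int
  unfold lineInt
  refine (congrArg (fun f => HasSum f _) (funext fun n => ?_)).mpr hs
  refine intervalIntegral.integral_congr_ae ?_
  have h1 : ∀ᵐ s : ℝ, s ≠ 1 := by simp [ae_iff, measure_singleton]
  filter_upwards [h1] with s hs hs'
  rw [uIoc_of_le zero_le_one] at hs'
  have hfl : ⌊s + n⌋ = n := by
    rw [Int.floor_add_intCast, Int.floor_eq_zero_iff.2 ⟨hs'.1.le, lt_of_le_of_ne hs'.2 hs⟩, zero_add]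
  have hm := P.mem_dom (s + n) hc
  unfold flatPath at hm
  unfold flatKer flatPath
  rw [hfl] at hm ⊢
  rw [← hh.period_int hm (-n), ← ker_add_int _ n]
  push_cast
  congr 2
  · ring
  · congr 1
    ring

/-- The Cauchy formula for the rectangle between two closed curves: the vertical sides cancel by
periodicity, and only the leaf `n = 0` contains a pole. -/
theorem flatPath_jump (hτ : 0 < τ.im) (hlam : lam = 1 ∨ lam = -1) {c c' : ℝ} {x : ℂ × ℂ}
    (hR : Steep τ R) (hh : Nice τ lam 0 R h A) (hc : Adm τ R c (level lam 0 x))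
    (hc' : Adm τ R c' (level lam 0 x)) (h1 : x.1.im - τ.im < c) (h2 : c < x.1.im)
    (h3 : x.1.im < c') (h4 : c' < x.1.im + τ.im) :
    lineInt (flatKer τ) flatPath c' h x - lineInt (flatKer τ) flatPath c h x = h x := by
  have P := pathData_flat (τ := τ) hlam
  have hoff : Off τ c x := Or.inl ⟨h2, by linarith⟩
  have hoff' : Off τ c' x := Or.inr ⟨h3, by linarith⟩
  have hadm : ∀ y ∈ Icc c c', Adm τ R y (level lam 0 x) := fun y hy => hc.between hc' hy
  have hmem : ∀ (w : ℂ) (n : ℤ), w.im ∈ Icc c c' → (w, x.2 + n) ∈ dom τ lam 0 R := by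
    intro w n hw
    have := hadm _ hw
    change Adm _ _ _ _
    have hl : level lam 0 (w, x.2 + n) = level lam 0 x := by
      rcases hlam with rfl | rfl <;> simp [level]
    rw [hl]; exact this
  have hhd : ∀ (w : ℂ) (n : ℤ), w.im ∈ Icc c c' →
      DifferentiableAt ℂ (fun w => h (w, x.2 + n)) w := fun w n hw =>
    DifferentiableAt.comp (g := h) w (hh.holo.differentiableAt (isOpen_dom.mem_nhds (hmem w n hw)))
      (by fun_prop)
  have hle : c ≤ c' := (h2.trans h3).le
  set q : ℤ → ℂ → ℂ × ℂ := fun n w => ker (w - x.1 + n * τ) • h (w, x.2 + n) with hq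
  have hper : ∀ n (w : ℂ), w.im ∈ Icc c c' → q n (w + 1) = q n w := by
    intro n w hw
    simp only [hq]
    have := hh.period _ (hmem w n hw)
    simp only at this
    rw [this, ← ker_add_one (w - x.1 + n * τ)]
    congr 2
    ring
  have hshift : ∀ (n : ℤ) (e a : ℝ), e ∈ Icc c c' →
      ∫ s : ℝ in (0 : ℝ)..1, q n (s + e * I) = ∫ s : ℝ in a..(a + 1), q n (s + e * I) := by
    intro n e a he
    have hp : Function.Periodic (fun s : ℝ => q n (s + e * I)) 1 := by
      intro s
      have := hper n (s + e * I) (by simpa using he)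
      simp only [ofReal_add, ofReal_one]
      rw [← this]
      congr 1
      ring
    have := hp.intervalIntegral_add_eq 0 a
    simpa using this
  -- for `n ≠ 0` the integrand has no pole between the two lines
  have hne : ∀ n : ℤ, n ≠ 0 → ∫ s : ℝ in (0 : ℝ)..1, q n (s + c * I) =
      ∫ s : ℝ in (0 : ℝ)..1, q n (s + c' * I) := by
    intro n hn
    have hd : DifferentiableOn ℂ (q n)
        ([[((0 : ℝ) + c * I : ℂ).re, (1 + c' * I : ℂ).re]] ×ℂ
          [[((0 : ℝ) + c * I : ℂ).im, (1 + c' * I : ℂ).im]]) := by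
      intro w hw
      have hw2 : w.im ∈ Icc c c' := by
        have := hw.2
        simpa [uIcc_of_le hle] using this
      suffices hk : DifferentiableAt ℂ (fun w => ker (w - x.1 + n * τ)) w from
        (hk.smul (hhd w n hw2)).differentiableWithinAt
      refine DifferentiableAt.comp (g := ker) w (differentiableAt_ker fun m hm => ?_) (by fun_prop)
      have := congrArg Complex.im hm
      simp at this
      rcases lt_or_gt_of_ne hn with hn | hn
      · have : (n : ℝ) ≤ -1 := by exact_mod_cast (by omega : n ≤ -1)
        nlinarith [hw2.1, hw2.2]
      · have : (1 : ℝ) ≤ n := by exact_mod_cast hn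
        nlinarith [hw2.1, hw2.2]
    have := Complex.integral_boundary_rect_eq_zero_of_differentiableOn (q n) _ _ hd
    have hsides : (∫ y : ℝ in c..c', q n (1 + y * I)) = ∫ y : ℝ in c..c', q n (0 + y * I) := by
      refine intervalIntegral.integral_congr fun y hy => ?_
      rw [uIcc_of_le hle] at hy
      have := hper n (0 + y * I) (by simpa using hy)
      rw [← this]
      congr 1
      ring
    simp only [add_re, ofReal_re, mul_re, I_re, mul_zero, ofReal_im, I_im, mul_one, sub_self,
      add_zero, add_im, mul_im, zero_add, one_re, one_im, ofReal_one, ofReal_zero] at this hsides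
    rw [hsides, add_sub_cancel_right, sub_eq_zero] at this
    exact this
  have hzero : (∫ s : ℝ in (0 : ℝ)..1, q 0 (s + c * I)) -
      ∫ s : ℝ in (0 : ℝ)..1, q 0 (s + c' * I) = -h x := by
    rw [hshift 0 c (x.1.re - 1 / 2) (left_mem_Icc.2 hle),
      hshift 0 c' (x.1.re - 1 / 2) (right_mem_Icc.2 hle)]
    set f : ℂ → ℂ × ℂ := fun w => (kerDen (w - x.1))⁻¹ • h (w, x.2 + (0 : ℤ)) with hf
    have hQ : ∀ w : ℂ, w ≠ x.1 → (w - x.1)⁻¹ • f w = q 0 w := by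
      intro w hw
      simp only [hf, hq, smul_smul]
      rw [ker_eq]
      · simp
      · simpa using sub_ne_zero.2 hw
    have := integral_boundary_rect_sub_inv_smul (f := f) (t := x.1) (a := x.1.re - 1 / 2)
      (b := x.1.re - 1 / 2 + 1) (by linarith) (by linarith) h2 h3 (fun w hw => by
        rw [uIcc_of_le hle, uIcc_of_le (by linarith)] at hw
        have hk : DifferentiableAt ℂ (fun w => kerDen (w - x.1)) w :=
          DifferentiableAt.comp (g := kerDen) w (differentiable_kerDen _) (by fun_prop)
        refine (DifferentiableAt.smul (hk.inv (kerDen_ne_zero fun n hn hwn => ?_))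
          (hhd w 0 hw.2)).differentiableWithinAt
        have h5 := congrArg Complex.re hwn
        simp at h5
        have h6 : x.1.re - 1 / 2 ≤ w.re ∧ w.re ≤ x.1.re - 1 / 2 + 1 := hw.1
        rcases lt_or_gt_of_ne hn with hn | hn
        · have : (n : ℝ) ≤ -1 := by exact_mod_cast (by omega : n ≤ -1)
          linarith
        · have : (1 : ℝ) ≤ n := by exact_mod_cast hn
          linarith)
    have hft : (2 * Real.pi * I : ℂ) • f x.1 = -h x := by
      simp only [hf, sub_self, Int.cast_zero, add_zero]
      exact two_pi_smul_kerDen_zero _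
    rw [hft] at this
    rw [← this]
    have hsides : (∫ y : ℝ in c..c', (((x.1.re - 1 / 2 + 1 : ℝ) : ℂ) + y * I - x.1 : ℂ)⁻¹ •
        f ((x.1.re - 1 / 2 + 1 : ℝ) + y * I)) =
        ∫ y : ℝ in c..c', (((x.1.re - 1 / 2 : ℝ) : ℂ) + y * I - x.1 : ℂ)⁻¹ •
        f ((x.1.re - 1 / 2 : ℝ) + y * I) := by
      refine intervalIntegral.integral_congr fun y hy => ?_
      rw [uIcc_of_le hle] at hy
      rw [hQ, hQ]
      · have := hper 0 ((x.1.re - 1 / 2 : ℝ) + y * I) (by simpa using hy)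
        rw [← this]
        congr 1
        push_cast
        ring
      · intro h
        have := congrArg Complex.re h
        simp at this
      · intro h
        have := congrArg Complex.re h
        simp at this
        linarith
    rw [hsides, add_sub_cancel_right]
    congr 1
    · refine intervalIntegral.integral_congr fun s _ => (hQ _ fun h => ?_).symm
      have : c = x.1.im := by simpa using congrArg Complex.im h
      linarith
    · refine intervalIntegral.integral_congr fun s _ => (hQ _ fun h => ?_).symm
      have : c' = x.1.im := by simpa using congrArg Complex.im h
      linarith
  have s1 := flatPath_hasSum hlam hR hh hc hoff
  have s2 := flatPath_hasSum hlam hR hh hc' hoff'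
  refine (s2.sub s1).unique ?_
  have h5 : h x = (∫ s : ℝ in (0 : ℝ)..1, q 0 (s + c' * I)) -
      ∫ s : ℝ in (0 : ℝ)..1, q 0 (s + c * I) := by
    rw [← neg_sub, hzero, neg_neg]
  rw [h5]
  refine hasSum_single (0 : ℤ) fun n hn => ?_
  exact sub_eq_zero.2 (hne n hn).symm

theorem solver_flat (hτ : 0 < τ.im) (hlam : lam = 1 ∨ lam = -1) :
    Solver τ lam 0 (flatKer τ) flatPath := by
  have P := pathData_flat (τ := τ) hlam
  refine ⟨P, fun R h A c x hh hc => ?_, fun R h A c x hh hc => ?_,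
    fun R h A c c' x hR hh hc hc' _ h1 h2 h3 h4 =>
      flatPath_jump hτ hlam hR hh hc hc' h1 h2 h3 h4⟩
  · unfold lineInt
    refine integral_congr_ae (Eventually.of_forall fun s => ?_)
    have e1 : flatKer τ c (x.1 + 1, x.2) s = flatKer τ c x s := by
      unfold flatKer
      rw [← ker_add_one]
      congr 1
      simp only
      ring
    simp only [e1, flatPath]
  · unfold lineInt
    rw [← integral_add_right_eq_self (fun s : ℝ => flatKer τ c (shift τ x) s •
      h (flatPath c (shift τ x) s)) 1]
    refine integral_congr_ae (Eventually.of_forall fun s => ?_)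
    have e1 : flatKer τ c (shift τ x) (s + 1) = flatKer τ c x s := by
      unfold flatKer shift
      rw [← ker_add_one (s + c * I - x.1 + ⌊s⌋ * τ), Int.floor_add_one]
      push_cast
      congr 1
      ring
    have e2 : flatPath c (shift τ x) (s + 1) = ((flatPath c x s).1 + 1, (flatPath c x s).2) := by
      unfold flatPath shift
      rw [Int.floor_add_one]
      push_cast
      refine Prod.ext ?_ ?_ <;> simp only <;> ring
    simp only [e1, e2]
    rw [hh.period _ (P.mem_dom s hc)]

/-- Every direction has a solver. -/
theorem exists_solver (hτ : 0 < τ.im) (hd : IsDirection τ lam mu) :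
    ∃ k γ, Solver τ lam mu k γ := by
  obtain ⟨rfl, h⟩ | ⟨h, rfl⟩ := hd
  · exact ⟨_, _, solver_flat hτ h⟩
  · exact ⟨_, _, solver_slant hτ h⟩

end Jump

/-! ### Sets of points of large depth -/

section Deep

variable {τ lam : ℂ} {mu : ℝ} {R : ℕ → ℝ} {A B : Set (ℂ × ℂ)}

/-- A set containing all points of sufficiently large depth, locally uniformly in `Im t`. -/
def Deep (τ lam : ℂ) (mu : ℝ) (A : Set (ℂ × ℂ)) : Prop :=
  ∀ n : ℕ, ∃ r : ℝ, ∀ x : ℂ × ℂ, |x.1.im| < (n + 1) * τ.im → r < level lam mu x → x ∈ A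

theorem Deep.mono (hA : Deep τ lam mu A) (h : A ⊆ B) : Deep τ lam mu B := fun n =>
  (hA n).imp fun _ hr x h1 h2 => h (hr x h1 h2)

theorem Deep.inter (hA : Deep τ lam mu A) (hB : Deep τ lam mu B) : Deep τ lam mu (A ∩ B) :=
  fun n => by
    obtain ⟨r, hr⟩ := hA n
    obtain ⟨s, hs⟩ := hB n
    exact ⟨max r s, fun x h1 h2 =>
      ⟨hr x h1 ((le_max_left _ _).trans_lt h2), hs x h1 ((le_max_right _ _).trans_lt h2)⟩⟩

theorem deep_le_level (b : ℝ) : Deep τ lam mu {x | b ≤ level lam mu x} := fun _ =>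
  ⟨b, fun _ _ h => h.le⟩

theorem deep_two_mul_abs_im_le : Deep τ lam mu {x | 2 * |x.1.im| + 2 ≤ level lam mu x} := fun n =>
  ⟨2 * ((n + 1) * τ.im) + 2, fun x h1 h2 =>
    show 2 * |x.1.im| + 2 ≤ level lam mu x by linarith⟩

theorem deep_dom : Deep τ lam mu (dom τ lam mu R) := fun n =>
  ⟨R n, fun _ h1 h2 => ⟨n, h1, h2⟩⟩

/-- A deep set contains a domain `dom R`, whose profile can be taken steep. -/
theorem Deep.exists_steep (hA : Deep τ lam mu A) : ∃ R, Steep τ R ∧ dom τ lam mu R ⊆ A := by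
  choose r hr using hA
  refine ⟨fun n => max (r n) (2 * ((n + 1) * τ.im) + 2), fun n => le_max_right _ _, ?_⟩
  rintro x ⟨n, h1, h2⟩
  exact hr n x h1 ((le_max_left _ _).trans_lt h2)

theorem abs_level_sub_le (hmu : |mu| ≤ 1) (x y : ℂ × ℂ) :
    |level lam mu y - level lam mu x| ≤ (‖lam‖ + 1) * ‖y - x‖ := by
  have h1 : level lam mu y - level lam mu x = (lam * (y - x).2 + mu * (y - x).1).im := by
    simp [level]; ring
  have h2 : ‖(mu : ℂ)‖ ≤ 1 := by simpa using hmu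
  rw [h1]
  refine (abs_im_le_norm _).trans ((norm_add_le _ _).trans ?_)
  rw [norm_mul, norm_mul, add_mul]
  have := norm_fst_le (y - x)
  have := norm_snd_le (y - x)
  gcongr

theorem level_le (hmu : |mu| ≤ 1) (x : ℂ × ℂ) :
    level lam mu x ≤ ‖lam‖ * ‖x.2‖ + |x.1.im| := by
  have h1 : level lam mu x = (lam * x.2).im + mu * x.1.im := by simp [level]
  have h2 : mu * x.1.im ≤ |x.1.im| := by
    refine (le_abs_self _).trans ?_
    rw [abs_mul]
    exact mul_le_of_le_one_left (abs_nonneg _) hmu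
  have h3 := (le_abs_self _).trans (abs_im_le_norm (lam * x.2))
  rw [norm_mul] at h3
  linarith

theorem level_le_two_mul (hmu : |mu| ≤ 1) {x : ℂ × ℂ} (hx : 2 * |x.1.im| + 2 ≤ level lam mu x) :
    level lam mu x ≤ 2 * ‖lam‖ * ‖x.2‖ ∧ 2 ≤ ‖lam‖ * ‖x.2‖ := by
  have := level_le (lam := lam) hmu x
  have := abs_nonneg x.1.im
  constructor <;> linarith

theorem deep_le_norm_snd (hmu : |mu| ≤ 1) (b : ℝ) : Deep τ lam mu {x | b ≤ ‖x.2‖} :=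
  (deep_two_mul_abs_im_le.inter (deep_le_level (2 * ‖lam‖ * b + 1))).mono fun x hx => by
    have h1 := (level_le_two_mul hmu hx.1).1
    have h2 : 2 * ‖lam‖ * b + 1 ≤ level lam mu x := hx.2
    by_contra h
    have h3 : ‖x.2‖ < b := not_le.1 h
    nlinarith [norm_nonneg lam, mul_nonneg (norm_nonneg lam) (sub_nonneg.2 h3.le)]

theorem Deep.closedBall_subset (hτ : 0 < τ.im) (hmu : |mu| ≤ 1) (hA : Deep τ lam mu A) (n : ℕ)
    (d : ℝ) : ∃ r : ℝ, ∀ x : ℂ × ℂ, |x.1.im| < (n + 1) * τ.im → r < level lam mu x →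
      closedBall x d ⊆ A := by
  obtain ⟨m, hm⟩ := exists_nat_ge (d / τ.im)
  obtain ⟨r, hr⟩ := hA (n + m)
  refine ⟨r + (‖lam‖ + 1) * d, fun x h1 h2 y hy => hr y ?_ ?_⟩
  · rw [mem_closedBall, dist_eq_norm] at hy
    have h3 : |y.1.im - x.1.im| ≤ d := by
      have := (abs_im_le_norm (y - x).1).trans ((norm_fst_le _).trans hy)
      simpa using this
    have h4 : d ≤ m * τ.im := (div_le_iff₀ hτ).1 hm
    have h5 := abs_sub_abs_le_abs_sub y.1.im x.1.im
    push_cast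
    linarith
  · rw [mem_closedBall, dist_eq_norm] at hy
    have h3 := (abs_le.1 (abs_level_sub_le (lam := lam) hmu x y)).1
    have h4 : (‖lam‖ + 1) * ‖y - x‖ ≤ (‖lam‖ + 1) * d := by gcongr
    linarith

theorem Deep.thicken (hτ : 0 < τ.im) (hmu : |mu| ≤ 1) (hA : Deep τ lam mu A) (d : ℝ) :
    Deep τ lam mu {x | closedBall x d ⊆ A} := fun n => hA.closedBall_subset hτ hmu n d

/-- Deep sets are stable under preimages by maps of bounded displacement on each strip. -/
theorem Deep.preimage (hτ : 0 < τ.im) (hmu : |mu| ≤ 1) (hA : Deep τ lam mu A)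
    {φ : ℂ × ℂ → ℂ × ℂ} (hφ : ∀ n : ℕ, ∃ d r : ℝ, ∀ x : ℂ × ℂ, |x.1.im| < (n + 1) * τ.im →
      r < level lam mu x → ‖φ x - x‖ ≤ d) : Deep τ lam mu {x | φ x ∈ A} := fun n => by
  obtain ⟨d, r, hr⟩ := hφ n
  obtain ⟨s, hs⟩ := hA.closedBall_subset hτ hmu n d
  refine ⟨max r s, fun x h1 h2 => hs x h1 ((le_max_right _ _).trans_lt h2) ?_⟩
  rw [mem_closedBall, dist_eq_norm]
  exact hr x h1 ((le_max_left _ _).trans_lt h2)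

/-- `f` is smaller than every power of `1 / ξ` in the deep part of each strip. -/
def Flat (τ lam : ℂ) (mu : ℝ) (f : ℂ × ℂ → ℂ × ℂ) : Prop :=
  ∀ m : ℕ, Deep τ lam mu {x | ‖f x‖ * ‖x.2‖ ^ m ≤ 1}

end Deep

/-! ### The difference equation -/

section Operator

variable {τ lam : ℂ} {mu : ℝ} {R : ℕ → ℝ} {h h' : ℂ × ℂ → ℂ × ℂ} {A A' : ℝ}
  {k : ℝ → ℂ × ℂ → ℝ → ℂ} {γ : ℝ → ℂ × ℂ → ℝ → ℂ × ℂ} {x : ℂ × ℂ}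

/-- The solution of the difference equation `G (F x) - G x = h x` for the model map `F`: the
integral of `h` over the line just below the point or, so as to stay in the smaller strips, over
the line just above it, corrected by the residue at the point. -/
noncomputable def solution (τ : ℂ) (k : ℝ → ℂ × ℂ → ℝ → ℂ) (γ : ℝ → ℂ × ℂ → ℝ → ℂ × ℂ)
    (h : ℂ × ℂ → ℂ × ℂ) (x : ℂ × ℂ) : ℂ × ℂ :=
  if 0 ≤ x.1.im then lineInt k γ (x.1.im - τ.im / 2) h x
  else lineInt k γ (x.1.im + τ.im / 2) h x - h x

theorem Adm.half_below (hτ : 0 < τ.im) {y v : ℝ} (hy : Adm τ R y v) (h0 : 0 ≤ y) :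
    Adm τ R (y - τ.im / 2) v := by
  obtain ⟨n, h1, h2⟩ := hy
  refine ⟨n, ?_, h2⟩
  rw [abs_of_nonneg h0] at h1
  have : (0 : ℝ) ≤ n * τ.im := by positivity
  rw [abs_lt]
  constructor <;> linarith

theorem Adm.half_above (hτ : 0 < τ.im) {y v : ℝ} (hy : Adm τ R y v) (h0 : y < 0) :
    Adm τ R (y + τ.im / 2) v := by
  obtain ⟨n, h1, h2⟩ := hy
  refine ⟨n, ?_, h2⟩
  rw [abs_of_neg h0] at h1
  have : (0 : ℝ) ≤ n * τ.im := by positivity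
  rw [abs_lt]
  constructor <;> linarith

theorem Adm.exists_near {y v d : ℝ} (hd : 0 < d) (hy : Adm τ R y v) :
    (∃ c, y - d < c ∧ c < y ∧ Adm τ R c v) ∧ ∃ c, y < c ∧ c < y + d ∧ Adm τ R c v := by
  obtain ⟨n, h1, h2⟩ := hy
  obtain ⟨e, he0, he⟩ := exists_between (lt_min hd (sub_pos.2 h1))
  rw [lt_min_iff] at he
  refine ⟨⟨y - e, by linarith, by linarith, n, ?_, h2⟩, y + e, by linarith, by linarith, n, ?_, h2⟩
  · have := abs_sub y e
    rw [abs_of_pos he0] at this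
    linarith
  · have := abs_add_le y e
    rw [abs_of_pos he0] at this
    linarith

/-- The solution can be computed on any admissible line at distance less than `Im τ` below the
point. -/
theorem Solver.solution_eq_below (S : Solver τ lam mu k γ) (hτ : 0 < τ.im) (hR : Steep τ R)
    (hh : Nice τ lam mu R h A) (hx : x ∈ dom τ lam mu R) {c : ℝ}
    (hc : Adm τ R c (level lam mu x)) (h1 : x.1.im - τ.im < c) (h2 : c < x.1.im) :
    solution τ k γ h x = lineInt k γ c h x := by
  unfold solution
  split_ifs with h0
  · obtain ⟨-, c', h3, h4, hc'⟩ := Adm.exists_near hτ hx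
    have e1 := S.jump R h A c c' x hR hh hc hc' hx h1 h2 h3 h4
    have e2 := S.jump R h A _ c' x hR hh (Adm.half_below hτ hx h0) hc' hx (by linarith)
      (by linarith) h3 h4
    rw [← e1] at e2
    exact sub_right_injective e2
  · have h0' := not_le.1 h0
    have e1 := S.jump R h A c _ x hR hh hc (Adm.half_above hτ hx h0') hx h1 h2
      (by linarith) (by linarith)
    rw [← e1]
    abel

/-- Up to the residue at the point, the solution can be computed on any admissible line at distance
less than `Im τ` above the point. -/
theorem Solver.solution_eq_above (S : Solver τ lam mu k γ) (hτ : 0 < τ.im) (hR : Steep τ R)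
    (hh : Nice τ lam mu R h A) (hx : x ∈ dom τ lam mu R) {c : ℝ}
    (hc : Adm τ R c (level lam mu x)) (h1 : x.1.im < c) (h2 : c < x.1.im + τ.im) :
    solution τ k γ h x = lineInt k γ c h x - h x := by
  obtain ⟨⟨b, h3, h4, hb⟩, -⟩ := Adm.exists_near hτ hx
  rw [S.solution_eq_below hτ hR hh hx hb h3 h4,
    ← S.jump R h A b c x hR hh hb hc hx h3 h4 h1 h2]
  abel

theorem Solver.differentiableOn_solution (S : Solver τ lam mu k γ) (hτ : 0 < τ.im)
    (hR : Steep τ R) (hh : Nice τ lam mu R h A) :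
    DifferentiableOn ℂ (solution τ k γ h) (dom τ lam mu R) := by
  intro x hx
  obtain ⟨⟨c, h1, h2, hc⟩, -⟩ := Adm.exists_near hτ hx
  have hd := S.differentiableAt_lineInt hR hh hc (Or.inl ⟨h2, by linarith⟩)
  refine (hd.congr_of_eventuallyEq ?_).differentiableWithinAt
  obtain ⟨n, hn1, hn2⟩ := hc
  have hcont : Continuous (fun y : ℂ × ℂ => y.1.im) := by fun_prop
  filter_upwards [isOpen_dom.mem_nhds hx,
    continuous_level.continuousAt.eventually (lt_mem_nhds hn2),
    hcont.continuousAt.eventually (lt_mem_nhds h2),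
    hcont.continuousAt.eventually (gt_mem_nhds (show x.1.im < c + τ.im by linarith))]
    with y hy1 hy2 hy3 hy4
  exact S.solution_eq_below hτ hR hh hy1 ⟨n, hn1, hy2⟩ (by linarith) hy3

theorem Solver.solution_period (S : Solver τ lam mu k γ) (hτ : 0 < τ.im)
    (hh : Nice τ lam mu R h A) (hx : x ∈ dom τ lam mu R) :
    solution τ k γ h (x.1 + 1, x.2) = solution τ k γ h x := by
  unfold solution
  simp only [add_im, one_im, add_zero]
  split_ifs with h0
  · exact S.period R h A _ x hh (Adm.half_below hτ hx h0)
  · rw [S.period R h A _ x hh (Adm.half_above hτ hx (not_le.1 h0)), hh.period x hx]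

theorem Solver.solution_shift (S : Solver τ lam mu k γ) (hτ : 0 < τ.im)
    (hd : IsDirection τ lam mu) (hR : Steep τ R) (hh : Nice τ lam mu R h A)
    (hx : x ∈ dom τ lam mu R) (hx' : shift τ x ∈ dom τ lam mu R) :
    solution τ k γ h (shift τ x) - solution τ k γ h x = h x := by
  -- a line just above `x` lies just below its translate
  obtain ⟨-, c, h1, h2, hc⟩ := Adm.exists_near hτ hx
  have him : (shift τ x).1.im = x.1.im + τ.im := by simp [shift]
  rw [S.solution_eq_above hτ hR hh hx hc h1 h2,
    S.solution_eq_below hτ hR hh hx' (by rwa [level_shift hd]) (by rw [him]; linarith)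
      (by rw [him]; linarith), S.shift_eq R h A c x hh hc]
  abel

theorem Solver.solution_sub (S : Solver τ lam mu k γ) (hτ : 0 < τ.im) (hR : Steep τ R)
    (hh : Nice τ lam mu R h A) (hh' : Nice τ lam mu R h' A') (hx : x ∈ dom τ lam mu R) :
    solution τ k γ (h - h') x = solution τ k γ h x - solution τ k γ h' x := by
  unfold solution
  split_ifs with h0
  · exact S.lineInt_sub hR hh hh' (Adm.half_below hτ hx h0) (Or.inl ⟨by linarith, by linarith⟩)
  · have h0' := not_le.1 h0
    rw [S.lineInt_sub hR hh hh' (Adm.half_above hτ hx h0') (Or.inr ⟨by linarith, by linarith⟩)]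
    simp only [Pi.sub_apply]
    abel

/-- The solution at a point is controlled by the values of the right-hand side at the same depth
in the same strip. -/
theorem Solver.exists_norm_solution_le (S : Solver τ lam mu k γ) (hτ : 0 < τ.im)
    (hd : IsDirection τ lam mu) : ∃ C > 0, ∀ (h : ℂ × ℂ → ℂ × ℂ) (R : ℕ → ℝ) (A : ℝ) (x : ℂ × ℂ),
      Steep τ R → 0 ≤ A → x ∈ dom τ lam mu R →
      (∀ y : ℂ × ℂ, |y.1.im| ≤ max |x.1.im| (τ.im / 2) → level lam mu y = level lam mu x →
        ‖h y‖ ≤ A / ‖y.2‖ ^ 2) → ‖solution τ k γ h x‖ ≤ C * A := by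
  obtain ⟨C, hC0, hC⟩ := S.exists_norm_lineInt_le hτ
  refine ⟨C + ‖lam‖ ^ 2, by positivity, fun h R A x hR hA hx hh => ?_⟩
  have hbelow : ∀ c, |c| ≤ max |x.1.im| (τ.im / 2) → Adm τ R c (level lam mu x) →
      |x.1.im - c| = τ.im / 2 → ‖lineInt k γ c h x‖ ≤ C * A := fun c h1 h2 h3 =>
    hC h A c x hA (h2.le_level hR) h3 fun y hy1 hy2 => hh y (by rw [hy1]; exact h1) hy2
  have hhalf : |τ.im / 2| = τ.im / 2 := abs_of_pos (half_pos hτ)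
  unfold solution
  split_ifs with h0
  · refine (hbelow _ ?_ (Adm.half_below hτ hx h0) (by rw [sub_sub_cancel]; exact hhalf)).trans ?_
    · rw [abs_le]
      have := le_max_left |x.1.im| (τ.im / 2)
      have := le_max_right |x.1.im| (τ.im / 2)
      have := le_abs_self x.1.im
      constructor <;> linarith
    · gcongr; nlinarith [sq_nonneg ‖lam‖]
  · have h0' := not_le.1 h0
    have h1 := hbelow _ (by
      rw [abs_le]
      have := le_max_left |x.1.im| (τ.im / 2)
      have := le_max_right |x.1.im| (τ.im / 2)
      have := neg_le_abs x.1.im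
      constructor <;> linarith) (Adm.half_above hτ hx h0')
      (by rw [sub_add_cancel_left, abs_neg]; exact hhalf)
    have h2 := hh x (le_max_left _ _) rfl
    have h3 := (level_le_two_mul hd.abs_mu_le (Adm.le_level hR hx)).2
    have h4 : A / ‖x.2‖ ^ 2 ≤ ‖lam‖ ^ 2 * A := by
      have hpos : 0 < ‖x.2‖ := by
        by_contra h
        have : ‖x.2‖ = 0 := le_antisymm (not_lt.1 h) (norm_nonneg _)
        rw [this] at h3; linarith
      rw [div_le_iff₀ (by positivity)]
      have : 1 ≤ (‖lam‖ * ‖x.2‖) ^ 2 := by nlinarith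
      calc A = A * 1 := (mul_one A).symm
        _ ≤ A * (‖lam‖ * ‖x.2‖) ^ 2 := by gcongr
        _ = _ := by ring
    calc _ ≤ ‖lineInt k γ (x.1.im + τ.im / 2) h x‖ + ‖h x‖ := norm_sub_le _ _
      _ ≤ (C + ‖lam‖ ^ 2) * A := by linarith

end Operator

/-! ### Flat perturbations of the model map -/

section Picard

variable {τ lam : ℂ} {mu : ℝ} {R : ℕ → ℝ} {f : ℂ × ℂ → ℂ × ℂ}
  {k : ℝ → ℂ × ℂ → ℝ → ℂ} {γ : ℝ → ℂ × ℂ → ℝ → ℂ × ℂ} {W : Set (ℂ × ℂ)}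

/-- The points around which `f` is defined and bounded by `ε / |ξ|²` on a unit ball. -/
def smallSet (f : ℂ × ℂ → ℂ × ℂ) (W : Set (ℂ × ℂ)) (ε : ℝ) : Set (ℂ × ℂ) :=
  {x | closedBall x 1 ⊆ W ∧ ∀ w ∈ closedBall x 1, ‖f w‖ ≤ ε / ‖x.2‖ ^ 2}

theorem norm_snd_le_two_mul {x w : ℂ × ℂ} (hx : 2 ≤ ‖x.2‖) (hw : w ∈ closedBall x 1) :
    ‖x.2‖ ≤ 2 * ‖w.2‖ := by
  rw [mem_closedBall, dist_eq_norm] at hw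
  have h1 := (norm_snd_le (w - x)).trans hw
  rw [Prod.snd_sub, norm_sub_rev] at h1
  have := norm_sub_norm_le x.2 w.2
  linarith

theorem deep_smallSet (hτ : 0 < τ.im) (hmu : |mu| ≤ 1) (hW : Deep τ lam mu W)
    (hf : Flat τ lam mu f) {ε : ℝ} (hε : 0 < ε) : Deep τ lam mu (smallSet f W ε) := by
  refine (((hW.inter ((hf 3).inter (deep_le_norm_snd hmu (max (4 / ε) 2)))).thicken hτ hmu
    1).inter (deep_le_norm_snd hmu 2)).mono ?_
  rintro x ⟨hx, hx2 : 2 ≤ ‖x.2‖⟩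
  refine ⟨fun w hw => (hx hw).1, fun w hw => ?_⟩
  obtain ⟨-, h3, h4⟩ := hx hw
  have h3 : ‖f w‖ * ‖w.2‖ ^ 3 ≤ 1 := h3
  have h4 : max (4 / ε) 2 ≤ ‖w.2‖ := h4
  have h5 : 4 ≤ ε * ‖w.2‖ := by
    have := (le_max_left _ _).trans h4
    rwa [div_le_iff₀' hε] at this
  have h6 := norm_snd_le_two_mul hx2 hw
  have h7 : 2 ≤ ‖w.2‖ := (le_max_right _ _).trans h4
  rw [le_div_iff₀ (by positivity)]
  have h8 : ‖x.2‖ ^ 2 ≤ (2 * ‖w.2‖) ^ 2 := by gcongr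
  have h9 : ‖f w‖ * ‖w.2‖ ^ 2 * 4 ≤ ε := by
    have : ‖f w‖ * ‖w.2‖ ^ 2 * 4 ≤ ‖f w‖ * ‖w.2‖ ^ 2 * (ε * ‖w.2‖) := by gcongr
    nlinarith
  calc ‖f w‖ * ‖x.2‖ ^ 2 ≤ ‖f w‖ * (2 * ‖w.2‖) ^ 2 := by gcongr
    _ ≤ ε := by linarith

/-- One step of the iteration solving `h = f ∘ (id + G h)`. -/
noncomputable def picard (τ : ℂ) (k : ℝ → ℂ × ℂ → ℝ → ℂ) (γ : ℝ → ℂ × ℂ → ℝ → ℂ × ℂ)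
    (f : ℂ × ℂ → ℂ × ℂ) (h : ℂ × ℂ → ℂ × ℂ) (x : ℂ × ℂ) : ℂ × ℂ :=
  f (x + solution τ k γ h x)

theorem norm_apply_add_sub_le (hf : DifferentiableOn ℂ f W) {ε : ℝ} {x u v : ℂ × ℂ}
    (hx : x ∈ smallSet f W ε) (hu : ‖u‖ ≤ 1 / 8) (hv : ‖v‖ ≤ 1 / 8) :
    ‖f (x + u) - f (x + v)‖ ≤ 4 * ε / ‖x.2‖ ^ 2 * ‖u - v‖ := by
  have hsub : ball (x + v) (1 / 2) ⊆ closedBall x 1 := fun w hw => by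
    rw [mem_ball, dist_eq_norm] at hw
    rw [mem_closedBall, dist_eq_norm]
    have := norm_add_le (w - (x + v)) v
    rw [sub_add_eq_sub_sub, sub_add_cancel] at this
    rw [sub_add_eq_sub_sub] at hw
    linarith
  have hmem : x + u ∈ ball (x + v) (1 / 2) := by
    rw [mem_ball, dist_eq_norm, add_sub_add_left_eq_sub]
    have := norm_sub_le u v
    linarith
  have := norm_sub_le_of_bound (hf.mono (hsub.trans hx.1)) (fun w hw => hx.2 w (hsub hw)) hmem
  rw [add_sub_add_left_eq_sub] at this
  refine this.trans (le_of_eq ?_)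
  ring

theorem mem_closedBall_add {x u : ℂ × ℂ} (hu : ‖u‖ ≤ 1 / 8) : x + u ∈ closedBall x 1 := by
  rw [mem_closedBall, dist_eq_norm, add_sub_cancel_left]
  linarith

/-- The fixed-point equation for flat perturbations: for flat `f` there is a solution `g` of
`g (F x) - g x = f (x + g x)`, where `F` is the model map. -/
theorem exists_fixedPoint (hτ : 0 < τ.im) (hd : IsDirection τ lam mu)
    (hW : Deep τ lam mu W) (hf : DifferentiableOn ℂ f W)
    (hper : ∀ x ∈ W, f (x.1 + 1, x.2) = f x) (hfl : Flat τ lam mu f) :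
    ∃ (R : ℕ → ℝ) (g : ℂ × ℂ → ℂ × ℂ), Steep τ R ∧ (∀ x ∈ dom τ lam mu R, closedBall x 1 ⊆ W) ∧
      DifferentiableOn ℂ g (dom τ lam mu R) ∧ (∀ x ∈ dom τ lam mu R, ‖g x‖ ≤ 1 / 8) ∧
      (∀ x ∈ dom τ lam mu R, g (x.1 + 1, x.2) = g x) ∧
      (∀ x ∈ dom τ lam mu R, shift τ x ∈ dom τ lam mu R → g (shift τ x) - g x = f (x + g x)) ∧
      ∀ m : ℕ, Deep τ lam mu {x | ‖g x‖ * level lam mu x ^ m ≤ 1} := by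
  obtain ⟨k, γ, S⟩ := exists_solver hτ hd
  obtain ⟨C, hC0, hC⟩ := S.exists_norm_solution_le hτ hd
  have hmu := hd.abs_mu_le
  -- with this `ε` solutions are bounded by `1 / 8` and the iteration contracts by a factor `1 / 2`
  set ε : ℝ := 1 / (8 * C) with hε
  have hε0 : 0 < ε := by positivity
  have hCε : C * ε = 1 / 8 := by rw [hε]; field_simp
  obtain ⟨R, hR, hsub⟩ := (deep_smallSet hτ hmu hW hfl hε0).exists_steep
  set D := dom τ lam mu R with hD
  -- the points of the same depth needed to evaluate the solution stay in the domain
  have hval : ∀ x ∈ D, ∀ y : ℂ × ℂ, |y.1.im| ≤ max |x.1.im| (τ.im / 2) →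
      level lam mu y = level lam mu x → y ∈ D := by
    rintro x ⟨n, h1, h2⟩ y h3 h4
    refine ⟨n, h3.trans_lt (max_lt h1 ?_), by rwa [h4]⟩
    have : (0 : ℝ) ≤ n * τ.im := by positivity
    linarith
  have hsol : ∀ (h : ℂ × ℂ → ℂ × ℂ) (A : ℝ), 0 ≤ A → (∀ x ∈ D, ‖h x‖ ≤ A / ‖x.2‖ ^ 2) →
      ∀ x ∈ D, ‖solution τ k γ h x‖ ≤ C * A := fun h A hA hh x hx =>
    hC h R A x hR hA hx fun y h1 h2 => hh y (hval x hx y h1 h2)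
  have hsol8 : ∀ h, Nice τ lam mu R h ε → ∀ x ∈ D, ‖solution τ k γ h x‖ ≤ 1 / 8 :=
    fun h hh x hx => hCε ▸ hsol h ε hε0.le hh.bound x hx
  have hmaps : ∀ h, Nice τ lam mu R h ε → ∀ x ∈ D, x + solution τ k γ h x ∈ W :=
    fun h hh x hx => (hsub hx).1 (mem_closedBall_add (hsol8 h hh x hx))
  have hstep : ∀ h, Nice τ lam mu R h ε → Nice τ lam mu R (picard τ k γ f h) ε := by
    intro h hh
    refine ⟨hε0.le, ?_, fun x hx => ?_, fun x hx => ?_⟩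
    · exact hf.comp (differentiableOn_id.add (S.differentiableOn_solution hτ hR hh))
        fun x hx => hmaps h hh x hx
    · unfold picard
      rw [S.solution_period hτ hh hx, ← hper _ (hmaps h hh x hx)]
      congr 1
      refine Prod.ext ?_ ?_ <;> simp [add_right_comm]
    · exact (hsub hx).2 _ (mem_closedBall_add (hsol8 h hh x hx))
  have hcontr : ∀ h h', Nice τ lam mu R h ε → Nice τ lam mu R h' ε → ∀ δ : ℝ, 0 ≤ δ →
      (∀ x ∈ D, ‖h x - h' x‖ ≤ δ / ‖x.2‖ ^ 2) →
      ∀ x ∈ D, ‖picard τ k γ f h x - picard τ k γ f h' x‖ ≤ δ / 2 / ‖x.2‖ ^ 2 := by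
    intro h h' hh hh' δ hδ hb x hx
    refine (norm_apply_add_sub_le hf (hsub hx) (hsol8 h hh x hx) (hsol8 h' hh' x hx)).trans ?_
    rw [← S.solution_sub hτ hR hh hh' hx]
    have h1 := hsol (h - h') δ hδ hb x hx
    calc 4 * ε / ‖x.2‖ ^ 2 * ‖solution τ k γ (h - h') x‖ ≤ 4 * ε / ‖x.2‖ ^ 2 * (C * δ) := by gcongr
      _ = 4 * (C * ε) * δ / ‖x.2‖ ^ 2 := by ring
      _ = δ / 2 / ‖x.2‖ ^ 2 := by rw [hCε]; ring
  set h : ℕ → ℂ × ℂ → ℂ × ℂ := fun n => (picard τ k γ f)^[n] 0 with hh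
  have hsucc : ∀ n, h (n + 1) = picard τ k γ f (h n) := fun n =>
    Function.iterate_succ_apply' _ _ _
  have hnice : ∀ n, Nice τ lam mu R (h n) ε := by
    intro n
    induction n with
    | zero =>
      refine ⟨hε0.le, differentiableOn_const _, fun x _ => rfl, fun x _ => ?_⟩
      simp only [hh, Function.iterate_zero, id, Pi.zero_apply, norm_zero]
      positivity
    | succ n ih => rw [hsucc]; exact hstep _ ih
  have hdiff : ∀ n, ∀ x ∈ D, ‖h n x - h (n + 1) x‖ ≤ ε / 2 ^ n / ‖x.2‖ ^ 2 := by
    intro n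
    induction n with
    | zero =>
      intro x hx
      have := (hnice 1).bound x hx
      simpa [hh] using this
    | succ n ih =>
      intro x hx
      have := hcontr _ _ (hnice n) (hnice (n + 1)) (ε / 2 ^ n) (by positivity) ih x hx
      rw [hsucc n, hsucc (n + 1)]
      refine this.trans (le_of_eq ?_)
      rw [pow_succ 2 n, div_div ε]
  have hinv : ∀ x ∈ D, 1 / ‖x.2‖ ^ 2 ≤ ‖lam‖ ^ 2 := fun x hx => by
    have h3 := (level_le_two_mul hmu (Adm.le_level hR hx)).2
    have hpos : 0 < ‖x.2‖ := by
      by_contra h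
      have : ‖x.2‖ = 0 := le_antisymm (not_lt.1 h) (norm_nonneg _)
      rw [this] at h3; linarith
    rw [div_le_iff₀ (by positivity), ← mul_pow]
    nlinarith
  have hlim : ∀ x ∈ D, ∃ l, Tendsto (fun n => h n x) atTop (𝓝 l) := fun x hx =>
    cauchySeq_tendsto_of_complete (cauchySeq_of_le_geometric (1 / 2) (ε / ‖x.2‖ ^ 2) (by norm_num)
      fun n => by
        rw [dist_eq_norm]
        refine (hdiff n x hx).trans (le_of_eq ?_)
        rw [one_div, inv_pow]; field_simp)
  choose! l hl using hlim
  have hrate : ∀ n, ∀ x ∈ D, ‖h n x - l x‖ ≤ 2 * ε / 2 ^ n / ‖x.2‖ ^ 2 := by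
    intro n x hx
    have := dist_le_of_le_geometric_of_tendsto (1 / 2) (ε / ‖x.2‖ ^ 2) (by norm_num)
      (fun n => by
        rw [dist_eq_norm]
        refine (hdiff n x hx).trans (le_of_eq ?_)
        rw [one_div, inv_pow]; field_simp) (hl x hx) n
    rw [dist_eq_norm] at this
    refine this.trans (le_of_eq ?_)
    rw [one_div, inv_pow]; field_simp; ring
  have hunif : TendstoUniformlyOn h l atTop D := by
    rw [Metric.tendstoUniformlyOn_iff]
    intro e he
    have ht : Tendsto (fun n : ℕ => 2 * ε * ‖lam‖ ^ 2 * (1 / 2) ^ n) atTop (𝓝 0) := by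
      simpa using (tendsto_pow_atTop_nhds_zero_of_lt_one (r := (1 / 2 : ℝ)) (by norm_num)
        (by norm_num)).const_mul (2 * ε * ‖lam‖ ^ 2)
    filter_upwards [ht.eventually (gt_mem_nhds he)] with n hn x hx
    rw [dist_comm, dist_eq_norm]
    refine lt_of_le_of_lt ((hrate n x hx).trans ?_) hn
    calc 2 * ε / 2 ^ n / ‖x.2‖ ^ 2 = 2 * ε * (1 / 2) ^ n * (1 / ‖x.2‖ ^ 2) := by
          rw [one_div, inv_pow]; field_simp
      _ ≤ 2 * ε * (1 / 2) ^ n * ‖lam‖ ^ 2 := by gcongr; exact hinv x hx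
      _ = _ := by ring
  have hlnice : Nice τ lam mu R l ε := by
    refine ⟨hε0.le, ?_, fun x hx => ?_, fun x hx => ?_⟩
    · exact differentiableOn_of_tendstoLocallyUniformlyOn isOpen_dom (fun n => (hnice n).holo)
        hunif.tendstoLocallyUniformlyOn
    · refine tendsto_nhds_unique (hl _ (mem_dom_add_one.2 hx)) ((hl x hx).congr fun n => ?_)
      exact ((hnice n).period x hx).symm
    · exact le_of_tendsto (hl x hx).norm (Eventually.of_forall fun n => (hnice n).bound x hx)
  have hfix : ∀ x ∈ D, l x = f (x + solution τ k γ l x) := by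
    intro x hx
    have h1 : Tendsto (fun n => h (n + 1) x) atTop (𝓝 (l x)) :=
      (hl x hx).comp (tendsto_add_atTop_nat 1)
    refine tendsto_nhds_unique h1 ?_
    have h2 : Tendsto (fun n => picard τ k γ f (h n) x - picard τ k γ f l x) atTop (𝓝 0) := by
      refine squeeze_zero_norm (fun n => hcontr _ _ (hnice n) hlnice (2 * ε / 2 ^ n) (by positivity)
        (hrate n) x hx) ?_
      have := (tendsto_pow_atTop_nhds_zero_of_lt_one (r := (1 / 2 : ℝ)) (by norm_num)
        (by norm_num)).const_mul (ε / ‖x.2‖ ^ 2)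
      rw [mul_zero] at this
      refine this.congr fun n => ?_
      rw [one_div, inv_pow]; field_simp
    have h3 := h2.add_const (picard τ k γ f l x)
    simp only [sub_add_cancel, zero_add, ← hsucc] at h3
    exact h3
  refine ⟨R, solution τ k γ l, hR, fun x hx => (hsub hx).1,
    S.differentiableOn_solution hτ hR hlnice, hsol8 l hlnice,
    fun x hx => S.solution_period hτ hlnice hx, fun x hx hx' => ?_, fun m => ?_⟩
  · rw [S.solution_shift hτ hd hR hlnice hx hx', ← hfix x hx]
  · -- flatness: at depth `v` the right-hand side is `O(v ^ (-m-1)) |ξ|⁻²`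
    set K : ℝ := C * (2 ^ (m + 3) * (2 * ‖lam‖) ^ (m + 1)) with hK
    intro n
    obtain ⟨r, hr⟩ := (((hfl (m + 3)).thicken hτ hmu 1).inter
      (deep_dom.inter (deep_le_norm_snd hmu 2) : Deep τ lam mu (D ∩ {x | 2 ≤ ‖x.2‖}))) n
    refine ⟨max (max r K) (max (R n) 0), fun x h1 h2 => ?_⟩
    simp only [max_lt_iff] at h2
    obtain ⟨⟨hv1, hv2⟩, hv3, hv4⟩ := h2
    set v := level lam mu x with hv
    have hxD : x ∈ D := ⟨n, h1, hv3⟩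
    have hb : ∀ y : ℂ × ℂ, |y.1.im| ≤ max |x.1.im| (τ.im / 2) → level lam mu y = level lam mu x →
        ‖l y‖ ≤ 2 ^ (m + 3) * (2 * ‖lam‖) ^ (m + 1) / v ^ (m + 1) / ‖y.2‖ ^ 2 := by
      intro y hy1 hy2
      have hyn : |y.1.im| < (n + 1) * τ.im := by
        refine hy1.trans_lt (max_lt h1 ?_)
        have : (0 : ℝ) ≤ n * τ.im := by positivity
        linarith
      obtain ⟨hy3, hy4, hy5⟩ := hr y hyn (by rw [hy2]; exact hv1)
      have hy5 : 2 ≤ ‖y.2‖ := hy5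
      have hw := mem_closedBall_add (x := y) (hsol8 l hlnice y hy4)
      have h4 : ‖f (y + solution τ k γ l y)‖ * ‖(y + solution τ k γ l y).2‖ ^ (m + 3) ≤ 1 := hy3 hw
      have h5 := norm_snd_le_two_mul hy5 hw
      have h6 := (level_le_two_mul hmu (Adm.le_level hR hy4)).1
      rw [hy2, ← hv] at h6
      rw [hfix y hy4]
      set b := ‖f (y + solution τ k γ l y)‖
      set w := ‖(y + solution τ k γ l y).2‖
      rw [div_div, le_div_iff₀ (by positivity)]
      calc b * (v ^ (m + 1) * ‖y.2‖ ^ 2) ≤ b * ((2 * ‖lam‖ * ‖y.2‖) ^ (m + 1) * ‖y.2‖ ^ 2) := by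
            gcongr
        _ = (2 * ‖lam‖) ^ (m + 1) * (b * ‖y.2‖ ^ (m + 3)) := by ring
        _ ≤ (2 * ‖lam‖) ^ (m + 1) * (b * (2 * w) ^ (m + 3)) := by gcongr
        _ = 2 ^ (m + 3) * (2 * ‖lam‖) ^ (m + 1) * (b * w ^ (m + 3)) := by ring
        _ ≤ 2 ^ (m + 3) * (2 * ‖lam‖) ^ (m + 1) * 1 := by gcongr
        _ = _ := mul_one _
    have h7 := hC l R _ x hR (by positivity) hxD hb
    have h8 : ‖solution τ k γ l x‖ ≤ K / v ^ (m + 1) := by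
      refine h7.trans (le_of_eq ?_)
      rw [hK]; ring
    change ‖solution τ k γ l x‖ * v ^ m ≤ 1
    calc ‖solution τ k γ l x‖ * v ^ m ≤ K / v ^ (m + 1) * v ^ m := by gcongr
      _ = K / v := by
        have := hv4.ne'
        rw [pow_succ, div_mul_eq_mul_div, mul_comm K, mul_div_mul_left _ _ (pow_ne_zero m this)]
      _ ≤ 1 := by rw [div_le_one hv4]; exact hv2.le

end Picard

/-! ### Uniform estimates for the germ -/

section Germ

variable {q : ℂ} (F : NbhdDiffeo q) {K : Set ℂ}

theorem isOpen_xiDomain {V : Set (ℂ × ℂ)} (hV : IsOpen V) : IsOpen (xiDomain V) := by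
  have h1 : IsOpen {p : ℂ × ℂ | p.2 ≠ 0} := isOpen_ne_fun continuous_snd continuous_const
  have h2 : ContinuousOn (fun p : ℂ × ℂ => (p.1, p.2⁻¹)) {p | p.2 ≠ 0} :=
    continuousOn_fst.prodMk (continuousOn_snd.inv₀ fun p hp => hp)
  exact h2.isOpen_inter_preimage h1 hV

/-- By injectivity, the germ maps the complement of the curve to the complement of the curve. -/
theorem NbhdDiffeo.snd_ne_zero (hq : q ≠ 0) {p : ℂ × ℂ} (hp : p ∈ F.U) (h : p.2 ≠ 0) :
    (F.toFun p).2 ≠ 0 := by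
  intro h0
  have h1 : (F.toFun p).1 / q ≠ 0 := div_ne_zero (F.map_ne_zero p hp) hq
  have h2 := F.map_curve _ h1
  rw [mul_div_cancel₀ _ hq] at h2
  have h3 := F.inj hp (F.curve_subset _ h1) (h2 ▸ Prod.ext rfl h0)
  rw [h3] at h
  exact h rfl

theorem NbhdDiffeo.differentiableOn_xi (hq : q ≠ 0) :
    DifferentiableOn ℂ F.xi (xiDomain F.U) := by
  have h1 : DifferentiableOn ℂ (fun p : ℂ × ℂ => F.toFun (p.1, p.2⁻¹)) (xiDomain F.U) :=
    F.holo.comp (differentiableOn_fst.prodMk (differentiableOn_snd.inv fun p hp => hp.1))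
      fun p hp => hp.2
  exact (differentiable_fst.comp_differentiableOn h1).prodMk
    ((differentiable_snd.comp_differentiableOn h1).inv fun p hp =>
      F.snd_ne_zero hq hp.2 (inv_ne_zero hp.1))

theorem exists_closedBall_prod_subset {U : Set (ℂ × ℂ)} (hU : IsOpen U) (hK : IsCompact K)
    (h : ∀ z ∈ K, (z, (0 : ℂ)) ∈ U) :
    ∃ r > 0, K ×ˢ closedBall (0 : ℂ) r ⊆ U := by
  obtain ⟨u, v, -, hv, hKu, h0v, huv⟩ := generalized_tube_lemma hK isCompact_singleton
    (n := U) hU (s := K) (t := {(0 : ℂ)}) (by rintro ⟨z, y⟩ ⟨hz, rfl⟩; exact h z hz)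
  obtain ⟨r, hr, hrv⟩ := Metric.nhds_basis_closedBall.mem_iff.1 (hv.mem_nhds (h0v rfl))
  exact ⟨r, hr, fun p hp => huv ⟨hKu hp.1, hrv hp.2⟩⟩

theorem differentiableOn_slice {f : ℂ × ℂ → ℂ × ℂ} {U : Set (ℂ × ℂ)} (hf : DifferentiableOn ℂ f U)
    {z : ℂ} {s : Set ℂ} (hs : ∀ y ∈ s, (z, y) ∈ U) : DifferentiableOn ℂ (fun y => f (z, y)) s :=
  hf.comp (by fun_prop) hs

/-- The conjugacy gives `F₂(z, y) = y + O(y²)`: its terms of order `0` compare `1 / F₂` with `1 / y`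
up to a bounded error. -/
theorem FormalDiffeo.Conjugates.isBigO_snd {P : FormalDiffeo} (hP : P.Conjugates F) (hq : q ≠ 0)
    {z : ℂ} (hz : z ≠ 0) :
    (fun y : ℂ => (F.toFun (z, y)).2 - y) =O[𝓝[≠] 0] (fun y => y ^ 2) := by
  have hcs : ContinuousAt (fun y : ℂ => F.toFun (z, y)) 0 :=
    ContinuousAt.comp (g := F.toFun) (F.holo.continuousOn.continuousAt
      (F.isOpen_U.mem_nhds (F.curve_subset z hz))) (by fun_prop)
  have hU : ∀ᶠ y : ℂ in 𝓝[≠] 0, (z, y) ∈ F.U := by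
    have hc : ContinuousAt (fun y : ℂ => (z, y)) 0 := by fun_prop
    exact (hc.eventually (F.isOpen_U.mem_nhds (F.curve_subset z hz))).filter_mono nhdsWithin_le_nhds
  have hF2 : (fun y : ℂ => (F.toFun (z, y)).2) =O[𝓝[≠] 0] (fun y => y) := by
    have hd : DifferentiableAt ℂ (fun y : ℂ => (F.toFun (z, y)).2) 0 :=
      DifferentiableAt.comp (g := fun p : ℂ × ℂ => (F.toFun p).2) (f := fun y : ℂ => (z, y)) 0
        (differentiable_snd.differentiableAt.comp _ (F.holo.differentiableAt
          (F.isOpen_U.mem_nhds (F.curve_subset z hz)))) (by fun_prop)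
    have := hd.isBigO_sub
    simp only [F.map_curve z hz, sub_zero] at this
    exact this.mono nhdsWithin_le_nhds
  have h0 := (hP 0 z hz).comp_tendsto (Filter.tendsto_inv₀_nhdsNE_zero (α := ℂ))
  have h1 : (fun y : ℂ => ((F.toFun (z, y)).2)⁻¹ + P.b 0 (F.toFun (z, y)).1 -
      (y⁻¹ + P.b 0 z - 1)) =O[𝓝[≠] 0] (fun y => y) := by
    refine (isBigO_snd_prod'.trans h0).congr (fun y => ?_) (fun y => ?_) <;>
      simp [FormalDiffeo.trunc, modelMap, partialSum, NbhdDiffeo.xi]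
  have hb : (fun y : ℂ => P.b 0 z - 1 - P.b 0 (F.toFun (z, y)).1) =O[𝓝[≠] 0]
      (fun _ => (1 : ℂ)) := by
    have hqz : q * z ≠ 0 := mul_ne_zero hq hz
    have hbc : ContinuousAt (P.b 0) (F.toFun (z, 0)).1 := by
      rw [F.map_curve z hz]
      exact ((P.holo_b 0).differentiableAt (isOpen_compl_singleton.mem_nhds hqz)).continuousAt
    have : ContinuousAt (fun y : ℂ => P.b 0 z - 1 - P.b 0 (F.toFun (z, y)).1) 0 :=
      continuousAt_const.sub (ContinuousAt.comp (g := P.b 0) (f := fun y => (F.toFun (z, y)).1)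
        hbc hcs.fst)
    exact (this.tendsto.isBigO_one ℂ).mono nhdsWithin_le_nhds
  have hid : (fun y : ℂ => y) =O[𝓝[≠] 0] (fun _ => (1 : ℂ)) :=
    ((continuous_id.tendsto (0 : ℂ)).isBigO_one ℂ).mono nhdsWithin_le_nhds
  have h2 : (fun y : ℂ => ((F.toFun (z, y)).2)⁻¹ - y⁻¹) =O[𝓝[≠] 0] (fun _ => (1 : ℂ)) :=
    ((h1.trans hid).add hb).congr_left fun y => by ring
  have h3 := (hF2.mul (isBigO_refl (fun y : ℂ => y) (𝓝[≠] 0))).mul h2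
  refine (h3.neg_left.congr' ?_ (Eventually.of_forall fun y => by ring))
  filter_upwards [hU, self_mem_nhdsWithin] with y hy hy0
  have h4 := F.snd_ne_zero hq hy hy0
  have h5 : y ≠ 0 := hy0
  field_simp
  ring

/-- Uniform estimates for a germ conjugate to the model map: `F₁ = q z + O(y)` and
`1 / F₂ = 1 / y + O(1)`. -/
theorem FormalDiffeo.Conjugates.exists_bounds {P : FormalDiffeo} (hP : P.Conjugates F)
    (hq : q ≠ 0) (hK : IsCompact K) (hK0 : ∀ z ∈ K, z ≠ 0) :
    ∃ r > 0, ∃ C > 0, K ×ˢ closedBall (0 : ℂ) r ⊆ F.U ∧ ∀ z ∈ K, ∀ y ∈ ball (0 : ℂ) r, y ≠ 0 →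
      ‖(F.toFun (z, y)).1 - q * z‖ ≤ C * ‖y‖ ∧ ‖((F.toFun (z, y)).2)⁻¹ - y⁻¹‖ ≤ C := by
  obtain ⟨r, hr, hsub⟩ := exists_closedBall_prod_subset F.isOpen_U hK
    fun z hz => F.curve_subset z (hK0 z hz)
  have hc : IsCompact (K ×ˢ closedBall (0 : ℂ) r) := hK.prod (isCompact_closedBall _ _)
  have hFc : ContinuousOn F.toFun (K ×ˢ closedBall (0 : ℂ) r) := F.holo.continuousOn.mono hsub
  obtain ⟨M, hM⟩ := hc.exists_bound_of_continuousOn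
    (f := fun p : ℂ × ℂ => ((F.toFun p).1 - q * p.1, (F.toFun p).2 - p.2)) (by fun_prop)
  have hmem : ∀ z ∈ K, ∀ y ∈ ball (0 : ℂ) r, (z, y) ∈ K ×ˢ closedBall (0 : ℂ) r :=
    fun z hz y hy => ⟨hz, ball_subset_closedBall hy⟩
  have hsl : ∀ z ∈ K, DifferentiableOn ℂ (fun y => F.toFun (z, y)) (ball 0 r \ {0}) := fun z hz =>
    differentiableOn_slice F.holo fun y hy => hsub (hmem z hz y hy.1)
  have e1 : ∀ z ∈ K, ∀ y ∈ ball (0 : ℂ) r, y ≠ 0 → ‖(F.toFun (z, y)).1 - q * z‖ ≤ M * (‖y‖ / r) := by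
    intro z hz y hy hy0
    have hz0 := hK0 z hz
    have := norm_le_of_isBigO_pow (f := fun y => (F.toFun (z, y)).1 - q * z) (k := 1)
      ((differentiable_fst.comp_differentiableOn (hsl z hz)).sub_const _)
      (fun y hy _ => (norm_fst_le _).trans (hM _ (hmem z hz y hy))) (by
        have hd : DifferentiableAt ℂ (fun y : ℂ => (F.toFun (z, y)).1) 0 :=
          DifferentiableAt.comp (g := fun p : ℂ × ℂ => (F.toFun p).1) (f := fun y : ℂ => (z, y)) 0
            (differentiable_fst.differentiableAt.comp _ (F.holo.differentiableAt
              (F.isOpen_U.mem_nhds (F.curve_subset z hz0)))) (by fun_prop)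
        have := hd.isBigO_sub
        simp only [F.map_curve z hz0, sub_zero] at this
        simpa using this.mono nhdsWithin_le_nhds) hy hy0
    simpa using this
  have e2 : ∀ z ∈ K, ∀ y ∈ ball (0 : ℂ) r, y ≠ 0 →
      ‖(F.toFun (z, y)).2 - y‖ ≤ M * (‖y‖ / r) ^ 2 := fun z hz y hy hy0 =>
    norm_le_of_isBigO_pow (f := fun y => (F.toFun (z, y)).2 - y)
      ((differentiable_snd.comp_differentiableOn (hsl z hz)).sub differentiableOn_id)
      (fun y hy _ => (norm_snd_le _).trans (hM _ (hmem z hz y hy)))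
      (hP.isBigO_snd F hq (hK0 z hz)) hy hy0
  set M' := max M 1 with hM'
  have hM0 : 0 < M' := lt_max_of_lt_right one_pos
  -- on this smaller disc `|F₂| ≥ |y| / 2`
  refine ⟨min r (r ^ 2 / (2 * M')), by positivity, M' / r + 2 * M' / r ^ 2, by positivity,
    (Set.prod_mono le_rfl (closedBall_subset_closedBall (min_le_left _ _))).trans hsub,
    fun z hz y hy hy0 => ?_⟩
  have hyr := ball_subset_ball (min_le_left _ _) hy
  have hy' : ‖y‖ < r ^ 2 / (2 * M') := by
    have := ball_subset_ball (min_le_right _ _) hy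
    simpa using this
  have hn : 0 < ‖y‖ := norm_pos_iff.2 hy0
  refine ⟨(e1 z hz y hyr hy0).trans ?_, ?_⟩
  · calc M * (‖y‖ / r) ≤ M' * (‖y‖ / r) := by gcongr; exact le_max_left _ _
      _ = M' / r * ‖y‖ := by ring
      _ ≤ _ := by gcongr; linarith [show 0 < 2 * M' / r ^ 2 by positivity]
  · have h1 : ‖(F.toFun (z, y)).2 - y‖ ≤ M' / r ^ 2 * ‖y‖ * ‖y‖ := by
      refine (e2 z hz y hyr hy0).trans ?_
      calc M * (‖y‖ / r) ^ 2 ≤ M' * (‖y‖ / r) ^ 2 := by gcongr; exact le_max_left _ _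
        _ = _ := by ring
    have h2 : M' / r ^ 2 * ‖y‖ ≤ 1 / 2 := by
      rw [lt_div_iff₀ (by positivity)] at hy'
      rw [div_mul_eq_mul_div, div_le_iff₀ (by positivity)]
      linarith
    have h3 : ‖y‖ / 2 ≤ ‖(F.toFun (z, y)).2‖ := by
      have := norm_sub_norm_le y (F.toFun (z, y)).2
      rw [norm_sub_rev] at this
      nlinarith
    have h4 : (F.toFun (z, y)).2 ≠ 0 := norm_pos_iff.1 (by linarith)
    have h5 : ((F.toFun (z, y)).2)⁻¹ - y⁻¹ =
        -((F.toFun (z, y)).2 - y) / ((F.toFun (z, y)).2 * y) := by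
      field_simp; ring
    rw [h5, norm_div, norm_neg, norm_mul, div_le_iff₀ (by positivity)]
    calc _ ≤ M' / r ^ 2 * ‖y‖ * ‖y‖ := h1
      _ = 2 * M' / r ^ 2 * (‖y‖ / 2 * ‖y‖) := by ring
      _ ≤ (M' / r + 2 * M' / r ^ 2) * (‖(F.toFun (z, y)).2‖ * ‖y‖) := by
        gcongr
        linarith [show 0 < M' / r by positivity]

/-- The same estimates in the coordinate `ξ`. -/
theorem FormalDiffeo.Conjugates.exists_xi_bounds {P : FormalDiffeo} (hP : P.Conjugates F)
    (hq : q ≠ 0) (hK : IsCompact K) (hK0 : ∀ z ∈ K, z ≠ 0) :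
    ∃ C > 0, ∃ R > 0, ∀ p : ℂ × ℂ, p.1 ∈ K → R < ‖p.2‖ → p ∈ xiDomain F.U ∧
      ‖(F.xi p).1 - q * p.1‖ ≤ C / ‖p.2‖ ∧ ‖(F.xi p).2 - p.2‖ ≤ C := by
  obtain ⟨r, hr, C, hC, hsub, h⟩ := hP.exists_bounds F hq hK hK0
  refine ⟨C, hC, r⁻¹, inv_pos.2 hr, fun p hp hR => ?_⟩
  have h0 : 0 < ‖p.2‖ := (inv_pos.2 hr).trans hR
  have h1 : p.2⁻¹ ∈ ball (0 : ℂ) r := by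
    rw [mem_ball_zero_iff, norm_inv]
    exact inv_lt_of_inv_lt₀ hr hR
  have h2 := h p.1 hp _ h1 (inv_ne_zero (norm_pos_iff.1 h0))
  refine ⟨⟨norm_pos_iff.1 h0, hsub ⟨hp, ball_subset_closedBall h1⟩⟩, ?_, ?_⟩
  · rw [div_eq_mul_inv, ← norm_inv]; exact h2.1
  · simpa [NbhdDiffeo.xi] using h2.2

/-- The conjugacy relation modulo `ξ ^ (-m-1)`, uniformly for `z` in a compact set. -/
theorem FormalDiffeo.Conjugates.exists_trunc_bound {P : FormalDiffeo} (hP : P.Conjugates F)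
    (hq : q ≠ 0) (hK : IsCompact K) (hK0 : ∀ z ∈ K, z ≠ 0) (m : ℕ) :
    ∃ C > 0, ∃ R > 0, ∀ p : ℂ × ℂ, p.1 ∈ K → R < ‖p.2‖ →
      ‖P.trunc m (F.xi p) - modelMap q (P.trunc m p)‖ ≤ C / ‖p.2‖ ^ (m + 1) := by
  obtain ⟨r, hr, C, hC, hsub, h⟩ := hP.exists_bounds F hq hK hK0
  have hc : IsCompact (K ×ˢ closedBall (0 : ℂ) r) := hK.prod (isCompact_closedBall _ _)
  -- the difference of the two sides, without the term `1 / F₂ - 1 / y`, extends to the curve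
  set S : ℂ × ℂ → ℂ × ℂ := fun p =>
    ((F.toFun p).1 + ∑ n ∈ Finset.range (m + 1), P.a n (F.toFun p).1 * (F.toFun p).2 ^ n -
      q * (p.1 + ∑ n ∈ Finset.range (m + 1), P.a n p.1 * p.2 ^ n),
    ∑ n ∈ Finset.range (m + 1), P.b n (F.toFun p).1 * (F.toFun p).2 ^ n -
      ∑ n ∈ Finset.range (m + 1), P.b n p.1 * p.2 ^ n + 1) with hS
  have hSd : DifferentiableOn ℂ S F.U := by
    have hF1 : DifferentiableOn ℂ (fun p => (F.toFun p).1) F.U :=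
      differentiable_fst.comp_differentiableOn F.holo
    have hF2 : DifferentiableOn ℂ (fun p => (F.toFun p).2) F.U :=
      differentiable_snd.comp_differentiableOn F.holo
    have hcF : ∀ c : ℕ → ℂ → ℂ, (∀ n, DifferentiableOn ℂ (c n) {0}ᶜ) → DifferentiableOn ℂ
        (fun p => ∑ n ∈ Finset.range (m + 1), c n (F.toFun p).1 * (F.toFun p).2 ^ n) F.U :=
      fun c hc => DifferentiableOn.fun_sum fun n _ =>
        ((hc n).comp hF1 fun p hp => F.map_ne_zero p hp).mul (hF2.pow n)
    have hcp : ∀ c : ℕ → ℂ → ℂ, (∀ n, DifferentiableOn ℂ (c n) {0}ᶜ) → DifferentiableOn ℂ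
        (fun p : ℂ × ℂ => ∑ n ∈ Finset.range (m + 1), c n p.1 * p.2 ^ n) F.U :=
      fun c hc => DifferentiableOn.fun_sum fun n _ =>
        ((hc n).comp differentiableOn_fst fun p hp => F.ne_zero_of_mem p hp).mul
          (differentiableOn_snd.pow n)
    exact ((hF1.add (hcF _ P.holo_a)).sub ((differentiableOn_fst.add
      (hcp _ P.holo_a)).const_mul q)).prodMk
      (((hcF _ P.holo_b).sub (hcp _ P.holo_b)).add_const _)
  obtain ⟨M, hM⟩ := hc.exists_bound_of_continuousOn (hSd.continuousOn.mono hsub)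
  set M' := max M 1 with hM'
  have hM0 : 0 < M' := lt_max_of_lt_right one_pos
  refine ⟨(M' + C) / r ^ (m + 1), by positivity, r⁻¹, inv_pos.2 hr, fun p hp hR => ?_⟩
  have h0 : 0 < ‖p.2‖ := (inv_pos.2 hr).trans hR
  have h1 : p.2⁻¹ ∈ ball (0 : ℂ) r := by
    rw [mem_ball_zero_iff, norm_inv]
    exact inv_lt_of_inv_lt₀ hr hR
  have hD : ∀ y : ℂ, P.trunc m (F.xi (p.1, y⁻¹)) - modelMap q (P.trunc m (p.1, y⁻¹)) =
      S (p.1, y) + (0, ((F.toFun (p.1, y)).2)⁻¹ - y⁻¹) := by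
    intro y
    simp only [FormalDiffeo.trunc, modelMap, partialSum, NbhdDiffeo.xi, inv_inv, hS]
    refine Prod.ext ?_ ?_
    · simp
    · simp; ring
  have hmem : ∀ y ∈ ball (0 : ℂ) r, (p.1, y) ∈ K ×ˢ closedBall (0 : ℂ) r :=
    fun y hy => ⟨hp, ball_subset_closedBall hy⟩
  have key := norm_le_of_isBigO_pow (r := r) (M := M' + C) (k := m + 1)
    (f := fun y => P.trunc m (F.xi (p.1, y⁻¹)) - modelMap q (P.trunc m (p.1, y⁻¹))) ?_ ?_ ?_ h1
    (inv_ne_zero (norm_pos_iff.1 h0))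
  · simp only [inv_inv, Prod.mk.eta] at key
    refine key.trans (le_of_eq ?_)
    rw [norm_inv, div_pow, inv_pow]
    field_simp
  · simp only [hD]
    refine (differentiableOn_slice hSd fun y hy => hsub (hmem y hy.1)).add
      ((differentiableOn_const _).prodMk (DifferentiableOn.sub ?_ ?_))
    · exact (differentiable_snd.comp_differentiableOn (differentiableOn_slice F.holo
        fun y hy => hsub (hmem y hy.1))).inv fun y hy => F.snd_ne_zero hq (hsub (hmem y hy.1)) hy.2
    · exact differentiableOn_id.inv fun y hy => hy.2
  · intro y hy hy0
    rw [hD]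
    refine (norm_add_le _ _).trans (add_le_add ((hM _ (hmem y hy)).trans (le_max_left _ _)) ?_)
    rw [Prod.norm_mk, norm_zero, max_eq_right (norm_nonneg _)]
    exact (h p.1 hp y hy hy0).2
  · refine ((hP m p.1 (hK0 _ hp)).comp_tendsto
      (Filter.tendsto_inv₀_nhdsNE_zero (α := ℂ))).congr (fun y => rfl) fun y => ?_
    simp

end Germ

/-! ### The Borel–Ritt theorem -/

section BorelRitt

/-- The principal square root; it maps the half-plane `Re w > 0` into the sector `|arg| < π / 4`. -/
noncomputable def halfRoot (w : ℂ) : ℂ := exp (log w / 2)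

theorem halfRoot_sq {w : ℂ} (hw : w ≠ 0) : halfRoot w ^ 2 = w := by
  unfold halfRoot
  rw [← exp_nat_mul]
  push_cast
  rw [mul_div_cancel₀ _ (two_ne_zero), exp_log hw]

theorem norm_halfRoot_sq {w : ℂ} (hw : w ≠ 0) : ‖halfRoot w‖ ^ 2 = ‖w‖ := by
  rw [← norm_pow, halfRoot_sq hw]

theorem halfRoot_re_pos {w : ℂ} (hw : 0 < w.re) : 0 < (halfRoot w).re := by
  have h := abs_lt.1 (abs_arg_lt_pi_div_two_iff.2 (Or.inl hw))
  have h2 : (log w / 2).im = arg w / 2 := by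
    rw [← log_im]; simp
  unfold halfRoot
  rw [exp_re, h2]
  exact mul_pos (Real.exp_pos _) (Real.cos_pos_of_mem_Ioo ⟨by linarith [h.1, Real.pi_pos],
    by linarith [h.2, Real.pi_pos]⟩)

theorem norm_halfRoot_le {w : ℂ} (hw : 0 < w.re) : ‖halfRoot w‖ ≤ 2 * (halfRoot w).re := by
  have h0 : w ≠ 0 := fun h => by simp [h] at hw
  have h1 := halfRoot_re_pos hw
  have h2 := congrArg re (halfRoot_sq h0)
  rw [pow_two, mul_re] at h2
  have h3 : ‖halfRoot w‖ ^ 2 = (halfRoot w).re * (halfRoot w).re +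
      (halfRoot w).im * (halfRoot w).im := by rw [← normSq_eq_norm_sq, normSq_apply]
  refine le_of_sq_le_sq ?_ (by positivity)
  nlinarith

theorem differentiableAt_halfRoot {w : ℂ} (hw : 0 < w.re) : DifferentiableAt ℂ halfRoot w := by
  unfold halfRoot
  exact ((differentiableAt_log (Or.inl hw)).div_const 2).cexp

theorem norm_exp_neg_le_one {w : ℂ} (hw : 0 ≤ w.re) : ‖exp (-w)‖ ≤ 1 := by
  rw [norm_exp, neg_re]
  exact Real.exp_le_one_iff.2 (by linarith)

theorem norm_one_sub_exp_neg_le {w : ℂ} (hw : 0 ≤ w.re) : ‖1 - exp (-w)‖ ≤ ‖w‖ := by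
  have hconv : Convex ℝ {x : ℂ | 0 ≤ x.re} := convex_halfSpace_re_ge 0
  have := hconv.norm_image_sub_le_of_norm_hasDerivWithin_le (f := fun x : ℂ => exp (-x))
    (f' := fun x => exp (-x) * -1) (C := 1) (x := w) (y := 0)
    (fun x _ => ((hasDerivAt_neg x).cexp).hasDerivWithinAt)
    (fun x hx => by simpa using norm_exp_neg_le_one (w := x) hx) hw (by simp)
  simpa using this

/-- `exp (-ε √w)` is smaller than every power of `1 / w`, uniformly on the half-plane `Re w > 0`. -/
theorem norm_exp_neg_halfRoot_le {w : ℂ} (hw : 0 < w.re) {ε : ℝ} (hε : 0 < ε) (m : ℕ) :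
    ‖exp (-(ε * halfRoot w))‖ * ‖w‖ ^ m ≤ (2 * m).factorial * (2 / ε) ^ (2 * m) := by
  have h0 : w ≠ 0 := fun h => by simp [h] at hw
  have h1 := norm_halfRoot_le hw
  have h2 := halfRoot_re_pos hw
  set s := halfRoot w
  have h3 : ‖exp (-(ε * s))‖ = Real.exp (-(ε * s.re)) := by simp [norm_exp]
  have h4 := Real.pow_div_factorial_le_exp (ε * s.re) (by positivity) (2 * m)
  rw [div_le_iff₀ (by positivity)] at h4
  rw [h3, ← norm_halfRoot_sq h0, ← pow_mul]
  calc Real.exp (-(ε * s.re)) * ‖s‖ ^ (2 * m)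
      ≤ Real.exp (-(ε * s.re)) * (2 * s.re) ^ (2 * m) := by gcongr
    _ = Real.exp (-(ε * s.re)) * (ε * s.re) ^ (2 * m) * (2 / ε) ^ (2 * m) := by
        rw [mul_assoc, ← mul_pow]; congr 2; field_simp
    _ ≤ Real.exp (-(ε * s.re)) * (Real.exp (ε * s.re) * (2 * m).factorial) *
        (2 / ε) ^ (2 * m) := by gcongr
    _ = _ := by rw [← mul_assoc, ← Real.exp_add]; simp

/-- The closed annulus `exp (-L) ≤ |z| ≤ exp L`. -/
def annulus (L : ℝ) : Set ℂ := {z | Real.exp (-L) ≤ ‖z‖ ∧ ‖z‖ ≤ Real.exp L}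

theorem isCompact_annulus (L : ℝ) : IsCompact (annulus L) := by
  refine Metric.isCompact_of_isClosed_isBounded ?_ ?_
  · exact (isClosed_le continuous_const continuous_norm).inter
      (isClosed_le continuous_norm continuous_const)
  · exact (isBounded_closedBall (x := (0 : ℂ)) (r := Real.exp L)).subset fun z hz => by
      simpa using hz.2

theorem annulus_ne_zero {L : ℝ} {z : ℂ} (hz : z ∈ annulus L) : z ≠ 0 :=
  norm_pos_iff.1 ((Real.exp_pos _).trans_le hz.1)

theorem annulus_mono {L L' : ℝ} (h : L ≤ L') : annulus L ⊆ annulus L' := fun _ hz =>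
  ⟨(Real.exp_le_exp.2 (by linarith)).trans hz.1, hz.2.trans (Real.exp_le_exp.2 h)⟩

/-- The half-plane `{Im (lam ξ) > 0, |ξ| > 1}` over `ℂ*`. -/
def halfSpace (lam : ℂ) : Set (ℂ × ℂ) := {p | p.1 ≠ 0 ∧ 1 < ‖p.2‖ ∧ 0 < (lam * p.2).im}

theorem isOpen_halfSpace (lam : ℂ) : IsOpen (halfSpace lam) :=
  (isOpen_ne_fun continuous_fst continuous_const).inter
    (IsOpen.inter (s := {p : ℂ × ℂ | 1 < ‖p.2‖}) (isOpen_lt continuous_const (by fun_prop))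
      (isOpen_lt (f := fun _ => (0 : ℝ)) (g := fun p : ℂ × ℂ => (lam * p.2).im)
        continuous_const (by fun_prop)))

/-- The `n`-th term of the Borel–Ritt sum: `c ξ⁻ⁿ` damped by a function flat at infinity, with
parameter `ε`. -/
noncomputable def borelTerm (lam : ℂ) (c : ℂ → ℂ) (ε : ℝ) (n : ℕ) (p : ℂ × ℂ) : ℂ :=
  c p.1 * (p.2⁻¹) ^ n * (1 - exp (-(ε * halfRoot (-I * (lam * p.2)))))

theorem neg_I_mul_re (w : ℂ) : (-I * w).re = w.im := by simp

theorem norm_tsum_sub_sum_mul_le {T d : ℕ → ℂ} {u : ℕ → ℝ} {x : ℝ} {m : ℕ} (hx : 0 < x)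
    (hT : Summable T) (hu : Summable u) (h1 : ∀ n ≤ m, ‖T n - d n‖ * x ≤ u n)
    (h2 : ∀ n > m, ‖T n‖ * x ≤ u n) :
    ‖∑' n, T n - ∑ n ∈ Finset.range (m + 1), d n‖ * x ≤ ∑' n, |u n| := by
  have hu0 : Summable fun n => |u n| := hu.abs
  have h4 : Summable fun n => |u (n + (m + 1))| :=
    (summable_nat_add_iff (f := fun n => |u n|) (m + 1)).2 hu0
  rw [← hT.sum_add_tsum_nat_add (m + 1), ← hu0.sum_add_tsum_nat_add (m + 1), add_sub_right_comm,
    ← Finset.sum_sub_distrib]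
  refine (mul_le_mul_of_nonneg_right (norm_add_le _ _) hx.le).trans ?_
  rw [add_mul]
  refine add_le_add ?_ ?_
  · refine (mul_le_mul_of_nonneg_right (norm_sum_le _ _) hx.le).trans ?_
    rw [Finset.sum_mul]
    exact Finset.sum_le_sum fun n hn =>
      (h1 n (Nat.lt_succ_iff.1 (Finset.mem_range.1 hn))).trans (le_abs_self _)
  · rw [← le_div_iff₀ hx]
    rw [← tsum_div_const]
    refine tsum_of_norm_bounded (h4.div_const x).hasSum fun n => ?_
    rw [le_div_iff₀ hx]
    exact (h2 _ (by omega)).trans (le_abs_self _)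

/-- Borel–Ritt: every power series in `1 / ξ` with coefficients holomorphic on `ℂ*` is the
asymptotic expansion of a function holomorphic over a half-plane, uniformly up to the boundary of
the half-plane. -/
theorem exists_borelRitt {lam : ℂ} {c : ℕ → ℂ → ℂ}
    (hc : ∀ n, DifferentiableOn ℂ (c n) {0}ᶜ) :
    ∃ f : ℂ × ℂ → ℂ, DifferentiableOn ℂ f (halfSpace lam) ∧ ∀ (m : ℕ) (L : ℝ), ∃ C > 0,
      ∀ p ∈ halfSpace lam, p.1 ∈ annulus L → ‖f p - partialSum c m p‖ ≤ C / ‖p.2‖ ^ (m + 1) := by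
  have hbd : ∀ (n : ℕ) (L : ℝ), ∃ N > 0, ∀ z ∈ annulus L, ‖c n z‖ ≤ N := fun n L => by
    obtain ⟨N, hN⟩ := (isCompact_annulus L).exists_bound_of_continuousOn
      ((hc n).continuousOn.mono fun z hz => annulus_ne_zero hz)
    exact ⟨max N 1, by positivity, fun z hz => (hN z hz).trans (le_max_left _ _)⟩
  choose N hN0 hN using hbd
  -- the `n`-th term is made of order `2⁻ⁿ` on the `n`-th annulus
  set ε : ℕ → ℝ := fun n => 1 / (2 ^ n * N n n) with hε
  have hε0 : ∀ n, 0 < ε n := fun n => by have := hN0 n n; positivity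
  set T : ℕ → ℂ × ℂ → ℂ := fun n => borelTerm lam (c n) (ε n) n with hT
  have hre : ∀ p ∈ halfSpace lam, 0 < (-I * (lam * p.2)).re := fun p hp => by
    rw [neg_I_mul_re]; exact hp.2.2
  have hdiff : ∀ n, DifferentiableOn ℂ (T n) (halfSpace lam) := by
    intro n p hp
    have h1 : DifferentiableAt ℂ (fun p : ℂ × ℂ => c n p.1) p :=
      DifferentiableAt.comp (g := c n) p
        ((hc n).differentiableAt (isOpen_compl_singleton.mem_nhds hp.1)) differentiableAt_fst
    have h2 : DifferentiableAt ℂ (fun p : ℂ × ℂ => p.2⁻¹) p :=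
      differentiableAt_snd.inv (norm_pos_iff.1 (one_pos.trans hp.2.1))
    have h3 : DifferentiableAt ℂ (fun p : ℂ × ℂ => halfRoot (-I * (lam * p.2))) p :=
      DifferentiableAt.comp (g := halfRoot) p (differentiableAt_halfRoot (hre p hp)) (by fun_prop)
    exact ((h1.mul (h2.pow n)).mul
      ((((h3.const_mul (ε n : ℂ)).neg).cexp).const_sub 1)).differentiableWithinAt
  -- the bounds on the terms, for an order `m` of the expansion and an annulus
  have key : ∀ (m : ℕ) (L : ℝ), ∃ u : ℕ → ℝ, Summable u ∧ ∀ p ∈ halfSpace lam, p.1 ∈ annulus L →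
      ∀ n, (n ≤ m → ‖T n p‖ ≤ u n ∧
        ‖T n p - c n p.1 * (p.2⁻¹) ^ n‖ * ‖p.2‖ ^ (m + 1) ≤ u n) ∧
        (m < n → ‖T n p‖ * ‖p.2‖ ^ (m + 1) ≤ u n) := by
    intro m L
    set E : ℕ → ℝ := fun n =>
      (2 * (m + 1)).factorial * (2 / ε n) ^ (2 * (m + 1)) with hE
    -- the terms of index greater than `l` are small on the given annulus; the others are finite
    -- in number
    obtain ⟨l, hl⟩ := exists_nat_ge (max L (m + 1))
    by_cases hlam : lam = 0
    · exact ⟨0, summable_zero, fun p hp => by have := hp.2.2; simp [hlam] at this⟩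
    have hlam0 : 0 < ‖lam‖ := norm_pos_iff.2 hlam
    refine ⟨fun n => if n ≤ l then N n L * (2 + E n / ‖lam‖ ^ (m + 1))
      else (‖lam‖ + 1) * (1 / 2) ^ n, ?_, fun p hp hpL n => ?_⟩
    · have h1 : Summable fun n : ℕ => (‖lam‖ + 1) * (1 / 2 : ℝ) ^ n :=
        (summable_geometric_two).mul_left _
      refine (summable_nat_add_iff (l + 1)).1 (((summable_nat_add_iff (l + 1)).2 h1).congr
        fun n => ?_)
      rw [if_neg (by omega)]
    · have hξ : 1 ≤ ‖p.2‖ := hp.2.1.le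
      have hξ0 : 0 < ‖p.2‖ := one_pos.trans_le hξ
      have hw := hre p hp
      have hw0 : -I * (lam * p.2) ≠ 0 := fun h => by rw [h] at hw; simp at hw
      have hwn : ‖-I * (lam * p.2)‖ = ‖lam‖ * ‖p.2‖ := by simp
      have hs0 := (halfRoot_re_pos hw).le
      have hcn := hN n L p.1 hpL
      have hEn : 0 ≤ E n := by have := hε0 n; positivity
      have hNn := hN0 n L
      have hre2 : 0 ≤ ((ε n : ℂ) * halfRoot (-I * (lam * p.2))).re := by
        rw [re_ofReal_mul]; exact mul_nonneg (hε0 n).le hs0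
      have htwo : ‖1 - exp (-((ε n : ℂ) * halfRoot (-I * (lam * p.2))))‖ ≤ 2 := by
        have h1 := norm_sub_le 1 (exp (-((ε n : ℂ) * halfRoot (-I * (lam * p.2)))))
        have h2 := norm_exp_neg_le_one hre2
        rw [norm_one] at h1
        linarith
      have hTn : ‖T n p‖ = ‖c n p.1‖ * (‖p.2‖⁻¹) ^ n *
          ‖1 - exp (-((ε n : ℂ) * halfRoot (-I * (lam * p.2))))‖ := by
        simp only [hT, borelTerm, norm_mul, norm_pow, norm_inv]
      have hinv1 : (‖p.2‖⁻¹) ^ n ≤ 1 := pow_le_one₀ (by positivity) (inv_le_one_of_one_le₀ hξ)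
      refine ⟨fun hnm => ?_, fun hnm => ?_⟩
      · have hnl : n ≤ l := by
          have : (m + 1 : ℝ) ≤ l := (le_max_right _ _).trans hl
          have : m + 1 ≤ l := by exact_mod_cast this
          omega
        beta_reduce
        rw [if_pos hnl]
        constructor
        · rw [hTn]
          calc _ ≤ N n L * 1 * 2 := by gcongr
            _ = N n L * (2 + 0) := by ring
            _ ≤ _ := by gcongr; positivity
        · have h1 : T n p - c n p.1 * (p.2⁻¹) ^ n = -(c n p.1 * (p.2⁻¹) ^ n *
              exp (-((ε n : ℂ) * halfRoot (-I * (lam * p.2))))) := by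
            simp only [hT, borelTerm]; ring
          have h2 := norm_exp_neg_halfRoot_le hw (hε0 n) (m + 1)
          rw [hwn, mul_pow] at h2
          rw [h1, norm_neg, norm_mul, norm_mul, norm_pow, norm_inv]
          set b := ‖exp (-((ε n : ℂ) * halfRoot (-I * (lam * p.2))))‖
          have h3 : b * ‖p.2‖ ^ (m + 1) ≤ E n / ‖lam‖ ^ (m + 1) := by
            rw [le_div_iff₀ (by positivity)]
            linarith
          calc ‖c n p.1‖ * ‖p.2‖⁻¹ ^ n * b * ‖p.2‖ ^ (m + 1)
              = ‖c n p.1‖ * ‖p.2‖⁻¹ ^ n * (b * ‖p.2‖ ^ (m + 1)) := by ring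
            _ ≤ N n L * 1 * (E n / ‖lam‖ ^ (m + 1)) := by gcongr
            _ = N n L * (0 + E n / ‖lam‖ ^ (m + 1)) := by ring
            _ ≤ _ := by gcongr; norm_num
      · rw [hTn]
        beta_reduce
        split_ifs with hnl
        · have h1 : (‖p.2‖⁻¹) ^ n * ‖p.2‖ ^ (m + 1) ≤ 1 := by
            rw [inv_pow, inv_mul_le_iff₀ (by positivity), mul_one]
            exact pow_le_pow_right₀ hξ hnm
          calc _ = ‖c n p.1‖ * (‖p.2‖⁻¹ ^ n * ‖p.2‖ ^ (m + 1)) *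
                ‖1 - exp (-((ε n : ℂ) * halfRoot (-I * (lam * p.2))))‖ := by ring
            _ ≤ N n L * 1 * 2 := by gcongr
            _ = N n L * (2 + 0) := by ring
            _ ≤ _ := by gcongr; positivity
        · have hnl' : l + 1 ≤ n := by omega
          have hlm : m + 1 ≤ l := by
            have : (m + 1 : ℝ) ≤ l := (le_max_right _ _).trans hl
            exact_mod_cast this
          have hLn : L ≤ n := by
            have : L ≤ l := (le_max_left _ _).trans hl
            have : (l : ℝ) ≤ n := by exact_mod_cast (by omega : l ≤ n)
            linarith
          have hc2 := hN n n p.1 (annulus_mono hLn hpL)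
          have hsn : ‖halfRoot (-I * (lam * p.2))‖ ≤ (‖lam‖ + 1) * ‖p.2‖ := by
            have h1 := norm_halfRoot_sq hw0
            rw [hwn] at h1
            refine le_of_sq_le_sq ?_ (by positivity)
            rw [h1]
            calc ‖lam‖ * ‖p.2‖ ≤ (‖lam‖ + 1) ^ 2 * ‖p.2‖ ^ 2 := by
                  gcongr
                  · nlinarith
                  · nlinarith
              _ = _ := by ring
          have h2 : ‖1 - exp (-((ε n : ℂ) * halfRoot (-I * (lam * p.2))))‖ ≤
              ε n * ((‖lam‖ + 1) * ‖p.2‖) := by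
            refine (norm_one_sub_exp_neg_le hre2).trans ?_
            rw [norm_mul, norm_real, Real.norm_of_nonneg (hε0 n).le]
            have := (hε0 n).le
            gcongr
          have h3 : (‖p.2‖⁻¹) ^ n * (‖p.2‖ * ‖p.2‖ ^ (m + 1)) ≤ 1 := by
            rw [inv_pow, inv_mul_le_iff₀ (by positivity), mul_one, ← pow_succ']
            exact pow_le_pow_right₀ hξ (by omega)
          have h4 := hN0 n n
          calc _ ≤ N n n * ‖p.2‖⁻¹ ^ n * (ε n * ((‖lam‖ + 1) * ‖p.2‖)) * ‖p.2‖ ^ (m + 1) := by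
                gcongr
            _ = N n n * ε n * (‖lam‖ + 1) * (‖p.2‖⁻¹ ^ n * (‖p.2‖ * ‖p.2‖ ^ (m + 1))) := by ring
            _ ≤ N n n * ε n * (‖lam‖ + 1) * 1 := by
                have := (hε0 n).le
                gcongr
            _ = _ := by simp only [hε, one_div, inv_pow]; field_simp
  have hbound : ∀ (m : ℕ) (L : ℝ), ∃ u : ℕ → ℝ, Summable u ∧
      ∀ p ∈ halfSpace lam, p.1 ∈ annulus L → ∀ n, ‖T n p‖ ≤ u n := by
    intro m L
    obtain ⟨u, hu, hk⟩ := key m L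
    refine ⟨u, hu, fun p hp hpL n => ?_⟩
    rcases le_or_gt n m with h | h
    · exact ((hk p hp hpL n).1 h).1
    · refine le_trans (le_mul_of_one_le_right (norm_nonneg _) ?_) ((hk p hp hpL n).2 h)
      exact one_le_pow₀ hp.2.1.le
  refine ⟨fun p => ∑' n, T n p, fun p hp => ?_, fun m L => ?_⟩
  · obtain ⟨L, hL⟩ : ∃ L : ℝ, Real.exp (-L) < ‖p.1‖ ∧ ‖p.1‖ < Real.exp L := by
      have h0 : 0 < ‖p.1‖ := norm_pos_iff.2 hp.1
      refine ⟨|Real.log ‖p.1‖| + 1, ?_, ?_⟩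
      · rw [← Real.lt_log_iff_exp_lt h0]
        linarith [neg_abs_le (Real.log ‖p.1‖)]
      · rw [← Real.log_lt_iff_lt_exp h0]
        linarith [le_abs_self (Real.log ‖p.1‖)]
    obtain ⟨u, hu, hk⟩ := hbound 0 L
    set V : Set (ℂ × ℂ) := halfSpace lam ∩ {p | Real.exp (-L) < ‖p.1‖ ∧ ‖p.1‖ < Real.exp L}
    have hVo : IsOpen V := (isOpen_halfSpace lam).inter
      (IsOpen.inter (s := {p : ℂ × ℂ | Real.exp (-L) < ‖p.1‖})
        (t := {p : ℂ × ℂ | ‖p.1‖ < Real.exp L})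
        (isOpen_lt continuous_const (by fun_prop)) (isOpen_lt (by fun_prop) continuous_const))
    have h1 := tendstoUniformlyOn_tsum_nat (f := T) (s := V) hu
      fun n p hp => hk p hp.1 ⟨hp.2.1.le, hp.2.2.le⟩ n
    exact ((differentiableOn_of_tendstoLocallyUniformlyOn hVo (fun N => DifferentiableOn.fun_sum
      fun n _ => (hdiff n).mono inter_subset_left)
      h1.tendstoLocallyUniformlyOn).differentiableAt (hVo.mem_nhds ⟨hp, hL⟩)).differentiableWithinAt
  · obtain ⟨u, hu, hk⟩ := key m L
    obtain ⟨u', hu', hk'⟩ := hbound m L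
    refine ⟨∑' n, |u n| + 1, by positivity, fun p hp hpL => ?_⟩
    have hξ0 : 0 < ‖p.2‖ := one_pos.trans hp.2.1
    rw [le_div_iff₀ (by positivity)]
    exact (norm_tsum_sub_sum_mul_le (pow_pos hξ0 _) (Summable.of_norm_bounded hu' (hk' p hp hpL)) hu
      (fun n hn => ((hk p hp hpL n).1 hn).2) (fun n hn => (hk p hp hpL n).2 hn)).trans
      (le_add_of_nonneg_right zero_le_one)

end BorelRitt

/-! ### Estimates at large depth -/

section DeepBigO

variable {τ lam : ℂ} {mu : ℝ} {E E' : Type*} [NormedAddCommGroup E] [NormedAddCommGroup E']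
  {f g : ℂ × ℂ → E} {k l : ℕ}

/-- `f = O(ξ ^ (-k))` in the deep part of each strip. -/
def DeepBigO (τ lam : ℂ) (mu : ℝ) (k : ℕ) (f : ℂ × ℂ → E) : Prop :=
  ∀ n : ℕ, ∃ C r : ℝ, ∀ x : ℂ × ℂ, |x.1.im| < (n + 1) * τ.im → r < level lam mu x →
    ‖f x‖ * ‖x.2‖ ^ k ≤ C

theorem Deep.exists_forall {A : Set (ℂ × ℂ)} (hA : Deep τ lam mu A) (n : ℕ) (s : ℝ) :
    ∃ r, s ≤ r ∧ ∀ x : ℂ × ℂ, |x.1.im| < (n + 1) * τ.im → r < level lam mu x → x ∈ A := by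
  obtain ⟨r, hr⟩ := hA n
  exact ⟨max s r, le_max_left _ _, fun x h1 h2 => hr x h1 ((le_max_right _ _).trans_lt h2)⟩

theorem DeepBigO.of_le {f' : ℂ × ℂ → E'} (hf : DeepBigO τ lam mu k f) {c : ℝ} (hc : 0 ≤ c)
    (h : Deep τ lam mu {x | ‖f' x‖ ≤ c * ‖f x‖}) : DeepBigO τ lam mu k f' := fun n => by
  obtain ⟨C, r, hr⟩ := hf n
  obtain ⟨s, hs, hs'⟩ := h.exists_forall n r
  refine ⟨c * C, s, fun x h1 h2 => ?_⟩
  have h3 : ‖f' x‖ ≤ c * ‖f x‖ := hs' x h1 h2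
  calc ‖f' x‖ * ‖x.2‖ ^ k ≤ c * ‖f x‖ * ‖x.2‖ ^ k := by gcongr
    _ = c * (‖f x‖ * ‖x.2‖ ^ k) := by ring
    _ ≤ c * C := by gcongr; exact hr x h1 (hs.trans_lt h2)

theorem DeepBigO.congr (hf : DeepBigO τ lam mu k f) (h : Deep τ lam mu {x | g x = f x}) :
    DeepBigO τ lam mu k g :=
  hf.of_le zero_le_one (h.mono fun x hx => by
    have : g x = f x := hx
    simp [this])

theorem DeepBigO.add (hf : DeepBigO τ lam mu k f) (hg : DeepBigO τ lam mu k g) :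
    DeepBigO τ lam mu k (fun x => f x + g x) := fun n => by
  obtain ⟨C, r, hr⟩ := hf n
  obtain ⟨D, s, hs⟩ := hg n
  refine ⟨C + D, max r s, fun x h1 h2 => ?_⟩
  calc ‖f x + g x‖ * ‖x.2‖ ^ k ≤ (‖f x‖ + ‖g x‖) * ‖x.2‖ ^ k := by gcongr; exact norm_add_le _ _
    _ ≤ C + D := by
      rw [add_mul]
      exact add_le_add (hr x h1 ((le_max_left _ _).trans_lt h2))
        (hs x h1 ((le_max_right _ _).trans_lt h2))

theorem DeepBigO.neg (hf : DeepBigO τ lam mu k f) : DeepBigO τ lam mu k (fun x => -f x) :=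
  fun n => by simpa only [norm_neg] using hf n

theorem DeepBigO.sub (hf : DeepBigO τ lam mu k f) (hg : DeepBigO τ lam mu k g) :
    DeepBigO τ lam mu k (fun x => f x - g x) := by
  simpa only [sub_eq_add_neg] using hf.add hg.neg

theorem deepBigO_const (c : E) : DeepBigO τ lam mu 0 (fun _ => c) := fun n =>
  ⟨‖c‖, 0, fun x _ _ => by simp⟩

theorem DeepBigO.prodMk {f' : ℂ × ℂ → E'} (hf : DeepBigO τ lam mu k f)
    (hf' : DeepBigO τ lam mu k f') : DeepBigO τ lam mu k (fun x => (f x, f' x)) := fun n => by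
  obtain ⟨C, r, hr⟩ := hf n
  obtain ⟨D, s, hs⟩ := hf' n
  refine ⟨max C D, max r s, fun x h1 h2 => ?_⟩
  rw [Prod.norm_mk, max_mul_of_nonneg _ _ (by positivity)]
  exact max_le_max (hr x h1 ((le_max_left _ _).trans_lt h2))
    (hs x h1 ((le_max_right _ _).trans_lt h2))

theorem DeepBigO.mono (hmu : |mu| ≤ 1) (hf : DeepBigO τ lam mu k f) (hlk : l ≤ k) :
    DeepBigO τ lam mu l f := fun n => by
  obtain ⟨C, r, hr⟩ := hf n
  obtain ⟨s, hs, hs'⟩ := (deep_le_norm_snd (τ := τ) (lam := lam) hmu 1).exists_forall n r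
  refine ⟨C, s, fun x h1 h2 => le_trans ?_ (hr x h1 (hs.trans_lt h2))⟩
  gcongr
  exact hs' x h1 h2

theorem DeepBigO.deep_le (hmu : |mu| ≤ 1) (hf : DeepBigO τ lam mu (k + 1) f) {ε : ℝ} (hε : 0 < ε) :
    Deep τ lam mu {x | ‖f x‖ * ‖x.2‖ ^ k ≤ ε} := fun n => by
  obtain ⟨C, r, hr⟩ := hf n
  obtain ⟨s, hs, hs'⟩ := (deep_le_norm_snd (τ := τ) (lam := lam) hmu (max (C / ε) 1)).exists_forall
    n r
  refine ⟨s, fun x h1 h2 => ?_⟩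
  have h3 : max (C / ε) 1 ≤ ‖x.2‖ := hs' x h1 h2
  have h4 : C ≤ ‖x.2‖ * ε := (div_le_iff₀ hε).1 ((le_max_left _ _).trans h3)
  have h5 : 0 < ‖x.2‖ := one_pos.trans_le ((le_max_right _ _).trans h3)
  have h6 := hr x h1 (hs.trans_lt h2)
  refine le_of_mul_le_mul_right ?_ h5
  rw [pow_succ] at h6
  linarith

theorem DeepBigO.small (hmu : |mu| ≤ 1) (hf : DeepBigO τ lam mu 1 f) {ε : ℝ} (hε : 0 < ε) :
    Deep τ lam mu {x | ‖f x‖ ≤ ε} := by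
  simpa using DeepBigO.deep_le (k := 0) hmu hf hε

theorem DeepBigO.exists_norm_le (hf : DeepBigO τ lam mu 0 f) (n : ℕ) :
    ∃ d r : ℝ, ∀ x : ℂ × ℂ, |x.1.im| < (n + 1) * τ.im → r < level lam mu x → ‖f x‖ ≤ d := by
  simpa using hf n

theorem Deep.preimage' {A : Set (ℂ × ℂ)} (hτ : 0 < τ.im) (hmu : |mu| ≤ 1) (hA : Deep τ lam mu A)
    {φ : ℂ × ℂ → ℂ × ℂ} (hφ : DeepBigO τ lam mu 0 (fun x => φ x - x)) :
    Deep τ lam mu {x | φ x ∈ A} := hA.preimage hτ hmu hφ.exists_norm_le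

/-- Estimates in `ξ` are preserved by composition with maps of bounded displacement. -/
theorem DeepBigO.comp (hτ : 0 < τ.im) (hmu : |mu| ≤ 1) (hf : DeepBigO τ lam mu k f)
    {φ : ℂ × ℂ → ℂ × ℂ} (hφ : DeepBigO τ lam mu 0 (fun x => φ x - x)) :
    DeepBigO τ lam mu k (fun x => f (φ x)) := fun n => by
  obtain ⟨d, r, hd⟩ := hφ.exists_norm_le n
  obtain ⟨m, hm⟩ := exists_nat_ge (d / τ.im)
  obtain ⟨C, s, hC⟩ := hf (n + m)
  obtain ⟨r', hr', h'⟩ := (deep_le_norm_snd (τ := τ) (lam := lam) hmu (2 * |d|)).exists_forall n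
    (max r (s + (‖lam‖ + 1) * |d|))
  refine ⟨2 ^ k * C, r', fun x h1 h2 => ?_⟩
  have h3 := hr'.trans_lt h2
  rw [max_lt_iff] at h3
  have h4 := hd x h1 h3.1
  have h4' := h4.trans (le_abs_self d)
  have h5 : 2 * |d| ≤ ‖x.2‖ := h' x h1 h2
  have h6 : ‖x.2‖ ≤ 2 * ‖(φ x).2‖ := by
    have h7 := (norm_snd_le (φ x - x)).trans h4'
    rw [Prod.snd_sub, norm_sub_rev] at h7
    have := norm_sub_norm_le x.2 (φ x).2
    linarith
  have h8 : |(φ x).1.im| < ((n + m : ℕ) + 1) * τ.im := by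
    have h9 : |(φ x).1.im - x.1.im| ≤ d := by
      have := (abs_im_le_norm (φ x - x).1).trans ((norm_fst_le _).trans h4)
      simpa using this
    have h10 : d ≤ m * τ.im := (div_le_iff₀ hτ).1 hm
    have h11 := abs_sub_abs_le_abs_sub (φ x).1.im x.1.im
    push_cast
    linarith
  have h12 : s < level lam mu (φ x) := by
    have h9 := (abs_le.1 (abs_level_sub_le (lam := lam) hmu x (φ x))).1
    have h10 : (‖lam‖ + 1) * ‖φ x - x‖ ≤ (‖lam‖ + 1) * |d| := by gcongr
    linarith [h3.2]
  calc ‖f (φ x)‖ * ‖x.2‖ ^ k ≤ ‖f (φ x)‖ * (2 * ‖(φ x).2‖) ^ k := by gcongr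
    _ = 2 ^ k * (‖f (φ x)‖ * ‖(φ x).2‖ ^ k) := by ring
    _ ≤ 2 ^ k * C := by gcongr; exact hC _ h8 h12

theorem deepBigO_comp_sub_self (hτ : 0 < τ.im) (hmu : |mu| ≤ 1) {φ ψ : ℂ × ℂ → ℂ × ℂ}
    (hφ : DeepBigO τ lam mu 0 (fun x => φ x - x)) (hψ : DeepBigO τ lam mu 0 (fun x => ψ x - x)) :
    DeepBigO τ lam mu 0 (fun x => φ (ψ x) - x) := by
  simpa using (hφ.comp hτ hmu hψ).add hψ

theorem flat_of_deepBigO (hmu : |mu| ≤ 1) {f : ℂ × ℂ → ℂ × ℂ} (hf : ∀ k, DeepBigO τ lam mu k f) :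
    Flat τ lam mu f := fun m => (hf (m + 1)).deep_le hmu one_pos

theorem deepBigO_shift : DeepBigO τ lam mu 0 (fun x => shift τ x - x) :=
  (deepBigO_const (τ, (-1 : ℂ))).congr (Deep.mono (A := univ) (fun _ => ⟨0, fun _ _ _ => trivial⟩)
    fun x _ => by
      change _ = _
      refine Prod.ext ?_ ?_ <;> simp [shift])

end DeepBigO

/-! ### The universal covering -/

section Cover

variable {τ lam : ℂ} {mu : ℝ} {E : Type*} [NormedAddCommGroup E]

/-- The universal covering `t ↦ exp (2 π i t)` of `ℂ*`. -/
noncomputable def expMap (t : ℂ) : ℂ := exp (2 * Real.pi * I * t)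

/-- The covering `(t, ξ) ↦ (exp (2 π i t), ξ)`. -/
noncomputable def cover (x : ℂ × ℂ) : ℂ × ℂ := (expMap x.1, x.2)

/-- The branch of `log (1 + u) / (2 π i)` near `u = 0`. -/
noncomputable def logLift (u : ℂ) : ℂ := log (1 + u) / (2 * Real.pi * I)

theorem two_pi_I_ne_zero' : (2 * Real.pi * I : ℂ) ≠ 0 := by simp [Real.pi_ne_zero]

theorem expMap_ne_zero (t : ℂ) : expMap t ≠ 0 := exp_ne_zero _

theorem expMap_add (s t : ℂ) : expMap (s + t) = expMap s * expMap t := by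
  unfold expMap; rw [mul_add, exp_add]

theorem expMap_int (n : ℤ) : expMap n = 1 := by
  unfold expMap
  rw [mul_comm]
  exact exp_int_mul_two_pi_mul_I n

theorem expMap_eq_iff {s t : ℂ} : expMap s = expMap t ↔ ∃ n : ℤ, s = t + n := by
  constructor
  · intro h
    obtain ⟨n, hn⟩ := exp_eq_exp_iff_exists_int.1 h
    refine ⟨n, mul_left_cancel₀ two_pi_I_ne_zero' ?_⟩
    rw [hn]; ring
  · rintro ⟨n, rfl⟩
    rw [expMap_add, expMap_int, mul_one]

theorem norm_expMap (t : ℂ) : ‖expMap t‖ = Real.exp (-(2 * Real.pi * t.im)) := by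
  unfold expMap
  rw [norm_exp]
  simp

theorem differentiable_expMap : Differentiable ℂ expMap := by unfold expMap; fun_prop

theorem differentiable_cover : Differentiable ℂ cover := by
  unfold cover
  exact (differentiable_expMap.comp differentiable_fst).prodMk differentiable_snd

theorem cover_add_one (x : ℂ × ℂ) : cover (x.1 + 1, x.2) = cover x := by
  have := expMap_int 1
  rw [Int.cast_one] at this
  simp [cover, expMap_add, this]

theorem cover_shift (x : ℂ × ℂ) :
    cover (shift τ x) = modelMap (Complex.exp (2 * Real.pi * Complex.I * τ)) (cover x) := by
  simp only [cover, shift, modelMap, expMap_add, mul_comm (expMap x.1)]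
  rfl

theorem expMap_logLift {u : ℂ} (hu : 1 + u ≠ 0) : expMap (logLift u) = 1 + u := by
  unfold expMap logLift
  rw [mul_div_cancel₀ _ two_pi_I_ne_zero', exp_log hu]

theorem norm_logLift_le {u : ℂ} (hu : ‖u‖ ≤ 1 / 2) : ‖logLift u‖ ≤ ‖u‖ := by
  unfold logLift
  have h1 := norm_log_one_add_half_le_self hu
  have h2 : ‖(2 * Real.pi * I : ℂ)‖ = 2 * Real.pi := by
    simp [abs_of_pos Real.pi_pos]
  rw [norm_div, h2, div_le_iff₀ (by positivity)]
  nlinarith [Real.pi_gt_three, norm_nonneg u]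

theorem one_add_ne_zero {u : ℂ} (hu : ‖u‖ ≤ 1 / 2) : 1 + u ≠ 0 := fun h => by
  have : u = -1 := by linear_combination h
  rw [this] at hu
  norm_num at hu

theorem differentiableAt_logLift {u : ℂ} (hu : ‖u‖ ≤ 1 / 2) : DifferentiableAt ℂ logLift u := by
  unfold logLift
  refine DifferentiableAt.div_const (DifferentiableAt.clog (by fun_prop) ?_) _
  rw [mem_slitPlane_iff]
  left
  have := (abs_re_le_norm u).trans hu
  rw [abs_le] at this
  simp only [add_re, one_re]
  linarith

theorem expMap_mem_annulus {t : ℂ} {L : ℝ} (ht : |t.im| ≤ L) :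
    expMap t ∈ annulus (2 * Real.pi * L) := by
  have := abs_le.1 ht
  have hp := Real.pi_pos
  constructor
  · rw [norm_expMap, Real.exp_le_exp]; nlinarith
  · rw [norm_expMap, Real.exp_le_exp]; nlinarith

theorem deep_cover_halfSpace (hmu : |mu| ≤ 1) :
    Deep τ lam mu {x | cover x ∈ halfSpace lam} :=
  (deep_two_mul_abs_im_le.inter (deep_le_norm_snd hmu 2)).mono fun x hx => by
    have h1 : 2 * |x.1.im| + 2 ≤ level lam mu x := hx.1
    have h2 : 2 ≤ ‖x.2‖ := hx.2
    refine ⟨expMap_ne_zero _, by change 1 < ‖x.2‖; linarith, ?_⟩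
    have h3 : level lam mu x = (lam * x.2).im + mu * x.1.im := by simp [level]
    have h4 : mu * x.1.im ≤ |x.1.im| := by
      refine (le_abs_self _).trans ?_
      rw [abs_mul]
      exact mul_le_of_le_one_left (abs_nonneg _) hmu
    change 0 < (lam * x.2).im
    linarith [abs_nonneg x.1.im]

/-- Estimates uniform on annuli lift to estimates on strips. -/
theorem deepBigO_cover (hmu : |mu| ≤ 1) {f : ℂ × ℂ → E} {k : ℕ}
    (h : ∀ L : ℝ, ∃ C R : ℝ, ∀ p ∈ halfSpace lam, p.1 ∈ annulus L → R < ‖p.2‖ →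
      ‖f p‖ ≤ C / ‖p.2‖ ^ k) : DeepBigO τ lam mu k (fun x => f (cover x)) := fun n => by
  obtain ⟨C, R, hC⟩ := h (2 * Real.pi * ((n + 1) * τ.im))
  obtain ⟨r, hr, hr'⟩ := ((deep_cover_halfSpace (τ := τ) (lam := lam) hmu).inter
    (deep_le_norm_snd hmu (R + 1))).exists_forall n 0
  refine ⟨C, r, fun x h1 h2 => ?_⟩
  obtain ⟨h3, h4⟩ := hr' x h1 h2
  have h4 : R + 1 ≤ ‖x.2‖ := h4
  have h5 := hC _ h3 (expMap_mem_annulus h1.le) (show R < ‖x.2‖ by linarith)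
  have h6 : 0 < ‖x.2‖ := one_pos.trans h3.2.1
  rwa [le_div_iff₀ (by exact pow_pos h6 k)] at h5

end Cover

/-! ### Lifts to the covering -/

section Lifts

variable {τ lam : ℂ} {mu : ℝ} {k l : ℕ}

theorem DeepBigO.mul {f g : ℂ × ℂ → ℂ} (hf : DeepBigO τ lam mu k f) (hg : DeepBigO τ lam mu l g) :
    DeepBigO τ lam mu (k + l) (fun x => f x * g x) := fun n => by
  obtain ⟨C, r, hr⟩ := hf n
  obtain ⟨D, s, hs⟩ := hg n
  refine ⟨C * D, max r s, fun x h1 h2 => ?_⟩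
  have h3 := hr x h1 ((le_max_left _ _).trans_lt h2)
  have h4 := hs x h1 ((le_max_right _ _).trans_lt h2)
  calc ‖f x * g x‖ * ‖x.2‖ ^ (k + l) = ‖f x‖ * ‖x.2‖ ^ k * (‖g x‖ * ‖x.2‖ ^ l) := by
        rw [norm_mul, pow_add]; ring
    _ ≤ C * D := mul_le_mul h3 h4 (by positivity) (le_trans (by positivity) h3)

theorem deep_cover (hmu : |mu| ≤ 1) {A : Set (ℂ × ℂ)}
    (h : ∀ L : ℝ, ∃ R : ℝ, ∀ p ∈ halfSpace lam, p.1 ∈ annulus L → R < ‖p.2‖ → p ∈ A) :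
    Deep τ lam mu {x | cover x ∈ A} := fun n => by
  obtain ⟨R, hC⟩ := h (2 * Real.pi * ((n + 1) * τ.im))
  obtain ⟨r, -, hr'⟩ := ((deep_cover_halfSpace (τ := τ) (lam := lam) hmu).inter
    (deep_le_norm_snd hmu (R + 1))).exists_forall n 0
  refine ⟨r, fun x h1 h2 => ?_⟩
  obtain ⟨h3, h4⟩ := hr' x h1 h2
  have h4 : R + 1 ≤ ‖x.2‖ := h4
  exact hC _ h3 (expMap_mem_annulus h1.le) (show R < ‖x.2‖ by linarith)

theorem deepBigO_expMap_inv : DeepBigO τ lam mu 0 (fun x => (expMap x.1)⁻¹) := fun n => by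
  refine ⟨Real.exp (2 * Real.pi * ((n + 1) * τ.im)), 0, fun x h1 _ => ?_⟩
  rw [pow_zero, mul_one, norm_inv, norm_expMap, ← Real.exp_neg, neg_neg, Real.exp_le_exp]
  have := (le_abs_self _).trans h1.le
  have := Real.pi_pos
  gcongr

/-- The lift to the covering of the map `(z, ξ) ↦ (exp (2 π i s) z (1 + u), v)`, for small `u`. -/
noncomputable def liftMap (s : ℂ) (u v : ℂ × ℂ → ℂ) (x : ℂ × ℂ) : ℂ × ℂ :=
  (x.1 + s + logLift (u (cover x)), v (cover x))

theorem liftMap_add_one (s : ℂ) (u v : ℂ × ℂ → ℂ) (x : ℂ × ℂ) :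
    liftMap s u v (x.1 + 1, x.2) = ((liftMap s u v x).1 + 1, (liftMap s u v x).2) := by
  simp only [liftMap, cover_add_one]
  refine Prod.ext ?_ rfl
  simp only
  ring

theorem cover_liftMap {s : ℂ} {u v : ℂ × ℂ → ℂ} {x : ℂ × ℂ} (h : ‖u (cover x)‖ ≤ 1 / 2) :
    cover (liftMap s u v x) = (expMap s * expMap x.1 * (1 + u (cover x)), v (cover x)) := by
  simp only [cover, liftMap, expMap_add]
  refine Prod.ext ?_ rfl
  simp only
  rw [← cover, expMap_logLift (one_add_ne_zero h)]
  ring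

theorem differentiableAt_liftMap {s : ℂ} {u v : ℂ × ℂ → ℂ} {x : ℂ × ℂ}
    (h : ‖u (cover x)‖ ≤ 1 / 2) (hu : DifferentiableAt ℂ u (cover x))
    (hv : DifferentiableAt ℂ v (cover x)) : DifferentiableAt ℂ (liftMap s u v) x := by
  have hc := differentiable_cover x
  have h1 : DifferentiableAt ℂ (fun x => logLift (u (cover x))) x :=
    DifferentiableAt.comp (g := logLift) x (differentiableAt_logLift h)
      (DifferentiableAt.comp (g := u) x hu hc)
  have h2 : DifferentiableAt ℂ (fun x => v (cover x)) x := DifferentiableAt.comp (g := v) x hv hc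
  exact ((differentiableAt_fst.add_const s).add h1).prodMk h2

theorem deepBigO_liftMap_fst (hmu : |mu| ≤ 1) {s : ℂ} {u v : ℂ × ℂ → ℂ}
    (hu : DeepBigO τ lam mu 1 (fun x => u (cover x))) :
    DeepBigO τ lam mu 1 (fun x => (liftMap s u v x).1 - (x.1 + s)) :=
  hu.of_le zero_le_one ((hu.small hmu (ε := 1 / 2) (by norm_num)).mono fun x hx => by
    simpa [liftMap] using norm_logLift_le hx)

/-- The lift of the germ. -/
theorem FormalDiffeo.Conjugates.exists_lift_germ (hmu : |mu| ≤ 1) {F : NbhdDiffeo (expMap τ)}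
    {P : FormalDiffeo} (hP : P.Conjugates F) :
    ∃ Fh : ℂ × ℂ → ℂ × ℂ, (∀ x, Fh (x.1 + 1, x.2) = ((Fh x).1 + 1, (Fh x).2)) ∧
      Deep τ lam mu {x | cover x ∈ xiDomain F.U ∧ cover (Fh x) = F.xi (cover x) ∧
        DifferentiableAt ℂ Fh x} ∧
      DeepBigO τ lam mu 1 (fun x => (Fh x).1 - (x.1 + τ)) ∧
      DeepBigO τ lam mu 0 (fun x => (Fh x).2 - x.2) := by
  have hq := expMap_ne_zero τ
  set u : ℂ × ℂ → ℂ := fun p => (F.xi p).1 / (expMap τ * p.1) - 1 with hu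
  have hdom : Deep τ lam mu {x | cover x ∈ xiDomain F.U} := deep_cover hmu fun L => by
    obtain ⟨C, -, R, -, h⟩ := hP.exists_xi_bounds F hq (isCompact_annulus L)
      fun z hz => annulus_ne_zero hz
    exact ⟨R, fun p _ hp hR => (h p hp hR).1⟩
  have hu1 : DeepBigO τ lam mu 1 (fun x => u (cover x)) := deepBigO_cover hmu fun L => by
    obtain ⟨C, hC, R, hR, h⟩ := hP.exists_xi_bounds F hq (isCompact_annulus L)
      fun z hz => annulus_ne_zero hz
    refine ⟨C / (‖expMap τ‖ * Real.exp (-L)), R, fun p _ hp hpR => ?_⟩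
    have h1 := (h p hp hpR).2.1
    have hp0 := annulus_ne_zero hp
    have h2 : u p = ((F.xi p).1 - expMap τ * p.1) / (expMap τ * p.1) := by
      simp only [hu]; field_simp
    have h3 : 0 < ‖expMap τ‖ := norm_pos_iff.2 hq
    rw [h2, norm_div, norm_mul, pow_one]
    calc _ ≤ C / ‖p.2‖ / (‖expMap τ‖ * Real.exp (-L)) := by
          have : 0 < ‖p.2‖ := hR.trans hpR
          gcongr
          exact hp.1
      _ = _ := by ring
  have hsmall := hu1.small hmu (ε := 1 / 2) (by norm_num)
  refine ⟨liftMap τ u fun p => (F.xi p).2, liftMap_add_one _ _ _, (hdom.inter hsmall).mono ?_,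
    deepBigO_liftMap_fst hmu hu1, ?_⟩
  · rintro x ⟨h1, h2⟩
    have h1 : cover x ∈ xiDomain F.U := h1
    have h3 := (F.differentiableOn_xi hq).differentiableAt
      ((isOpen_xiDomain F.isOpen_U).mem_nhds h1)
    have hz : expMap x.1 ≠ 0 := expMap_ne_zero _
    refine ⟨h1, ?_, differentiableAt_liftMap h2 ?_ ?_⟩
    · rw [cover_liftMap h2]
      refine Prod.ext ?_ rfl
      simp only [hu, cover]
      field_simp
      ring
    · have h4 : DifferentiableAt ℂ (fun p : ℂ × ℂ => expMap τ * p.1) (cover x) := by fun_prop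
      simp only [hu, div_eq_mul_inv]
      exact ((differentiableAt_fst.comp _ h3).mul (h4.inv
        (show expMap τ * (cover x).1 ≠ 0 from mul_ne_zero hq hz))).sub_const _
    · exact differentiableAt_snd.comp _ h3
  · refine deepBigO_cover (f := fun p => (F.xi p).2 - p.2) hmu fun L => ?_
    obtain ⟨C, hC, R, hR, h⟩ := hP.exists_xi_bounds F hq (isCompact_annulus L)
      fun z hz => annulus_ne_zero hz
    exact ⟨C, R, fun p _ hp hpR => by simpa using (h p hp hpR).2.2⟩

theorem deepBigO_coeff (hmu : |mu| ≤ 1) {c : ℂ → ℂ} (hc : DifferentiableOn ℂ c {0}ᶜ) :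
    DeepBigO τ lam mu 0 (fun x => c (expMap x.1)) :=
  deepBigO_cover (f := fun p => c p.1) hmu fun L => by
    obtain ⟨N, hN⟩ := (isCompact_annulus L).exists_bound_of_continuousOn
      (hc.continuousOn.mono fun z hz => annulus_ne_zero hz)
    exact ⟨N, 0, fun p _ hp _ => by simpa using hN _ hp⟩

/-- The lift of a holomorphic map with the given formal expansion. -/
theorem FormalDiffeo.exists_lift (hmu : |mu| ≤ 1) (P : FormalDiffeo) :
    ∃ (pa pb : ℂ × ℂ → ℂ) (Ph : ℂ × ℂ → ℂ × ℂ),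
      (∀ m, DeepBigO τ lam mu (m + 1)
        (fun x => pa (cover x) - partialSum P.a m (cover x))) ∧
      (∀ m, DeepBigO τ lam mu (m + 1)
        (fun x => pb (cover x) - partialSum P.b m (cover x))) ∧
      (∀ x, Ph (x.1 + 1, x.2) = ((Ph x).1 + 1, (Ph x).2)) ∧
      Deep τ lam mu {x | cover (Ph x) = ((cover x).1 + pa (cover x), x.2 + pb (cover x)) ∧
        DifferentiableAt ℂ Ph x} ∧
      DeepBigO τ lam mu 1 (fun x => (Ph x).1 - x.1) ∧
      DeepBigO τ lam mu 1 (fun x => (Ph x).2 - x.2 - P.b 0 (expMap x.1)) ∧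
      ∀ x, (Ph x).2 = x.2 + pb (cover x) := by
  obtain ⟨pa, hpa, ha⟩ := exists_borelRitt (lam := lam) P.holo_a
  obtain ⟨pb, hpb, hb⟩ := exists_borelRitt (lam := lam) P.holo_b
  have ha' : ∀ m, DeepBigO τ lam mu (m + 1)
      (fun x => pa (cover x) - partialSum P.a m (cover x)) := fun m =>
    deepBigO_cover (f := fun p => pa p - partialSum P.a m p) hmu fun L => by
      obtain ⟨C, -, h⟩ := ha m L
      exact ⟨C, 0, fun p h1 h2 _ => h p h1 h2⟩
  have hb' : ∀ m, DeepBigO τ lam mu (m + 1)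
      (fun x => pb (cover x) - partialSum P.b m (cover x)) := fun m =>
    deepBigO_cover (f := fun p => pb p - partialSum P.b m p) hmu fun L => by
      obtain ⟨C, -, h⟩ := hb m L
      exact ⟨C, 0, fun p h1 h2 _ => h p h1 h2⟩
  have hu : DeepBigO τ lam mu 1 (fun x => (fun p : ℂ × ℂ => pa p / p.1) (cover x)) := by
    refine ((ha' 0).mul deepBigO_expMap_inv).congr ?_
    refine Deep.mono (A := univ) (fun _ => ⟨0, fun _ _ _ => trivial⟩) fun x _ => ?_
    simp [cover, partialSum, P.a_zero _ (expMap_ne_zero _), div_eq_mul_inv]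
  have hsmall := hu.small hmu (ε := 1 / 2) (by norm_num)
  refine ⟨pa, pb, liftMap 0 (fun p => pa p / p.1) fun p => p.2 + pb p, ha', hb',
    liftMap_add_one _ _ _, (hsmall.inter (deep_cover_halfSpace hmu)).mono ?_, ?_, ?_, fun x => rfl⟩
  · rintro x ⟨h1, h2⟩
    have h2 : cover x ∈ halfSpace lam := h2
    have hz : expMap x.1 ≠ 0 := expMap_ne_zero _
    have ho := (isOpen_halfSpace lam).mem_nhds h2
    refine ⟨?_, differentiableAt_liftMap h1 ?_ ?_⟩
    · rw [cover_liftMap h1]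
      have h0 : expMap 0 = 1 := by simpa using expMap_int 0
      refine Prod.ext ?_ rfl
      simp only [h0, cover]
      field_simp
    · have h4 : DifferentiableAt ℂ (fun p : ℂ × ℂ => p.1) (cover x) := by fun_prop
      simp only [div_eq_mul_inv]
      exact (hpa.differentiableAt ho).mul (h4.inv (show (cover x).1 ≠ 0 from hz))
    · exact differentiableAt_snd.add (hpb.differentiableAt ho)
  · simpa using deepBigO_liftMap_fst (s := 0) (v := fun p => p.2 + pb p) hmu hu
  · refine (hb' 0).congr (Deep.mono (A := univ) (fun _ => ⟨0, fun _ _ _ => trivial⟩) fun x _ => ?_)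
    simp [liftMap, partialSum, cover]

/-- Comparison of `z` with `t` near `t = 0`, to pass from estimates on the base to estimates on the
covering. -/
theorem norm_le_norm_expMap_sub_one {s : ℂ} (hs : ‖s‖ ≤ 1 / 16) : ‖s‖ ≤ ‖expMap s - 1‖ := by
  have h2 : ‖2 * Real.pi * I * s‖ = 2 * Real.pi * ‖s‖ := by
    simp [abs_of_pos Real.pi_pos]
  have h3 : ‖2 * Real.pi * I * s‖ ≤ 1 / 2 := by
    rw [h2]; nlinarith [Real.pi_lt_four, norm_nonneg s]
  have h4 := norm_exp_sub_one_sub_id_le (h3.trans (by norm_num))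
  have h5 := norm_sub_norm_le (2 * Real.pi * I * s) (expMap s - 1)
  rw [norm_sub_rev (2 * Real.pi * I * s)] at h5
  unfold expMap at h5 ⊢
  rw [h2] at h3 h4 h5
  have h6 : (2 * Real.pi * ‖s‖) ^ 2 ≤ 2 * Real.pi * ‖s‖ * (1 / 2) := by
    rw [pow_two]; gcongr
  nlinarith [Real.pi_gt_three, norm_nonneg s]

end Lifts

/-! ### Inversion at large depth -/

section Inverse

variable {τ lam : ℂ} {mu : ℝ}

theorem deep_univ : Deep τ lam mu (univ : Set (ℂ × ℂ)) := fun _ => ⟨0, fun _ _ _ => trivial⟩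

theorem deepBigO_zero_of_deep {f : ℂ × ℂ → ℂ × ℂ} {C : ℝ} (h : Deep τ lam mu {x | ‖f x‖ ≤ C}) :
    DeepBigO τ lam mu 0 f := fun n => (h n).elim fun r hr =>
  ⟨C, r, fun x h1 h2 => by simpa using hr x h1 h2⟩

/-- The translation `(t, ξ) ↦ (t + 1, ξ)`, the deck transformation of the covering. -/
def turn (x : ℂ × ℂ) : ℂ × ℂ := (x.1 + 1, x.2)

theorem turn_add (x y : ℂ × ℂ) : turn x + y = turn (x + y) := by
  refine Prod.ext ?_ ?_ <;> simp [turn]; ring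

theorem Deep.turn {A : Set (ℂ × ℂ)} (hA : Deep τ lam mu A) :
    Deep τ lam mu {x | turn x ∈ A} := fun n => by
  obtain ⟨r, hr⟩ := hA n
  exact ⟨r, fun x h1 h2 => hr _ (by simpa [EllipticNbhd.turn] using h1)
    (by rw [EllipticNbhd.turn, level_add_one]; exact h2)⟩

/-- Inversion of a perturbation of the identity in the deep part of the strips. -/
theorem exists_deep_inverse (hτ : 0 < τ.im) (hmu : |mu| ≤ 1) {g : ℂ × ℂ → ℂ × ℂ}
    (hg : Deep τ lam mu {x | DifferentiableAt ℂ g x ∧ ‖g x‖ ≤ 1 / 8 ∧ g (turn x) = g x}) :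
    ∃ J : ℂ × ℂ → ℂ × ℂ, Deep τ lam mu {y | ‖J y - y‖ ≤ 1 / 8} ∧
      Deep τ lam mu {y | DifferentiableAt ℂ J y ∧ J y + g (J y) = y ∧ J (turn y) = turn (J y)} ∧
      Deep τ lam mu {x | J (x + g x) = x} := by
  obtain ⟨R, -, hsub⟩ := hg.exists_steep
  set Ω := dom τ lam mu R with hΩ
  have hΩd : Deep τ lam mu Ω := deep_dom
  obtain ⟨J, hJ1, hJ2, hJ3⟩ := exists_inverse_near_id (Ω := Ω) (g := g)
    (fun x hx => (hsub hx).1.differentiableWithinAt) fun x hx => (hsub hx).2.1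
  have e1 : Deep τ lam mu {y | ‖J y - y‖ ≤ 1 / 8} :=
    (hΩd.thicken hτ hmu 1).mono fun y hy => (hJ1 y hy).1
  have e2 : Deep τ lam mu {x | J (x + g x) = x} := (hΩd.thicken hτ hmu 2).mono fun x hx => by
    have hx : closedBall x 2 ⊆ Ω := hx
    refine hJ2 x ?_ ?_
    · exact (ball_subset_closedBall.trans (closedBall_subset_closedBall (by norm_num))).trans hx
    · refine (closedBall_subset_closedBall' ?_).trans hx
      rw [dist_eq_norm, add_sub_cancel_left]
      linarith [(hsub (hx (mem_closedBall_self (by norm_num)))).2.1]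
  refine ⟨J, e1, ?_, e2⟩
  have hJd : DeepBigO τ lam mu 0 (fun x => J x - x) := deepBigO_zero_of_deep e1
  refine (((hΩd.thicken hτ hmu 2).inter ((hΩd.inter e2.turn).preimage' hτ hmu hJd))).mono ?_
  rintro y ⟨hy, hy2, hy3⟩
  have hy : closedBall y 2 ⊆ Ω := hy
  have hy1 : closedBall y 1 ⊆ Ω := (closedBall_subset_closedBall (by norm_num)).trans hy
  have h3 : J (turn (J y) + g (turn (J y))) = turn (J y) := hy3
  refine ⟨hJ3.differentiableAt (isOpen_interior.mem_nhds ?_), (hJ1 y hy1).2, ?_⟩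
  · rw [mem_interior]
    refine ⟨ball y 1, fun w hw => (closedBall_subset_closedBall' ?_).trans hy, isOpen_ball,
      mem_ball_self one_pos⟩
    rw [mem_ball] at hw
    linarith
  · rw [← h3, (hsub hy2).2.2, turn_add, (hJ1 y hy1).2]

end Inverse

/-! ### The flat conjugacy defect -/

section Normalization

variable {τ lam : ℂ} {mu : ℝ}

/-- The lift `Ph` of a holomorphic map with the given formal expansion conjugates the lift `Fh` of
the germ to the model map up to a flat error. -/
theorem exists_lifts (hτ : 0 < τ.im) (hmu : |mu| ≤ 1) {F : NbhdDiffeo (expMap τ)}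
    {P : FormalDiffeo} (hP : P.Conjugates F) :
    ∃ (pa pb : ℂ × ℂ → ℂ) (Ph Fh : ℂ × ℂ → ℂ × ℂ),
      (∀ m, DeepBigO τ lam mu (m + 1)
        (fun x => pa (cover x) - partialSum P.a m (cover x))) ∧
      (∀ m, DeepBigO τ lam mu (m + 1)
        (fun x => pb (cover x) - partialSum P.b m (cover x))) ∧
      (∀ x, Ph (turn x) = turn (Ph x)) ∧ (∀ x, Fh (turn x) = turn (Fh x)) ∧
      Deep τ lam mu {x | cover (Ph x) = ((cover x).1 + pa (cover x), x.2 + pb (cover x)) ∧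
        DifferentiableAt ℂ Ph x} ∧
      Deep τ lam mu {x | cover x ∈ xiDomain F.U ∧ cover (Fh x) = F.xi (cover x) ∧
        DifferentiableAt ℂ Fh x} ∧
      DeepBigO τ lam mu 1 (fun x => Ph x - (x.1, x.2 + P.b 0 (expMap x.1))) ∧
      DeepBigO τ lam mu 0 (fun x => Fh x - x) ∧
      ∀ k, DeepBigO τ lam mu k (fun x => Ph (Fh x) - shift τ (Ph x)) := by
  obtain ⟨pa, pb, Ph, ha, hb, hPt, hPc, hP1, hP2, hP3⟩ := P.exists_lift (τ := τ) (lam := lam) hmu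
  obtain ⟨Fh, hFt, hFc, hF1, hF2⟩ := hP.exists_lift_germ (lam := lam) hmu
  have hb0 : DeepBigO τ lam mu 0 (fun x => P.b 0 (expMap x.1)) := deepBigO_coeff hmu (P.holo_b 0)
  have hPd : DeepBigO τ lam mu 0 (fun x => Ph x - x) :=
    (((hP1.mono hmu zero_le_one).prodMk ((hP2.mono hmu zero_le_one).add hb0))).congr
      (deep_univ.mono fun x _ => by
        change _ = _
        refine Prod.ext ?_ ?_ <;> simp)
  have hFd : DeepBigO τ lam mu 0 (fun x => Fh x - x) :=
    ((((hF1.mono hmu zero_le_one).add (deepBigO_const τ)).prodMk hF2)).congr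
      (deep_univ.mono fun x _ => by
        change _ = _
        refine Prod.ext ?_ ?_ <;> simp; ring)
  refine ⟨pa, pb, Ph, Fh, ha, hb, hPt, hFt, hPc, hFc, ?_, hFd, fun k => ?_⟩
  · exact (hP1.prodMk hP2).congr (deep_univ.mono fun x _ => by
      change _ = _
      refine Prod.ext ?_ ?_ <;> simp; ring)
  have hq := expMap_ne_zero τ
  -- both sides of the conjugacy relation agree with those of its truncations
  set A : ℂ × ℂ → ℂ × ℂ := fun x => ((cover x).1 + pa (cover x), x.2 + pb (cover x)) with hA
  have hAk : DeepBigO τ lam mu (k + 1) (fun x => A x - P.trunc k (cover x)) :=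
    ((ha k).prodMk (hb k)).congr (deep_univ.mono fun x _ => by
      change _ = _
      refine Prod.ext ?_ ?_ <;> simp [hA, FormalDiffeo.trunc, cover])
  have hAq : DeepBigO τ lam mu (k + 1)
      (fun x => modelMap (expMap τ) (A x) - modelMap (expMap τ) (P.trunc k (cover x))) :=
    hAk.of_le (c := ‖expMap τ‖ + 1) (by positivity) (deep_univ.mono fun x _ => by
      have h1 : modelMap (expMap τ) (A x) - modelMap (expMap τ) (P.trunc k (cover x)) =
          (expMap τ * (A x - P.trunc k (cover x)).1, (A x - P.trunc k (cover x)).2) := by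
        refine Prod.ext ?_ ?_ <;> simp [modelMap]; ring
      change ‖_‖ ≤ _
      rw [h1, Prod.norm_mk, norm_mul]
      have h2 := norm_fst_le (A x - P.trunc k (cover x))
      have h3 := norm_snd_le (A x - P.trunc k (cover x))
      have h4 := norm_nonneg (expMap τ)
      have h5 := norm_nonneg (A x - P.trunc k (cover x))
      refine max_le ?_ ?_ <;> nlinarith)
  have hT : DeepBigO τ lam mu (k + 1) (fun x => P.trunc k (F.xi (cover x)) -
      modelMap (expMap τ) (P.trunc k (cover x))) :=
    deepBigO_cover (f := fun p => P.trunc k (F.xi p) - modelMap (expMap τ) (P.trunc k p)) hmu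
      fun L => by
        obtain ⟨C, hC, R, hR, h⟩ := hP.exists_trunc_bound F hq (isCompact_annulus L)
          (fun z hz => annulus_ne_zero hz) k
        exact ⟨C, R, fun p _ hp hpR => h p hp hpR⟩
  have hD : DeepBigO τ lam mu k (fun x => A (Fh x) - modelMap (expMap τ) (A x)) := by
    refine ((((hAk.comp hτ hmu hFd).add hT).sub hAq).mono hmu k.le_succ).congr
      (hFc.mono fun x hx => ?_)
    change _ = _
    rw [hx.2.1]
    abel
  have hcov : Deep τ lam mu {x | cover (Ph x) = A x ∧ cover (Ph (Fh x)) = A (Fh x)} :=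
    (hPc.inter (hPc.preimage' hτ hmu hFd)).mono fun x hx => ⟨hx.1.1, hx.2.1⟩
  set δ : ℂ × ℂ → ℂ := fun x => (Ph (Fh x)).1 - ((Ph x).1 + τ) with hδ
  have hδ1 : DeepBigO τ lam mu 1 δ :=
    (((hP1.comp hτ hmu hFd).add hF1).sub hP1).congr (deep_univ.mono fun x _ => by
      change _ = _
      simp only [hδ]; ring)
  have hinv : DeepBigO τ lam mu 0 (fun x => (expMap (shift τ (Ph x)).1)⁻¹) :=
    (deepBigO_expMap_inv (τ := τ) (lam := lam) (mu := mu)).comp hτ hmu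
      (deepBigO_comp_sub_self hτ hmu deepBigO_shift hPd)
  have hδk : DeepBigO τ lam mu k δ := by
    have hD1 : DeepBigO τ lam mu k (fun x => (A (Fh x) - modelMap (expMap τ) (A x)).1) :=
      hD.of_le zero_le_one (deep_univ.mono fun x _ => by
        change ‖_‖ ≤ _
        rw [one_mul]
        exact norm_fst_le _)
    refine (hD1.mul hinv).of_le zero_le_one (((hδ1.small hmu (ε := 1 / 16) (by norm_num)).inter
      hcov).mono fun x hx => ?_)
    obtain ⟨h1, h2, h3⟩ := hx
    have h1 : ‖δ x‖ ≤ 1 / 16 := h1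
    change ‖δ x‖ ≤ _
    refine (norm_le_norm_expMap_sub_one h1).trans (le_of_eq ?_)
    rw [one_mul]
    congr 1
    rw [← h2, ← h3]
    have h4 := expMap_ne_zero (Ph x).1
    have h5 : expMap (Ph (Fh x)).1 = expMap τ * expMap (Ph x).1 * expMap (δ x) := by
      rw [← expMap_add, ← expMap_add]
      congr 1
      simp only [hδ]; ring
    simp only [cover, modelMap, Prod.fst_sub, shift, expMap_add, h5]
    field_simp
  have hD2 : DeepBigO τ lam mu k (fun x => (A (Fh x) - modelMap (expMap τ) (A x)).2) :=
    hD.of_le zero_le_one (deep_univ.mono fun x _ => by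
      change ‖_‖ ≤ _
      rw [one_mul]
      exact norm_snd_le _)
  refine (hδk.prodMk hD2).congr (hcov.mono fun x hx => ?_)
  change _ = _
  rw [← hx.1, ← hx.2]
  refine Prod.ext ?_ ?_ <;> simp [hδ, shift, cover, modelMap]

end Normalization

/-! ### Sectorial normalization on the covering -/

section Normalization

variable {τ lam : ℂ} {mu : ℝ}

theorem turn_sub_turn (x y : ℂ × ℂ) : turn x - turn y = x - y := by
  refine Prod.ext ?_ ?_ <;> simp [turn]

theorem expMap_add_one (t : ℂ) : expMap (t + 1) = expMap t :=
  congrArg Prod.fst (cover_add_one (t, 0))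

theorem shift_turn (x : ℂ × ℂ) : shift τ (turn x) = turn (shift τ x) := by
  refine Prod.ext ?_ ?_ <;> simp [turn, shift]; ring

theorem shift_add (x y : ℂ × ℂ) : shift τ (x + y) = shift τ x + y := by
  refine Prod.ext ?_ ?_ <;> simp [shift] <;> ring

theorem differentiable_shift : Differentiable ℂ (shift τ) := by unfold shift; fun_prop

theorem deep_half_level_le (hmu : |mu| ≤ 1) {φ : ℂ × ℂ → ℂ × ℂ}
    (hφ : DeepBigO τ lam mu 0 (fun x => φ x - x)) :
    Deep τ lam mu {x | level lam mu x ≤ 2 * level lam mu (φ x)} := fun n => by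
  obtain ⟨d, r, hr⟩ := hφ.exists_norm_le n
  refine ⟨max r (2 * ((‖lam‖ + 1) * d)), fun x h1 h2 => ?_⟩
  rw [max_lt_iff] at h2
  have h3 := hr x h1 h2.1
  have h4 := (abs_le.1 (abs_level_sub_le (lam := lam) hmu x (φ x))).1
  have h5 : (‖lam‖ + 1) * ‖φ x - x‖ ≤ (‖lam‖ + 1) * d := by gcongr
  change level lam mu x ≤ 2 * level lam mu (φ x)
  linarith [h2.2]

/-- A formal conjugacy has a holomorphic right inverse `Q` in the deep part of the strips. -/
theorem exists_formal_inverse (hτ : 0 < τ.im) (hmu : |mu| ≤ 1) {P : FormalDiffeo}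
    {Ph : ℂ × ℂ → ℂ × ℂ} (hPt : ∀ x, Ph (turn x) = turn (Ph x))
    (hPd : Deep τ lam mu {x | DifferentiableAt ℂ Ph x})
    (hP1 : DeepBigO τ lam mu 1 (fun x => Ph x - (x.1, x.2 + P.b 0 (expMap x.1)))) :
    ∃ Q : ℂ × ℂ → ℂ × ℂ, DeepBigO τ lam mu 0 (fun x => Q x - x) ∧
      Deep τ lam mu {x | DifferentiableAt ℂ Q x ∧ Ph (Q x) = x ∧ Q (turn x) = turn (Q x)} ∧
      Deep τ lam mu {x | Q (Ph x) = x} := by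
  have hb0 : DeepBigO τ lam mu 0 (fun x => P.b 0 (expMap x.1)) := deepBigO_coeff hmu (P.holo_b 0)
  have hbd : Differentiable ℂ (fun x : ℂ × ℂ => P.b 0 (expMap x.1)) := fun x =>
    DifferentiableAt.comp (g := P.b 0) x ((P.holo_b 0).differentiableAt
      (isOpen_compl_singleton.mem_nhds (expMap_ne_zero _)))
      ((differentiable_expMap _).comp x differentiableAt_fst)
  set sh : ℂ × ℂ → ℂ × ℂ := fun x => (x.1, x.2 - P.b 0 (expMap x.1)) with hsh
  set sh' : ℂ × ℂ → ℂ × ℂ := fun x => (x.1, x.2 + P.b 0 (expMap x.1)) with hsh'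
  have hss : ∀ x, sh (sh' x) = x := fun x => by simp [hsh, hsh']
  have hss' : ∀ x, sh' (sh x) = x := fun x => by simp [hsh, hsh']
  have hsd : Differentiable ℂ sh := differentiable_fst.prodMk (differentiable_snd.sub hbd)
  have hst : ∀ x, sh (turn x) = turn (sh x) := fun x => by simp [hsh, turn, expMap_add_one]
  have hz : DeepBigO τ lam mu 0 (fun _ : ℂ × ℂ => (0 : ℂ)) := deepBigO_const 0
  have hs0 : DeepBigO τ lam mu 0 (fun x => sh x - x) :=
    (hz.prodMk hb0.neg).congr (deep_univ.mono fun x _ => by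
      change _ = _
      refine Prod.ext ?_ ?_ <;> simp [hsh])
  have hs0' : DeepBigO τ lam mu 0 (fun x => sh' x - x) :=
    (hz.prodMk hb0).congr (deep_univ.mono fun x _ => by
      change _ = _
      refine Prod.ext ?_ ?_ <;> simp [hsh'])
  set g : ℂ × ℂ → ℂ × ℂ := fun x => Ph (sh x) - x with hg
  have hg1 : DeepBigO τ lam mu 1 g := (hP1.comp hτ hmu hs0).congr (deep_univ.mono fun x _ => by
    change _ = _
    have := hss' x
    simp only [hsh'] at this
    rw [this])
  obtain ⟨J, hJ1, hJ2, hJ3⟩ := exists_deep_inverse (g := g) hτ hmu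
    (((hg1.small hmu (ε := 1 / 8) (by norm_num)).inter (hPd.preimage' hτ hmu hs0)).mono
      fun x hx => by
        refine ⟨?_, hx.1, ?_⟩
        · exact (DifferentiableAt.comp (g := Ph) x hx.2 (hsd x)).sub differentiableAt_id
        · simp only [hg, hst, hPt, turn_sub_turn])
  have hJd : DeepBigO τ lam mu 0 (fun x => J x - x) := deepBigO_zero_of_deep hJ1
  refine ⟨fun x => sh (J x), deepBigO_comp_sub_self hτ hmu hs0 hJd, hJ2.mono ?_, ?_⟩
  · rintro x ⟨h1, h2, h3⟩
    refine ⟨(hsd _).comp x h1, ?_, ?_⟩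
    · simpa [hg] using h2
    · change sh (J (turn x)) = turn (sh (J x))
      rw [h3, hst]
  · refine (hJ3.preimage' hτ hmu hs0').mono fun x hx => ?_
    have hx : J (sh' x + g (sh' x)) = sh' x := hx
    simp only [hg, add_sub_cancel, hss] at hx
    change sh (J (Ph x)) = x
    rw [hx, hss]

/-- The sectorial normalization, lifted to the covering: `Θ` conjugates the model map to the germ,
and its inverse `Ψ` has the given formal expansion. -/
theorem exists_normalization (hτ : 0 < τ.im) (hd : IsDirection τ lam mu)
    {F : NbhdDiffeo (expMap τ)} {P : FormalDiffeo} (hP : P.Conjugates F) :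
    ∃ (pa pb : ℂ × ℂ → ℂ) (Ph Fh Θ Ψ : ℂ × ℂ → ℂ × ℂ),
      (∀ m, DeepBigO τ lam mu (m + 1)
        (fun x => pa (cover x) - partialSum P.a m (cover x))) ∧
      (∀ m, DeepBigO τ lam mu (m + 1)
        (fun x => pb (cover x) - partialSum P.b m (cover x))) ∧
      Deep τ lam mu {x | cover (Ph x) = ((cover x).1 + pa (cover x), x.2 + pb (cover x))} ∧
      DeepBigO τ lam mu 1 (fun x => Ph x - (x.1, x.2 + P.b 0 (expMap x.1))) ∧
      Deep τ lam mu {x | cover x ∈ xiDomain F.U ∧ cover (Fh x) = F.xi (cover x)} ∧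
      DeepBigO τ lam mu 0 (fun x => Θ x - x) ∧ DeepBigO τ lam mu 0 (fun x => Ψ x - x) ∧
      Deep τ lam mu {x | DifferentiableAt ℂ Θ x ∧ Θ (turn x) = turn (Θ x) ∧ Ψ (Θ x) = x ∧
        Fh (Θ x) = Θ (shift τ x)} ∧
      Deep τ lam mu {x | DifferentiableAt ℂ Ψ x ∧ Θ (Ψ x) = x} ∧
      Deep τ lam mu {x | ‖Ψ x - Ph x‖ ≤ 1 / 8} ∧
      ∀ m : ℕ, Deep τ lam mu {x | ‖Ψ x - Ph x‖ * level lam mu x ^ m ≤ 1} := by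
  have hmu := hd.abs_mu_le
  obtain ⟨pa, pb, Ph, Fh, ha, hb, hPt, hFt, hPc, hFc, hP1, hF0, hδ⟩ :=
    exists_lifts (lam := lam) hτ hmu hP
  have hb0 : DeepBigO τ lam mu 0 (fun x => P.b 0 (expMap x.1)) := deepBigO_coeff hmu (P.holo_b 0)
  have hz : DeepBigO τ lam mu 0 (fun _ : ℂ × ℂ => (0 : ℂ)) := deepBigO_const 0
  have hP0 : DeepBigO τ lam mu 0 (fun x => Ph x - x) :=
    ((hP1.mono hmu zero_le_one).add (hz.prodMk hb0)).congr (deep_univ.mono fun x _ => by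
      change _ = _
      refine Prod.ext ?_ ?_
      · simp
      · simp; ring)
  obtain ⟨Q, hQ0, hQ1, hQ2⟩ := exists_formal_inverse hτ hmu hPt (hPc.mono fun x hx => hx.2) hP1
  have hFQ0 : DeepBigO τ lam mu 0 (fun x => Fh (Q x) - x) := deepBigO_comp_sub_self hτ hmu hF0 hQ0
  -- the perturbation of the model map conjugate to the germ
  set f : ℂ × ℂ → ℂ × ℂ := fun x => Ph (Fh (Q x)) - shift τ x with hf
  have hfl : Flat τ lam mu f := flat_of_deepBigO hmu fun k =>
    ((hδ k).comp hτ hmu hQ0).congr (hQ1.mono fun x hx => by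
      change _ = _
      simp only [hf]
      rw [hx.2.1])
  obtain ⟨R0, -, hR0⟩ := (hQ1.inter ((hFc.preimage' hτ hmu hQ0).inter
    (hPc.preimage' hτ hmu hFQ0))).exists_steep
  have hfd : DifferentiableOn ℂ f (dom τ lam mu R0) := fun x hx => by
    obtain ⟨h1, h2, h3⟩ := hR0 hx
    have h4 : DifferentiableAt ℂ (fun x => Fh (Q x)) x :=
      DifferentiableAt.comp (g := Fh) x h2.2.2 h1.1
    exact ((DifferentiableAt.comp (g := Ph) x h3.2 h4).sub
      (differentiable_shift x)).differentiableWithinAt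
  obtain ⟨R, g, -, hRW, hgd, hg8, hgt, hgs, hgflat⟩ := exists_fixedPoint hτ hd deep_dom hfd
    (fun x hx => by
      change f (turn x) = f x
      simp only [hf]
      rw [(hR0 hx).1.2.2, hFt, hPt, shift_turn, turn_sub_turn]) hfl
  obtain ⟨J, hJ1, hJ2, hJ3⟩ := exists_deep_inverse (g := g) hτ hmu
    ((deep_dom (R := R)).mono fun x hx =>
      ⟨hgd.differentiableAt (isOpen_dom.mem_nhds hx), hg8 x hx, hgt x hx⟩)
  have hJ0 : DeepBigO τ lam mu 0 (fun x => J x - x) := deepBigO_zero_of_deep hJ1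
  set T : ℂ × ℂ → ℂ × ℂ := fun x => x + g x with hT
  have hT0 : DeepBigO τ lam mu 0 (fun x => T x - x) :=
    deepBigO_zero_of_deep ((deep_dom (R := R)).mono fun x hx => by
      simpa [hT] using hg8 x hx)
  have hΨ0 := deepBigO_comp_sub_self hτ hmu hJ0 hP0
  have hΨP : Deep τ lam mu {x | ‖J (Ph x) - Ph x‖ ≤ 1 / 8} := hJ1.preimage' hτ hmu hP0
  refine ⟨pa, pb, Ph, Fh, fun x => Q (T x), fun x => J (Ph x), ha, hb, hPc.mono fun x hx => hx.1,
    hP1, hFc.mono fun x hx => ⟨hx.1, hx.2.1⟩, deepBigO_comp_sub_self hτ hmu hQ0 hT0, hΨ0, ?_, ?_,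
    hΨP, fun m => ?_⟩
  · refine (((deep_dom (R := R)).inter ((deep_dom (R := R)).preimage' hτ hmu deepBigO_shift)).inter
      ((hQ1.preimage' hτ hmu hT0).inter (hJ3.inter
        (hQ2.preimage' hτ hmu (deepBigO_comp_sub_self hτ hmu hFQ0 hT0))))).mono ?_
    rintro x ⟨⟨h1, h2⟩, ⟨h3, h4, h5⟩, h6, h7⟩
    have h1 : x ∈ dom τ lam mu R := h1
    have h2 : shift τ x ∈ dom τ lam mu R := h2
    have h4 : Ph (Q (T x)) = T x := h4
    have h5 : Q (turn (T x)) = turn (Q (T x)) := h5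
    have h6 : J (T x) = x := h6
    have h7 : Q (Ph (Fh (Q (T x)))) = Fh (Q (T x)) := h7
    have hTd : DifferentiableAt ℂ T x :=
      differentiableAt_id.add (hgd.differentiableAt (isOpen_dom.mem_nhds h1))
    refine ⟨DifferentiableAt.comp (g := Q) x h3 hTd, ?_, ?_, ?_⟩
    · have h8 : T (turn x) = turn (T x) := by
        have h9 : g (turn x) = g x := hgt x h1
        simp only [hT, h9, turn_add]
      change Q (T (turn x)) = _
      rw [h8, h5]
    · change J (Ph (Q (T x))) = x
      rw [h4, h6]
    · have h8 : T (shift τ x) = Ph (Fh (Q (T x))) := by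
        have h9 := hgs x h1 h2
        simp only [hf] at h9
        simp only [hT]
        rw [shift_add] at h9
        rw [sub_eq_iff_eq_add.1 h9]
        abel
      change _ = Q (T (shift τ x))
      rw [h8, h7]
  · refine (((hJ2.preimage' hτ hmu hP0).inter hPc).inter hQ2).mono ?_
    rintro x ⟨⟨⟨h1, h2, -⟩, -, h3⟩, h4⟩
    refine ⟨DifferentiableAt.comp (g := J) x h1 h3, ?_⟩
    change Q (J (Ph x) + g (J (Ph x))) = x
    rw [h2]
    exact h4
  · refine ((((hgflat (m + 1)).inter (deep_le_level (2 ^ m + 1))).preimage' hτ hmu hΨ0).inter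
      ((deep_half_level_le hmu hΨ0).inter ((hJ2.preimage' hτ hmu hP0).inter
        (deep_le_level 0)))).mono ?_
    rintro x ⟨⟨h1, h2⟩, h3, ⟨-, h4, -⟩, h5⟩
    have h1 : ‖g (J (Ph x))‖ * level lam mu (J (Ph x)) ^ (m + 1) ≤ 1 := h1
    have h2 : 2 ^ m + 1 ≤ level lam mu (J (Ph x)) := h2
    have h3 : level lam mu x ≤ 2 * level lam mu (J (Ph x)) := h3
    have h5 : 0 ≤ level lam mu x := h5
    have h6 : J (Ph x) - Ph x = -g (J (Ph x)) := by
      nth_rewrite 2 [← h4]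
      abel
    change ‖J (Ph x) - Ph x‖ * _ ≤ 1
    rw [h6, norm_neg]
    set v := level lam mu (J (Ph x))
    have hv : 0 < v := lt_of_lt_of_le (by positivity) h2
    calc ‖g (J (Ph x))‖ * level lam mu x ^ m ≤ ‖g (J (Ph x))‖ * (2 * v) ^ m := by gcongr
      _ = ‖g (J (Ph x))‖ * v ^ m * 2 ^ m := by ring
      _ ≤ ‖g (J (Ph x))‖ * v ^ m * v := by gcongr; linarith
      _ ≤ 1 := by rw [mul_assoc, ← pow_succ]; exact h1

end Normalization

/-! ### Directions and sectors -/

section Sectors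

variable {τ lam : ℂ} {mu : ℝ}

/-- The direction attached to each of the four intervals: `Im (lam ξ) > 0` when `arg ξ` lies in the
interval. -/
theorem exists_direction (hτ : 0 < τ.im) (i : Fin 4) : ∃ (lam : ℂ) (mu : ℝ),
    IsDirection τ lam mu ∧ lam * exp ((intervalStart τ i : ℂ) * I) = ‖lam‖ := by
  have h0 : τ ≠ 0 := fun h => by simp [h] at hτ
  have h1 : τ * exp (((-τ.arg : ℝ) : ℂ) * I) = ‖τ‖ := by
    nth_rewrite 1 [← norm_mul_exp_arg_mul_I τ]
    rw [mul_assoc, ← exp_add]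
    simp
  have h2 : exp (((-Real.pi : ℝ) : ℂ) * I) = -1 := by
    rw [ofReal_neg, neg_mul, exp_neg, exp_pi_mul_I]
    norm_num
  have h3 : exp (((Real.pi - τ.arg : ℝ) : ℂ) * I) = -exp (((-τ.arg : ℝ) : ℂ) * I) := by
    rw [sub_eq_add_neg, ofReal_add, add_mul, exp_add, exp_pi_mul_I, neg_one_mul]
  fin_cases i
  · exact ⟨τ, 1, Or.inr ⟨Or.inl rfl, by simp⟩, h1⟩
  · refine ⟨-1, 0, Or.inl ⟨rfl, Or.inr rfl⟩, ?_⟩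
    change -1 * exp (((-Real.pi : ℝ) : ℂ) * I) = _
    rw [h2]; simp
  · refine ⟨-τ, -1, Or.inr ⟨Or.inr rfl, by simp⟩, ?_⟩
    change -τ * exp (((Real.pi - τ.arg : ℝ) : ℂ) * I) = _
    rw [h3, neg_mul_neg, h1, norm_neg]
  · refine ⟨1, 0, Or.inl ⟨rfl, Or.inl rfl⟩, ?_⟩
    change 1 * exp (((0 : ℝ) : ℂ) * I) = _
    simp

theorem argMem_of_im_pos {θ : ℝ} (hlam : lam * exp ((θ : ℂ) * I) = ‖lam‖) {ξ : ℂ}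
    (h : 0 < (lam * ξ).im) : ArgMem θ (θ + Real.pi) ξ := by
  have h0 : lam * ξ ≠ 0 := fun h0 => by simp [h0] at h
  have hl0 : lam ≠ 0 := left_ne_zero_of_mul h0
  refine ⟨right_ne_zero_of_mul h0, θ + arg (lam * ξ), ?_, ?_, ?_⟩
  · have h1 := arg_nonneg_iff.2 h.le
    have h2 : arg (lam * ξ) ≠ 0 := fun h2 => by
      rw [arg_eq_zero_iff] at h2
      exact h.ne' h2.2
    have := lt_of_le_of_ne h1 h2.symm
    linarith
  · have h2 : arg (lam * ξ) < Real.pi := lt_of_le_of_ne (arg_le_pi _) fun h2 => by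
      rw [arg_eq_pi_iff] at h2
      exact h.ne' h2.2
    linarith
  · have h1 := norm_mul_exp_arg_mul_I (lam * ξ)
    rw [norm_mul, ofReal_mul, ← hlam] at h1
    apply mul_left_cancel₀ hl0
    refine h1.symm.trans ?_
    rw [ofReal_add, add_mul, exp_add]
    ring

theorem le_im_of_argMem {θ ε : ℝ} (hlam : lam * exp ((θ : ℂ) * I) = ‖lam‖) (hε : 0 < ε) {ξ : ℂ}
    (h : ArgMem (θ + ε) (θ + Real.pi - ε) ξ) :
    ε < Real.pi / 2 ∧ ‖lam‖ * ‖ξ‖ * Real.sin ε ≤ (lam * ξ).im := by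
  obtain ⟨-, φ, h1, h2, h3⟩ := h
  have hε2 : ε < Real.pi / 2 := by linarith
  refine ⟨hε2, ?_⟩
  have h4 : lam * ξ = ((‖lam‖ * ‖ξ‖ : ℝ) : ℂ) * exp (((φ - θ : ℝ) : ℂ) * I) := by
    have h5 : exp ((φ : ℂ) * I) = exp ((θ : ℂ) * I) * exp (((φ - θ : ℝ) : ℂ) * I) := by
      rw [← exp_add]; congr 1; push_cast; ring
    nth_rewrite 1 [h3]
    rw [h5, ofReal_mul, ← hlam]
    ring
  rw [h4, im_ofReal_mul, exp_ofReal_mul_I_im]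
  have h6 : Real.sin ε ≤ Real.sin (φ - θ) := by
    rcases le_total (φ - θ) (Real.pi / 2) with h7 | h7
    · exact Real.sin_le_sin_of_le_of_le_pi_div_two (by linarith) h7 (by linarith)
    · rw [← Real.sin_pi_sub (φ - θ)]
      exact Real.sin_le_sin_of_le_of_le_pi_div_two (by linarith) (by linarith) (by linarith)
  gcongr

/-- The imaginary part of a logarithm `t` of `z`, where `z = exp (2 π i t)`. -/
noncomputable def height (z : ℂ) : ℝ := -Real.log ‖z‖ / (2 * Real.pi)

theorem height_expMap (t : ℂ) : height (expMap t) = t.im := by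
  have := Real.pi_ne_zero
  unfold height
  rw [norm_expMap, Real.log_exp]
  field_simp

/-- A logarithm `t` of `z = exp (2 π i t)`. -/
noncomputable def logMap (z : ℂ) : ℂ := log z / (2 * Real.pi * I)

theorem expMap_logMap {z : ℂ} (hz : z ≠ 0) : expMap (logMap z) = z := by
  unfold expMap logMap
  rw [mul_div_cancel₀ _ two_pi_I_ne_zero', exp_log hz]

theorem im_logMap {z : ℂ} (hz : z ≠ 0) : (logMap z).im = height z := by
  rw [← height_expMap, expMap_logMap hz]

theorem height_mul {z w : ℂ} (hz : z ≠ 0) (hw : w ≠ 0) : height (z * w) = height z + height w := by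
  unfold height
  rw [norm_mul, Real.log_mul (norm_ne_zero_iff.2 hz) (norm_ne_zero_iff.2 hw)]
  ring

theorem abs_height_one_add_le {u : ℂ} (hu : ‖u‖ ≤ 1 / 2) : |height (1 + u)| ≤ ‖u‖ := by
  have h1 : height (1 + u) = (logLift u).im := by
    rw [← expMap_logLift (one_add_ne_zero hu), height_expMap]
  rw [h1]
  exact (abs_im_le_norm _).trans (norm_logLift_le hu)

theorem mem_annulus_of_abs_height_le {z : ℂ} (hz : z ≠ 0) {L : ℝ} (h : |height z| ≤ L) :
    z ∈ annulus (2 * Real.pi * L) := by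
  rw [← expMap_logMap hz]
  exact expMap_mem_annulus (by rwa [im_logMap hz])

/-- Points of a subsector lift to points of one strip whose depth is comparable with `|ξ|`. -/
theorem exists_lift_sector (hτ : 0 < τ.im) (hd : IsDirection τ lam mu) {θ ε c : ℝ}
    (hlam : lam * exp ((θ : ℂ) * I) = ‖lam‖) (hε : 0 < ε) (hc : 0 < c) :
    ∃ (n : ℕ) (κ : ℝ), 0 < κ ∧ ∀ r : ℝ, ∃ R > 0,
      ∀ p ∈ sector (θ + ε) (θ + Real.pi - ε) R c, ∃ x, cover x = p ∧ |x.1.im| < (n + 1) * τ.im ∧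
        r < level lam mu x ∧ κ * ‖p.2‖ ≤ level lam mu x := by
  obtain ⟨n, hn⟩ := exists_nat_ge (c / τ.im)
  have hn : c ≤ n * τ.im := (div_le_iff₀ hτ).1 hn
  have hl := norm_pos_iff.2 (hd.ne_zero hτ)
  by_cases hε2 : ε < Real.pi / 2
  swap
  · exact ⟨n, 1, one_pos, fun r => ⟨1, one_pos, fun p hp =>
      absurd (le_im_of_argMem hlam hε hp.1).1 hε2⟩⟩
  have hs : 0 < Real.sin ε := Real.sin_pos_of_pos_of_lt_pi hε (by linarith)
  set κ : ℝ := ‖lam‖ * Real.sin ε / 2 with hκ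
  have hκ0 : 0 < κ := by positivity
  refine ⟨n, κ, hκ0, fun r => ⟨(|r| + c + 1) / κ, by positivity, ?_⟩⟩
  rintro p ⟨h1, h2, h3, h4⟩
  have hp0 : p.1 ≠ 0 := norm_pos_iff.1 ((Real.exp_pos _).trans h3)
  have hh : |height p.1| ≤ c := by
    have h5 : |Real.log ‖p.1‖| ≤ c := by
      have := norm_pos_iff.2 hp0
      rw [abs_le]
      exact ⟨((Real.lt_log_iff_exp_lt this).2 h3).le, ((Real.log_lt_iff_lt_exp this).2 h4).le⟩
    unfold height
    rw [abs_div, abs_neg, abs_of_pos (show 0 < 2 * Real.pi by positivity),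
      div_le_iff₀ (by positivity)]
    nlinarith [Real.pi_gt_three]
  have h6 := (le_im_of_argMem hlam hε h1).2
  rw [div_lt_iff₀ hκ0] at h2
  have him : (logMap p.1).im = height p.1 := im_logMap hp0
  have hlev : level lam mu (logMap p.1, p.2) = (lam * p.2).im + mu * height p.1 := by
    simp [level, him]
  have hmu : -c ≤ mu * height p.1 := by
    have h7 : |mu * height p.1| ≤ c := by
      rw [abs_mul]
      calc |mu| * |height p.1| ≤ 1 * c := by gcongr; exact hd.abs_mu_le
        _ = c := one_mul c
    exact (abs_le.1 h7).1
  have h8 : ‖lam‖ * ‖p.2‖ * Real.sin ε = 2 * (‖p.2‖ * κ) := by rw [hκ]; ring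
  refine ⟨(logMap p.1, p.2), ?_, ?_, ?_, ?_⟩
  · simp [cover, expMap_logMap hp0]
  · change |(logMap p.1).im| < _
    rw [him]
    linarith
  · rw [hlev]
    linarith [le_abs_self r, abs_nonneg r]
  · rw [hlev]
    linarith [abs_nonneg r]

end Sectors

/-! ### Drift of the orbits near the curve -/

section Neighborhood

variable {τ lam : ℂ} {mu : ℝ} {P : FormalDiffeo} {F : NbhdDiffeo (expMap τ)}

/-- The depth of a point `(z, ξ)` measured in the coordinate `ξ + b₀(z)`, which the germ shifts by
`-1` up to `O(1 / ξ)`. -/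
noncomputable def depth (lam : ℂ) (mu : ℝ) (P : FormalDiffeo) (p : ℂ × ℂ) : ℝ :=
  (lam * (p.2 + P.b 0 p.1)).im + mu * height p.1

theorem IsDirection.im_eq (hd : IsDirection τ lam mu) : lam.im = mu * τ.im := by
  obtain ⟨rfl, rfl | rfl⟩ | ⟨rfl | rfl, rfl⟩ := hd <;> simp

/-- On a bounded interval the arctangent increases by a definite amount over steps of length `δ`. -/
theorem exists_arctan_gap {b δ : ℝ} (hδ : 0 < δ) :
    ∃ κ > 0, ∀ y ∈ Icc (-b) b, κ ≤ Real.arctan (y + δ) - Real.arctan y := by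
  rcases (Icc (-b) b).eq_empty_or_nonempty with he | hne
  · exact ⟨1, one_pos, fun y hy => by rw [he] at hy; exact hy.elim⟩
  obtain ⟨y0, -, hmin⟩ := (isCompact_Icc (a := -b) (b := b)).exists_isMinOn hne
    (f := fun y => Real.arctan (y + δ) - Real.arctan y)
    (((Real.continuous_arctan.comp (continuous_add_const δ)).sub
      Real.continuous_arctan).continuousOn)
  exact ⟨_, sub_pos.2 (Real.arctan_strictMono (lt_add_of_pos_right y0 hδ)), fun y hy => hmin hy⟩

/-- Close enough to the curve over a strip, the germ increases the height, and it changes the depth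
by at most the increment of the arctangent of the height. -/
theorem FormalDiffeo.Conjugates.exists_drift (hP : P.Conjugates F) (hτ : 0 < τ.im)
    (hd : IsDirection τ lam mu) (n : ℕ) : ∃ ρ > 0, ∀ p : ℂ × ℂ, p.1 ≠ 0 →
      |height p.1| < (n + 1) * τ.im → ρ < ‖p.2‖ → p ∈ xiDomain F.U ∧
      height p.1 ≤ height (F.xi p).1 ∧ |depth lam mu P (F.xi p) - depth lam mu P p| ≤
        Real.arctan (height (F.xi p).1) - Real.arctan (height p.1) := by
  have hq := expMap_ne_zero τ
  set L : ℝ := 2 * Real.pi * ((n + 1) * τ.im) with hL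
  obtain ⟨C, hC, R, hR, h1⟩ := hP.exists_xi_bounds F hq (isCompact_annulus L)
    fun z hz => annulus_ne_zero hz
  obtain ⟨C', hC', R', hR', h2⟩ := hP.exists_trunc_bound F hq (isCompact_annulus L)
    (fun z hz => annulus_ne_zero hz) 0
  obtain ⟨κ, hκ, hgap⟩ := exists_arctan_gap (b := (n + 1) * τ.im) (half_pos hτ)
  have hqn : 0 < ‖expMap τ‖ := norm_pos_iff.2 hq
  set C₁ : ℝ := C / (‖expMap τ‖ * Real.exp (-L)) with hC₁
  have hC₁0 : 0 < C₁ := by positivity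
  -- `|ξ| > ρ` forces the height to increase by at least `Im τ / 2`, and the depth to vary by at most
  -- the least increment `κ` of the arctangent over such a step
  refine ⟨max (max R R') (max (C₁ / min (1 / 2) (τ.im / 2)) ((‖lam‖ * C' + C₁) / κ)),
    lt_max_of_lt_left (lt_max_of_lt_left hR), fun p hp0 hh hρ => ?_⟩
  simp only [max_lt_iff] at hρ
  obtain ⟨⟨hρ1, hρ2⟩, hρ3, hρ4⟩ := hρ
  have hξ : 0 < ‖p.2‖ := hR.trans hρ1
  have hpK : p.1 ∈ annulus L := mem_annulus_of_abs_height_le hp0 hh.le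
  obtain ⟨hU, h3, -⟩ := h1 p hpK hρ1
  have h4 := h2 p hpK hρ2
  set u : ℂ := (F.xi p).1 / (expMap τ * p.1) - 1 with hu
  have hqz : expMap τ * p.1 ≠ 0 := mul_ne_zero hq hp0
  have hu1 : ‖u‖ ≤ C₁ / ‖p.2‖ := by
    have h5 : u = ((F.xi p).1 - expMap τ * p.1) / (expMap τ * p.1) := by
      rw [hu]; field_simp
    rw [h5, norm_div, norm_mul]
    calc _ ≤ C / ‖p.2‖ / (‖expMap τ‖ * Real.exp (-L)) := by gcongr; exact hpK.1
      _ = _ := by rw [hC₁]; ring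
  have hu2 : C₁ / ‖p.2‖ ≤ min (1 / 2) (τ.im / 2) := by
    have hm : 0 < min (1 / 2) (τ.im / 2) := lt_min (by norm_num) (half_pos hτ)
    rw [div_le_iff₀ hξ]
    rw [div_lt_iff₀ hm] at hρ3
    linarith
  have hu3 : ‖u‖ ≤ 1 / 2 := hu1.trans (hu2.trans (min_le_left _ _))
  have hF1 : (F.xi p).1 = expMap τ * p.1 * (1 + u) := by rw [hu]; field_simp; ring
  have hheight : height (F.xi p).1 = height p.1 + τ.im + height (1 + u) := by
    rw [hF1, height_mul hqz (one_add_ne_zero hu3), height_mul hq hp0, height_expMap]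
    ring
  have hd1 := abs_height_one_add_le hu3
  have hup : height p.1 + τ.im / 2 ≤ height (F.xi p).1 := by
    have := (abs_le.1 (hd1.trans (hu1.trans (hu2.trans (min_le_right _ _))))).1
    linarith
  refine ⟨hU, by linarith, ?_⟩
  have hdep : |depth lam mu P (F.xi p) - depth lam mu P p| ≤ κ := by
    set e : ℂ := (P.trunc 0 (F.xi p) - modelMap (expMap τ) (P.trunc 0 p)).2 with he
    have he1 : ‖e‖ ≤ C' / ‖p.2‖ := by
      have := (norm_snd_le _).trans h4
      rwa [zero_add, pow_one] at this
    have he2 : e = (F.xi p).2 + P.b 0 (F.xi p).1 - (p.2 + P.b 0 p.1 - 1) := by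
      simp [he, FormalDiffeo.trunc, modelMap, partialSum]
    have h5 : depth lam mu P (F.xi p) - depth lam mu P p =
        (lam * e).im + mu * height (1 + u) := by
      have h6 : (F.xi p).2 + P.b 0 (F.xi p).1 = p.2 + P.b 0 p.1 - 1 + e := by rw [he2]; ring
      unfold depth
      rw [h6, hheight]
      have h7 := hd.im_eq
      simp only [mul_add, mul_sub, add_im, sub_im, mul_one, h7]
      ring
    rw [h5]
    calc _ ≤ |(lam * e).im| + |mu * height (1 + u)| := abs_add_le _ _
      _ ≤ ‖lam‖ * (C' / ‖p.2‖) + 1 * (C₁ / ‖p.2‖) := by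
        refine add_le_add ((abs_im_le_norm _).trans ?_) ?_
        · rw [norm_mul]; gcongr
        · rw [abs_mul]
          exact mul_le_mul hd.abs_mu_le (hd1.trans hu1) (abs_nonneg _) zero_le_one
      _ = (‖lam‖ * C' + C₁) / ‖p.2‖ := by ring
      _ ≤ κ := by
        rw [div_le_iff₀ hξ]
        rw [div_lt_iff₀ hκ] at hρ4
        linarith
  have h8 := hgap (height p.1) (abs_le.1 hh.le)
  have h9 := Real.arctan_strictMono.monotone hup
  linarith

/-- The neighborhood of the curve on which the orbits of the germ drift as those of the model map;
as the increments of the arctangent telescope, the depth varies by less than `π` along an orbit. -/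
theorem FormalDiffeo.Conjugates.exists_nbhd (hP : P.Conjugates F) (hτ : 0 < τ.im)
    (hd : IsDirection τ lam mu) : ∃ V : Set (ℂ × ℂ), IsOpen V ∧ V ⊆ F.U ∧
      (∀ z : ℂ, z ≠ 0 → (z, (0 : ℂ)) ∈ V) ∧ Deep τ lam mu {x | cover x ∈ xiDomain V} ∧
      ∀ p ∈ xiDomain V, height p.1 ≤ height (F.xi p).1 ∧
        |depth lam mu P (F.xi p) - depth lam mu P p| ≤
          Real.arctan (height (F.xi p).1) - Real.arctan (height p.1) := by
  choose ρ hρ0 hρ using hP.exists_drift hτ hd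
  set V : Set (ℂ × ℂ) := ⋃ n : ℕ, ({p | p.1 ≠ 0} ∩ {p | |height p.1| < (n + 1) * τ.im}) ∩
    {p | ρ n * ‖p.2‖ < 1} with hV
  have hmem : ∀ p : ℂ × ℂ, p ∈ xiDomain V → ∃ n : ℕ, p.1 ≠ 0 ∧ |height p.1| < (n + 1) * τ.im ∧
      ρ n < ‖p.2‖ := by
    rintro p ⟨hp0, hp⟩
    obtain ⟨n, ⟨h1, h2⟩, h3⟩ := mem_iUnion.1 hp
    refine ⟨n, h1, h2, ?_⟩
    have h3 : ρ n * ‖p.2⁻¹‖ < 1 := h3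
    rwa [norm_inv, mul_inv_lt_iff₀ (norm_pos_iff.2 hp0), one_mul] at h3
  refine ⟨V, ?_, ?_, ?_, ?_, ?_⟩
  · refine isOpen_iUnion fun n => IsOpen.inter ?_
      (isOpen_lt (f := fun p : ℂ × ℂ => ρ n * ‖p.2‖) (by fun_prop) continuous_const)
    have hc : ContinuousOn (fun p : ℂ × ℂ => |height p.1|) {p | p.1 ≠ 0} := by
      unfold height
      refine ContinuousOn.abs (ContinuousOn.div_const (ContinuousOn.neg (ContinuousOn.log
        (by fun_prop) fun p hp => norm_ne_zero_iff.2 hp)) _)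
    exact hc.isOpen_inter_preimage (isOpen_ne_fun continuous_fst continuous_const) isOpen_Iio
  · rintro p hp
    obtain ⟨n, ⟨h1, h2⟩, h3⟩ := mem_iUnion.1 hp
    by_cases h0 : p.2 = 0
    · have := F.curve_subset p.1 h1
      rwa [← h0] at this
    · have h3 : ρ n * ‖p.2‖ < 1 := h3
      have := (hρ n (p.1, p.2⁻¹) h1 h2 (by
        change ρ n < ‖p.2⁻¹‖
        rw [norm_inv, ← one_div, lt_div_iff₀ (norm_pos_iff.2 h0)]
        exact h3)).1.2
      simpa using this
  · intro z hz
    obtain ⟨n, hn⟩ := exists_nat_ge (|height z| / τ.im)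
    rw [div_le_iff₀ hτ] at hn
    refine mem_iUnion.2 ⟨n, ⟨hz, ?_⟩, ?_⟩
    · change |height z| < _
      linarith
    · change ρ n * ‖(0 : ℂ)‖ < 1
      simp
  · intro n
    obtain ⟨r, -, hr⟩ := (deep_le_norm_snd (τ := τ) (lam := lam) hd.abs_mu_le
      (ρ n + 1)).exists_forall n 0
    refine ⟨r, fun x h1 h2 => ?_⟩
    have h3 : ρ n + 1 ≤ ‖x.2‖ := hr x h1 h2
    have h4 := hρ0 n
    have h5 : 0 < ‖x.2‖ := by linarith
    refine ⟨norm_pos_iff.1 h5, mem_iUnion.2 ⟨n, ⟨expMap_ne_zero _, ?_⟩, ?_⟩⟩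
    · change |height (expMap x.1)| < _
      rwa [height_expMap]
    · change ρ n * ‖x.2⁻¹‖ < 1
      rw [norm_inv, mul_inv_lt_iff₀ h5]
      linarith
  · intro p hp
    obtain ⟨n, h1, h2, h3⟩ := hmem p hp
    exact (hρ n p h1 h2 h3).2

end Neighborhood

/-! ### Descent to the sectors and comparison of orbits -/

section Chart

variable {τ lam : ℂ} {mu : ℝ} {P : FormalDiffeo} {F : NbhdDiffeo (expMap τ)} {V W : Set (ℂ × ℂ)}
  {R R' : ℕ → ℝ} {Θ Ψ : ℂ × ℂ → ℂ × ℂ}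

theorem dom_mono (h : ∀ n, R n ≤ R' n) : dom τ lam mu R' ⊆ dom τ lam mu R := by
  rintro x ⟨n, h1, h2⟩
  exact ⟨n, h1, (h n).trans_lt h2⟩

theorem Deep.exists_monotone {A : Set (ℂ × ℂ)} (hA : Deep τ lam mu A) :
    ∃ R, Monotone R ∧ dom τ lam mu R ⊆ A := by
  obtain ⟨R, -, hR⟩ := hA.exists_steep
  refine ⟨fun n => ∑ i ∈ Finset.range (n + 1), |R i|, ?_, (dom_mono fun n => ?_).trans hR⟩
  · refine monotone_nat_of_le_succ fun n => ?_
    rw [Finset.sum_range_succ _ (n + 1)]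
    exact le_add_of_nonneg_right (abs_nonneg _)
  · exact (le_abs_self _).trans (Finset.single_le_sum (f := fun i => |R i|)
      (fun i _ => abs_nonneg _) (Finset.self_mem_range_succ n))

/-- Coordinates `Θ` on the covering of a sector near the curve, with inverse `Ψ`: they conjugate the
model map on `dom R` to the lifted germ, commute with the deck transformation `turn`, take values in
an open set `W` on which `Ψ` is holomorphic, and change the height and the depth by at most `1`. -/
structure SectorChart (F : NbhdDiffeo (expMap τ)) (P : FormalDiffeo) (lam : ℂ) (mu : ℝ)
    (V W : Set (ℂ × ℂ)) (R : ℕ → ℝ) (Θ Ψ : ℂ × ℂ → ℂ × ℂ) : Prop where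
  isOpen : IsOpen W
  maps : ∀ x ∈ dom τ lam mu R, Θ x ∈ W
  diff : ∀ w ∈ W, DifferentiableAt ℂ Ψ w
  right_inv : ∀ w ∈ W, Θ (Ψ w) = w
  left_inv : ∀ x ∈ dom τ lam mu R, Ψ (Θ x) = x
  turn_eq : ∀ x ∈ dom τ lam mu R, Θ (turn x) = turn (Θ x)
  conj : ∀ x ∈ dom τ lam mu R, cover (Θ (shift τ x)) = F.xi (cover (Θ x))
  mem_nbhd : ∀ x ∈ dom τ lam mu R, cover (Θ x) ∈ xiDomain V
  depth_sub_le : ∀ x ∈ dom τ lam mu R, |depth lam mu P (cover (Θ x)) - level lam mu x| ≤ 1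
  im_sub_le : ∀ x ∈ dom τ lam mu R, |(Θ x).1.im - x.1.im| ≤ 1
  im_pos : ∀ x ∈ dom τ lam mu R, 0 < (lam * (Θ x).2).im

/-- The map induced by `Ψ` on the base of the covering, computed with the principal logarithm of
`z`. -/
noncomputable def descent (Ψ : ℂ × ℂ → ℂ × ℂ) (p : ℂ × ℂ) : ℂ × ℂ :=
  cover (Ψ (logMap p.1, p.2))

theorem cover_eq_cover_iff {x y : ℂ × ℂ} :
    cover x = cover y ↔ ∃ n : ℤ, x = (y.1 + n, y.2) := by
  simp only [cover, Prod.ext_iff, expMap_eq_iff]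
  constructor
  · rintro ⟨⟨n, h1⟩, h2⟩; exact ⟨n, h1, h2⟩
  · rintro ⟨n, h1, h2⟩; exact ⟨⟨n, h1⟩, h2⟩

theorem mem_dom_add_int {x : ℂ × ℂ} (n : ℤ) :
    (x.1 + n, x.2) ∈ dom τ lam mu R ↔ x ∈ dom τ lam mu R := by
  have h1 : level lam mu (x.1 + n, x.2) = level lam mu x := by simp [level]
  change Adm _ _ _ _ ↔ Adm _ _ _ _
  rw [h1]
  simp

theorem SectorChart.turn_int (H : SectorChart F P lam mu V W R Θ Ψ) {x : ℂ × ℂ}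
    (hx : x ∈ dom τ lam mu R) (n : ℤ) : Θ (x.1 + n, x.2) = ((Θ x).1 + n, (Θ x).2) := by
  have key : ∀ m : ℤ, Θ (x.1 + (m + 1 : ℤ), x.2) = turn (Θ (x.1 + m, x.2)) := fun m => by
    rw [← H.turn_eq _ ((mem_dom_add_int m).2 hx)]
    congr 1
    simp [turn, add_assoc]
  induction n using Int.induction_on with
  | zero => simp
  | succ n ih => rw [key, ih]; simp [turn, add_assoc]
  | pred n ih =>
    have h1 := key (-n - 1)
    rw [sub_add_cancel, ih] at h1
    have h2 := Prod.ext_iff.1 h1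
    simp only [turn] at h2
    refine Prod.ext ?_ h2.2.symm
    have h3 := h2.1
    push_cast at h3 ⊢
    linear_combination -h3

theorem SectorChart.injective (H : SectorChart F P lam mu V W R Θ Ψ) {x y : ℂ × ℂ}
    (hx : x ∈ dom τ lam mu R) (hy : y ∈ dom τ lam mu R) :
    cover (Θ x) = cover (Θ y) ↔ cover x = cover y := by
  rw [cover_eq_cover_iff, cover_eq_cover_iff]
  constructor
  · rintro ⟨n, h⟩
    refine ⟨n, ?_⟩
    rw [← H.turn_int hy n] at h
    rw [← H.left_inv x hx, h, H.left_inv _ ((mem_dom_add_int n).2 hy)]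
  · rintro ⟨n, h⟩
    exact ⟨n, by rw [← H.turn_int hy n, h]⟩

theorem SectorChart.descent_cover (H : SectorChart F P lam mu V W R Θ Ψ) {x : ℂ × ℂ}
    (hx : x ∈ dom τ lam mu R) : descent Ψ (cover (Θ x)) = cover x := by
  obtain ⟨n, hn⟩ : ∃ n : ℤ, (logMap (expMap (Θ x).1), (Θ x).2) = ((Θ x).1 + n, (Θ x).2) := by
    rw [← cover_eq_cover_iff]
    simp [cover, expMap_logMap (expMap_ne_zero _)]
  change cover (Ψ (logMap (expMap (Θ x).1), (Θ x).2)) = cover x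
  rw [hn, ← H.turn_int hx n, H.left_inv _ ((mem_dom_add_int n).2 hx), cover_eq_cover_iff]
  exact ⟨n, rfl⟩

/-- The local inverse of the covering through the point `w`. -/
noncomputable def localLift (w p : ℂ × ℂ) : ℂ × ℂ :=
  (w.1 + logLift (p.1 * (expMap w.1)⁻¹ - 1), p.2)

theorem localLift_cover (w : ℂ × ℂ) : localLift w (cover w) = w := by
  simp [localLift, cover, logLift, expMap_ne_zero]

theorem differentiableAt_localLift (w : ℂ × ℂ) : DifferentiableAt ℂ (localLift w) (cover w) := by
  have h1 : DifferentiableAt ℂ logLift ((cover w).1 * (expMap w.1)⁻¹ - 1) :=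
    differentiableAt_logLift (by simp [cover, expMap_ne_zero])
  have h2 : DifferentiableAt ℂ (fun p : ℂ × ℂ => logLift (p.1 * (expMap w.1)⁻¹ - 1)) (cover w) :=
    DifferentiableAt.comp (g := logLift) (cover w) h1 (by fun_prop)
  exact (h2.const_add w.1).prodMk differentiableAt_snd

theorem eventually_cover_localLift (w : ℂ × ℂ) :
    ∀ᶠ p in 𝓝 (cover w), cover (localLift w p) = p := by
  filter_upwards [continuousAt_fst.eventually_ne (show (cover w).1 ≠ 0 from expMap_ne_zero _)]
    with p hp
  refine Prod.ext ?_ rfl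
  have h0 := expMap_ne_zero w.1
  simp only [cover, localLift, expMap_add]
  rw [expMap_logLift]
  · field_simp; ring
  · rw [add_sub_cancel]
    exact mul_ne_zero hp (inv_ne_zero h0)

/-- Near a point of the sector, the map induced by `Ψ` is given by a holomorphic branch. -/
theorem SectorChart.eventually_mem (H : SectorChart F P lam mu V W R Θ Ψ)
    (hR : ∀ n, R n ≤ R' n) {x : ℂ × ℂ} (hx : x ∈ dom τ lam mu R') :
    ∀ᶠ p in 𝓝 (cover (Θ x)), p ∈ cover '' (Θ '' dom τ lam mu R') ∧
      descent Ψ p = cover (Ψ (localLift (Θ x) p)) := by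
  have hx' := dom_mono hR hx
  have hc : ContinuousAt (localLift (Θ x)) (cover (Θ x)) :=
    (differentiableAt_localLift (Θ x)).continuousAt
  have hw := H.maps x hx'
  have h1 : ∀ᶠ w in 𝓝 (localLift (Θ x) (cover (Θ x))), w ∈ W ∧ Ψ w ∈ dom τ lam mu R' := by
    rw [localLift_cover]
    have hWn : ∀ᶠ w in 𝓝 (Θ x), w ∈ W := H.isOpen.mem_nhds hw
    refine hWn.and ((H.diff _ hw).continuousAt.eventually (isOpen_dom.mem_nhds ?_))
    rwa [H.left_inv x hx']
  filter_upwards [hc.eventually h1, eventually_cover_localLift (Θ x)] with p hp1 hp2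
  have h3 := H.right_inv _ hp1.1
  have h4 : cover (Θ (Ψ (localLift (Θ x) p))) = p := by rw [h3, hp2]
  refine ⟨⟨_, ⟨_, hp1.2, rfl⟩, h4⟩, ?_⟩
  have h5 := H.descent_cover (dom_mono hR hp1.2)
  rwa [h4] at h5

theorem SectorChart.isOpen_image (H : SectorChart F P lam mu V W R Θ Ψ)
    (hR : ∀ n, R n ≤ R' n) : IsOpen (cover '' (Θ '' dom τ lam mu R')) := by
  rw [isOpen_iff_mem_nhds]
  rintro _ ⟨_, ⟨x, hx, rfl⟩, rfl⟩
  exact (H.eventually_mem hR hx).mono fun p hp => hp.1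

theorem SectorChart.differentiableOn_descent (H : SectorChart F P lam mu V W R Θ Ψ)
    (hR : ∀ n, R n ≤ R' n) :
    DifferentiableOn ℂ (descent Ψ) (cover '' (Θ '' dom τ lam mu R')) := by
  rintro _ ⟨_, ⟨x, hx, rfl⟩, rfl⟩
  have h1 : DifferentiableAt ℂ (fun p => cover (Ψ (localLift (Θ x) p))) (cover (Θ x)) := by
    have h2 : DifferentiableAt ℂ Ψ (localLift (Θ x) (cover (Θ x))) := by
      rw [localLift_cover]
      exact H.diff _ (H.maps x (dom_mono hR hx))
    exact DifferentiableAt.comp (g := cover) _ (differentiable_cover _)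
      (DifferentiableAt.comp (g := Ψ) _ h2 (differentiableAt_localLift (Θ x)))
  exact (h1.congr_of_eventuallyEq ((H.eventually_mem hR hx).mono fun p hp => hp.2)
    ).differentiableWithinAt

theorem SectorChart.injOn_descent (H : SectorChart F P lam mu V W R Θ Ψ)
    (hR : ∀ n, R n ≤ R' n) : InjOn (descent Ψ) (cover '' (Θ '' dom τ lam mu R')) := by
  rintro _ ⟨_, ⟨x, hx, rfl⟩, rfl⟩ _ ⟨_, ⟨y, hy, rfl⟩, rfl⟩ h
  have hx' := dom_mono hR hx
  have hy' := dom_mono hR hy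
  rw [H.descent_cover hx', H.descent_cover hy'] at h
  exact (H.injective hx' hy').2 h

theorem iterate_shift (k : ℕ) (x : ℂ × ℂ) : (shift τ)^[k] x = (x.1 + k * τ, x.2 - k) := by
  induction k with
  | zero => simp
  | succ k ih =>
    rw [Function.iterate_succ_apply', ih]
    refine Prod.ext ?_ ?_ <;> simp [shift] <;> ring

theorem cover_iterate_shift (k : ℕ) (x : ℂ × ℂ) :
    cover ((shift τ)^[k] x) = (modelMap (expMap τ))^[k] (cover x) := by
  induction k with
  | zero => rfl
  | succ k ih =>
    rw [Function.iterate_succ_apply', Function.iterate_succ_apply', ← ih]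
    exact cover_shift _

theorem level_iterate_shift (hd : IsDirection τ lam mu) (k : ℕ) (x : ℂ × ℂ) :
    level lam mu ((shift τ)^[k] x) = level lam mu x := by
  induction k with
  | zero => rfl
  | succ k ih => rw [Function.iterate_succ_apply', level_shift hd, ih]

theorem SectorChart.cover_iterate (H : SectorChart F P lam mu V W R Θ Ψ) {x : ℂ × ℂ} {k : ℕ}
    (hx : ∀ j < k, (shift τ)^[j] x ∈ dom τ lam mu R) :
    F.xi^[k] (cover (Θ x)) = cover (Θ ((shift τ)^[k] x)) := by
  induction k with
  | zero => rfl
  | succ k ih =>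
    rw [Function.iterate_succ_apply', Function.iterate_succ_apply',
      ih fun j hj => hx j (hj.trans k.lt_succ_self), H.conj _ (hx k k.lt_succ_self)]

/-- If the images of two points lie on one orbit of the model map, then the points lie on one orbit
of the germ: the orbit segment between the images stays in the domain of the chart. -/
theorem SectorChart.orbitIn_of_iterate (H : SectorChart F P lam mu V W R Θ Ψ) (hτ : 0 < τ.im)
    (hd : IsDirection τ lam mu) {x y : ℂ × ℂ} (hx : x ∈ dom τ lam mu R) (hy : y ∈ dom τ lam mu R)
    {k : ℕ} (h : (modelMap (expMap τ))^[k] (cover x) = cover y) :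
    OrbitIn F V k (cover (Θ x)) (cover (Θ y)) := by
  rw [← cover_iterate_shift] at h
  obtain ⟨n, hn⟩ := cover_eq_cover_iff.1 h
  have hk : (shift τ)^[k] x ∈ dom τ lam mu R := by rw [hn]; exact (mem_dom_add_int n).2 hy
  have hmem : ∀ j ≤ k, (shift τ)^[j] x ∈ dom τ lam mu R := by
    intro j hj
    have h1 : Adm τ R x.1.im (level lam mu x) := hx
    have h2 : Adm τ R ((shift τ)^[k] x).1.im (level lam mu ((shift τ)^[k] x)) := hk
    rw [level_iterate_shift hd] at h2
    change Adm τ R _ _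
    rw [level_iterate_shift hd]
    refine h1.between h2 ?_
    have h3 : (j : ℝ) ≤ k := by exact_mod_cast hj
    simp only [iterate_shift, add_im, mul_im, natCast_re, natCast_im, zero_mul, add_zero]
    constructor
    · have : (0 : ℝ) ≤ j * τ.im := by positivity
      linarith
    · gcongr
  refine ⟨fun j hj => ?_, ?_⟩
  · rw [H.cover_iterate fun i hi => hmem i (hi.le.trans hj)]
    exact H.mem_nbhd _ (hmem j hj)
  · rw [H.cover_iterate fun i hi => hmem i hi.le, H.injective hk hy, h]

/-- Conversely, the drift of the orbits of the germ forces an orbit segment to stay in the domain of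
the chart if its end point belongs to a smaller domain. At the end point the depth has to exceed the
bound by `6`, for the drift of the depth (less than `π < 4`) and for the errors at both ends (`1`
each), and the height of a point may exceed that of the end point by `2 + Im τ`, which is absorbed
by `m` further strips. -/
theorem SectorChart.iterate_of_orbitIn (H : SectorChart F P lam mu V W R Θ Ψ) (hτ : 0 < τ.im)
    (hd : IsDirection τ lam mu) (hmono : Monotone R) {m : ℕ} (hm : 2 + τ.im ≤ m * τ.im)
    (hV : ∀ p ∈ xiDomain V, height p.1 ≤ height (F.xi p).1 ∧
        |depth lam mu P (F.xi p) - depth lam mu P p| ≤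
          Real.arctan (height (F.xi p).1) - Real.arctan (height p.1)) {x y : ℂ × ℂ}
    (hx : x ∈ dom τ lam mu R) (hy : y ∈ dom τ lam mu (fun n => R (n + m) + 6)) {k : ℕ}
    (h : OrbitIn F V k (cover (Θ x)) (cover (Θ y))) :
    (modelMap (expMap τ))^[k] (cover x) = cover y := by
  obtain ⟨hin, hk⟩ := h
  have hy' : y ∈ dom τ lam mu R :=
    dom_mono (fun n => by have := hmono (n.le_add_right m); linarith) hy
  -- monotonicity along the orbit
  have hdrift : ∀ i d : ℕ, i + d ≤ k →
      height (F.xi^[i] (cover (Θ x))).1 ≤ height (F.xi^[i + d] (cover (Θ x))).1 ∧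
      |depth lam mu P (F.xi^[i + d] (cover (Θ x))) - depth lam mu P (F.xi^[i] (cover (Θ x)))| ≤
        Real.arctan (height (F.xi^[i + d] (cover (Θ x))).1) -
          Real.arctan (height (F.xi^[i] (cover (Θ x))).1) := by
    intro i d
    induction d with
    | zero => intro _; simp
    | succ d ih =>
      intro hid
      obtain ⟨h1, h2⟩ := ih (by omega)
      obtain ⟨h3, h4⟩ := hV _ (hin (i + d) (by omega))
      rw [← add_assoc, Function.iterate_succ_apply']
      refine ⟨h1.trans h3, ?_⟩
      have h5 := abs_add_le (depth lam mu P (F.xi (F.xi^[i + d] (cover (Θ x)))) -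
        depth lam mu P (F.xi^[i + d] (cover (Θ x))))
        (depth lam mu P (F.xi^[i + d] (cover (Θ x))) - depth lam mu P (F.xi^[i] (cover (Θ x))))
      rw [sub_add_sub_cancel] at h5
      linarith
  have hmem : ∀ j ≤ k, ∀ i ≤ j, (shift τ)^[i] x ∈ dom τ lam mu R := by
    intro j
    induction j with
    | zero =>
      intro _ i hi
      rw [Nat.le_zero.1 hi]
      exact hx
    | succ j ih =>
      intro hj i hi
      have ih := ih (by omega)
      rcases Nat.lt_or_ge i (j + 1) with hij | hij
      · exact ih i (by omega)
      obtain rfl : i = j + 1 := le_antisymm hi hij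
      set v := level lam mu x with hv
      have hlev : level lam mu ((shift τ)^[j] x) = v := level_iterate_shift hd j x
      have him : ((shift τ)^[j + 1] x).1.im = ((shift τ)^[j] x).1.im + τ.im := by
        rw [Function.iterate_succ_apply']; simp [shift]
      change Adm τ R _ _
      rw [level_iterate_shift hd]
      rcases le_or_gt ((shift τ)^[j + 1] x).1.im 0 with h0 | h0
      · -- below the real axis, the strip of the initial point still contains the point
        obtain ⟨n, hn1, hn2⟩ := hx
        refine ⟨n, ?_, hn2⟩
        rw [abs_of_nonpos h0]
        have h1 : x.1.im ≤ ((shift τ)^[j + 1] x).1.im := by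
          rw [iterate_shift]
          have : (0 : ℝ) ≤ ((j + 1 : ℕ) : ℝ) * τ.im := by positivity
          simp only [add_im, mul_im, natCast_re, natCast_im, zero_mul, add_zero]
          linarith
        linarith [neg_le_abs x.1.im]
      · -- above it, the depth and the height are controlled by the end point
        obtain ⟨n, hn1, hn2⟩ := hy
        obtain ⟨d, hd'⟩ := Nat.exists_eq_add_of_le (show j ≤ k by omega)
        obtain ⟨h1, h2⟩ := hdrift j d (by omega)
        rw [← hd', hk, H.cover_iterate fun i hi => ih i hi.le] at h1 h2
        have h3 := abs_le.1 (H.depth_sub_le _ (ih j le_rfl))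
        have h4 := abs_le.1 (H.im_sub_le _ (ih j le_rfl))
        have h5 := abs_le.1 (H.depth_sub_le y hy')
        have h6 := abs_le.1 (H.im_sub_le y hy')
        have h7 := abs_le.1 h2
        rw [hlev] at h3
        have h8 : height (cover (Θ y)).1 = (Θ y).1.im := height_expMap _
        have h9 : height (cover (Θ ((shift τ)^[j] x))).1 = (Θ ((shift τ)^[j] x)).1.im :=
          height_expMap _
        have h10 := Real.arctan_lt_pi_div_two (height (cover (Θ y)).1)
        have h11 := Real.neg_pi_div_two_lt_arctan (height (cover (Θ ((shift τ)^[j] x))).1)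
        have h12 := Real.pi_lt_four
        rw [h8, h9] at h1
        refine ⟨n + m, ?_, ?_⟩
        · rw [abs_of_pos h0, him]
          have := le_abs_self y.1.im
          push_cast
          linarith
        · have hn2 : R (n + m) + 6 < level lam mu y := hn2
          linarith
  have h1 := H.cover_iterate fun i hi => hmem k le_rfl i hi.le
  rw [hk] at h1
  rw [← cover_iterate_shift]
  exact ((H.injective hy' (hmem k le_rfl k le_rfl)).1 h1).symm

end Chart

/-! ### Construction of the charts -/

section Existence

variable {τ lam : ℂ} {mu : ℝ} {P : FormalDiffeo} {F : NbhdDiffeo (expMap τ)} {V : Set (ℂ × ℂ)}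

theorem norm_expMap_sub_one_le {s : ℂ} (hs : ‖s‖ ≤ 1 / 8) : ‖expMap s - 1‖ ≤ 16 * ‖s‖ := by
  have h1 : ‖2 * Real.pi * I * s‖ = 2 * Real.pi * ‖s‖ := by simp [abs_of_pos Real.pi_pos]
  have h2 := norm_exp_sub_one_le (x := 2 * Real.pi * I * s) (by
    rw [h1]; nlinarith [Real.pi_lt_four, norm_nonneg s])
  rw [h1] at h2
  refine h2.trans ?_
  nlinarith [Real.pi_lt_four, norm_nonneg s]

theorem norm_cover_sub_cover_le {x y : ℂ × ℂ} (h : ‖y - x‖ ≤ 1 / 8) :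
    ‖cover y - cover x‖ ≤ (16 * ‖expMap x.1‖ + 1) * ‖y - x‖ := by
  have h1 := norm_fst_le (y - x)
  have h2 : (cover y - cover x).1 = expMap x.1 * (expMap (y - x).1 - 1) := by
    rw [mul_sub, ← expMap_add]
    simp [cover]
  have h3 := norm_expMap_sub_one_le (h1.trans h)
  have h4 := norm_nonneg (expMap x.1)
  have h5 := norm_nonneg (y - x)
  rw [Prod.norm_def, h2, norm_mul]
  refine max_le ?_ ?_
  · calc _ ≤ ‖expMap x.1‖ * (16 * ‖y - x‖) := by gcongr; exact h3.trans (by gcongr)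
      _ ≤ _ := by nlinarith
  · have h6 : (cover y - cover x).2 = (y - x).2 := rfl
    rw [h6]
    refine (norm_snd_le _).trans ?_
    nlinarith [mul_nonneg h4 h5]

/-- The sectorial normalization provides a chart whose inverse `Ψ`, seen on the base, is flat-close
to a map `A` with the given formal expansion. -/
theorem FormalDiffeo.Conjugates.exists_sectorChart (hP : P.Conjugates F) (hτ : 0 < τ.im)
    (hd : IsDirection τ lam mu) (hV : Deep τ lam mu {x | cover x ∈ xiDomain V}) :
    ∃ (W : Set (ℂ × ℂ)) (R : ℕ → ℝ) (Θ Ψ A : ℂ × ℂ → ℂ × ℂ), Monotone R ∧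
      SectorChart F P lam mu V W R Θ Ψ ∧ DeepBigO τ lam mu 0 (fun x => Ψ x - x) ∧
      Deep τ lam mu {x | Θ (Ψ x) = x} ∧
      (∀ m, DeepBigO τ lam mu (m + 1) (fun x => A x - P.trunc m (cover x))) ∧
      ∀ m n : ℕ, ∃ C r : ℝ, ∀ x : ℂ × ℂ, |x.1.im| < (n + 1) * τ.im → r < level lam mu x →
        ‖cover (Ψ x) - A x‖ * level lam mu x ^ m ≤ C := by
  have hmu := hd.abs_mu_le
  obtain ⟨pa, pb, Ph, Fh, Θ, Ψ, ha, hb, hPc, hP1, hFc, hΘ0, hΨ0, hΘ, hΨ, h8, hflat⟩ :=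
    exists_normalization hτ hd hP
  have hb0 : DeepBigO τ lam mu 0 (fun x => P.b 0 (expMap x.1)) := deepBigO_coeff hmu (P.holo_b 0)
  have hz : DeepBigO τ lam mu 0 (fun _ : ℂ × ℂ => (0 : ℂ)) := deepBigO_const 0
  have hP0 : DeepBigO τ lam mu 0 (fun x => Ph x - x) :=
    ((hP1.mono hmu zero_le_one).add (hz.prodMk hb0)).congr (deep_univ.mono fun x _ => by
      change _ = _
      refine Prod.ext ?_ ?_
      · simp
      · simp; ring)
  have hl : 0 < ‖lam‖ + 1 := by positivity
  -- `Ψ` is close to its leading terms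
  have hclose : Deep τ lam mu
      {w | ‖Ψ w - (w.1, w.2 + P.b 0 (expMap w.1))‖ ≤ 1 / (‖lam‖ + 1)} := by
    refine ((hflat 1).inter ((deep_le_level (2 * (‖lam‖ + 1))).inter
      (hP1.small hmu (ε := 1 / (‖lam‖ + 1) / 2) (by positivity)))).mono ?_
    rintro w ⟨h1, h2, h3⟩
    have h1 : ‖Ψ w - Ph w‖ * level lam mu w ^ 1 ≤ 1 := h1
    have h2 : 2 * (‖lam‖ + 1) ≤ level lam mu w := h2
    have h3 : ‖Ph w - (w.1, w.2 + P.b 0 (expMap w.1))‖ ≤ 1 / (‖lam‖ + 1) / 2 := h3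
    have h4 : ‖Ψ w - Ph w‖ ≤ 1 / (‖lam‖ + 1) / 2 := by
      rw [div_div, le_div_iff₀ (by positivity), mul_comm (‖lam‖ + 1)]
      rw [pow_one] at h1
      exact (by gcongr : ‖Ψ w - Ph w‖ * (2 * (‖lam‖ + 1)) ≤ ‖Ψ w - Ph w‖ * level lam mu w).trans h1
    have h5 := norm_sub_le_norm_sub_add_norm_sub (Ψ w) (Ph w) (w.1, w.2 + P.b 0 (expMap w.1))
    change ‖_‖ ≤ _
    linarith
  obtain ⟨Rw, -, hRw⟩ := hΨ.exists_steep
  obtain ⟨R, hmono, hR⟩ := (hΘ.inter ((((deep_dom (R := Rw)).inter hV).inter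
    (((deep_cover_halfSpace hmu).inter hFc).inter hclose)).preimage' hτ hmu hΘ0)).exists_monotone
  refine ⟨dom τ lam mu Rw, R, Θ, Ψ, fun x => cover (Ph x), hmono, ?_, hΨ0,
    hΨ.mono fun x hx => hx.2, fun m => ?_, fun m n => ?_⟩
  · have key : ∀ x ∈ dom τ lam mu R,
        ‖x - ((Θ x).1, (Θ x).2 + P.b 0 (expMap (Θ x).1))‖ ≤ 1 / (‖lam‖ + 1) := fun x hx => by
      obtain ⟨⟨-, -, h1, -⟩, -, -, h2⟩ := hR hx
      have h2 : ‖Ψ (Θ x) - ((Θ x).1, (Θ x).2 + P.b 0 (expMap (Θ x).1))‖ ≤ _ := h2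
      rwa [h1] at h2
    refine ⟨isOpen_dom, fun x hx => (hR hx).2.1.1, fun w hw => (hRw hw).1, fun w hw => (hRw hw).2,
      fun x hx => (hR hx).1.2.2.1, fun x hx => (hR hx).1.2.1, fun x hx => ?_,
      fun x hx => (hR hx).2.1.2, fun x hx => ?_, fun x hx => ?_, fun x hx => (hR hx).2.2.1.1.2.2⟩
    · rw [← (hR hx).1.2.2.2]
      exact (hR hx).2.2.1.2.2
    · have h1 := abs_level_sub_le (lam := lam) hmu x
        ((Θ x).1, (Θ x).2 + P.b 0 (expMap (Θ x).1))
      have h2 : level lam mu ((Θ x).1, (Θ x).2 + P.b 0 (expMap (Θ x).1)) =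
          depth lam mu P (cover (Θ x)) := by
        simp [level, depth, cover, height_expMap]
      rw [h2, norm_sub_rev] at h1
      refine h1.trans ?_
      calc _ ≤ (‖lam‖ + 1) * (1 / (‖lam‖ + 1)) := by gcongr; exact key x hx
        _ = 1 := by field_simp
    · have h1 := (abs_im_le_norm _).trans ((norm_fst_le _).trans (key x hx))
      rw [Prod.fst_sub, sub_im, abs_sub_comm] at h1
      refine h1.trans ?_
      rw [div_le_one hl]
      linarith [norm_nonneg lam]
  · refine ((ha m).prodMk (hb m)).congr (hPc.mono fun x hx => ?_)
    have hx : cover (Ph x) = ((cover x).1 + pa (cover x), x.2 + pb (cover x)) := hx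
    change cover (Ph x) - _ = _
    rw [hx]
    refine Prod.ext ?_ ?_ <;> simp [FormalDiffeo.trunc, cover]
  · have hE : DeepBigO τ lam mu 0 (fun x => expMap (Ph x).1) :=
      (deepBigO_coeff (c := id) hmu differentiableOn_id).comp hτ hmu hP0
    obtain ⟨D, s, hD⟩ := hE.exists_norm_le n
    obtain ⟨r, hr, hr'⟩ := (h8.inter ((hflat m).inter (deep_le_level 0))).exists_forall n s
    refine ⟨16 * D + 1, r, fun x h1 h2 => ?_⟩
    obtain ⟨h3, h4, h5⟩ := hr' x h1 h2
    have h4 : ‖Ψ x - Ph x‖ * level lam mu x ^ m ≤ 1 := h4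
    have h5 : 0 ≤ level lam mu x := h5
    have h6 := hD x h1 (hr.trans_lt h2)
    have hD0 : 0 ≤ D := (norm_nonneg _).trans h6
    calc _ ≤ (16 * ‖expMap (Ph x).1‖ + 1) * ‖Ψ x - Ph x‖ * level lam mu x ^ m := by
          gcongr; exact norm_cover_sub_cover_le h3
      _ = (16 * ‖expMap (Ph x).1‖ + 1) * (‖Ψ x - Ph x‖ * level lam mu x ^ m) := by ring
      _ ≤ (16 * D + 1) * 1 := by gcongr
      _ = _ := mul_one _

end Existence

/-! ### Asymptotic expansions on the sectors -/

section Sectorial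

variable {τ lam : ℂ} {mu : ℝ} {P : FormalDiffeo} {F : NbhdDiffeo (expMap τ)} {V W : Set (ℂ × ℂ)}
  {R R' : ℕ → ℝ} {Θ Ψ A : ℂ × ℂ → ℂ × ℂ} {θ : ℝ}

/-- On each subsector the induced map is defined for large `ξ` and asymptotic to the formal
diffeomorphism. -/
theorem SectorChart.exists_asymptotic (H : SectorChart F P lam mu V W R Θ Ψ) (hτ : 0 < τ.im)
    (hd : IsDirection τ lam mu) (hlam : lam * exp ((θ : ℂ) * I) = ‖lam‖)
    (hΨ0 : DeepBigO τ lam mu 0 (fun x => Ψ x - x)) (hΨ : Deep τ lam mu {x | Θ (Ψ x) = x})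
    (hA : ∀ m, DeepBigO τ lam mu (m + 1) (fun x => A x - P.trunc m (cover x)))
    (hΨA : ∀ m n : ℕ, ∃ C r : ℝ, ∀ x : ℂ × ℂ, |x.1.im| < (n + 1) * τ.im → r < level lam mu x →
        ‖cover (Ψ x) - A x‖ * level lam mu x ^ m ≤ C) (hR : ∀ n, R n ≤ R' n)
    (m : ℕ) {c ε : ℝ} (hc : 0 < c) (hε : 0 < ε) :
    ∃ C > 0, ∃ ρ > 0, ∀ p ∈ sector (θ + ε) (θ + Real.pi - ε) ρ c,
      p ∈ cover '' (Θ '' dom τ lam mu R') ∧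
        ‖descent Ψ p - P.trunc m p‖ ≤ C / ‖p.2‖ ^ (m + 1) := by
  have hmu := hd.abs_mu_le
  obtain ⟨n, κ, hκ, hsec⟩ := exists_lift_sector hτ hd hlam hε hc
  obtain ⟨C₁, r₁, h1⟩ := hA m n
  obtain ⟨C₂, r₂, h2⟩ := hΨA (m + 1) n
  obtain ⟨r, hr, h3⟩ := (hΨ.inter ((deep_dom (R := R')).preimage' hτ hmu hΨ0)).exists_forall n
    (max r₁ r₂)
  obtain ⟨ρ, hρ, hlift⟩ := hsec r
  refine ⟨|C₁| + |C₂| / κ ^ (m + 1) + 1, by positivity, ρ, hρ, fun p hp => ?_⟩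
  obtain ⟨x, rfl, hx1, hx2, hx3⟩ := hlift p hp
  obtain ⟨h4, h5⟩ := h3 x hx1 hx2
  have h4 : Θ (Ψ x) = x := h4
  have h5 : Ψ x ∈ dom τ lam mu R' := h5
  obtain ⟨hr1, hr2⟩ := max_lt_iff.1 (hr.trans_lt hx2)
  have h6 := h1 x hx1 hr1
  have h7 := h2 x hx1 hr2
  have hξ : 0 < ‖x.2‖ := hρ.trans hp.2.1
  have h8 := H.descent_cover (dom_mono hR h5)
  rw [h4] at h8
  refine ⟨⟨x, ⟨_, h5, h4⟩, rfl⟩, ?_⟩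
  change _ ≤ _ / ‖x.2‖ ^ (m + 1)
  rw [h8, le_div_iff₀ (by positivity)]
  have h9 : ‖cover (Ψ x) - A x‖ * ‖x.2‖ ^ (m + 1) ≤ |C₂| / κ ^ (m + 1) := by
    rw [le_div_iff₀ (by positivity), mul_assoc, ← mul_pow, mul_comm ‖x.2‖]
    refine le_trans ?_ (h7.trans (le_abs_self _))
    gcongr
    exact hx3
  calc _ ≤ (‖cover (Ψ x) - A x‖ + ‖A x - P.trunc m (cover x)‖) * ‖x.2‖ ^ (m + 1) := by
        gcongr; exact norm_sub_le_norm_sub_add_norm_sub _ _ _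
    _ ≤ _ := by
        rw [add_mul]
        linarith [h6.trans (le_abs_self _)]

end Sectorial

end EllipticNbhd

theorem mainTheorem2 (τ : ℂ) (hτ : 0 < τ.im)
    (F : EllipticNbhd.NbhdDiffeo (Complex.exp (2 * Real.pi * Complex.I * τ)))
    (P : EllipticNbhd.FormalDiffeo) (hP : P.Conjugates F) (i : Fin 4) :
    ∃ (S : Set (ℂ × ℂ)) (Ψ : ℂ × ℂ → ℂ × ℂ),
      S ⊆ EllipticNbhd.xiDomain F.U ∧
      EllipticNbhd.IsSectorialBiholo (EllipticNbhd.intervalStart τ i)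
        (EllipticNbhd.intervalStart τ i + Real.pi) P S Ψ ∧
      (∀ p ∈ S, F.xi p ∈ S →
        Ψ (F.xi p) = EllipticNbhd.modelMap (Complex.exp (2 * Real.pi * Complex.I * τ)) (Ψ p)) ∧
      EllipticNbhd.DescendsInjectively F S Ψ := by
  change EllipticNbhd.NbhdDiffeo (EllipticNbhd.expMap τ) at F
  obtain ⟨lam, mu, hd, hlam⟩ := EllipticNbhd.exists_direction hτ i
  obtain ⟨V, hVo, hVU, hVc, hVd, hV⟩ := hP.exists_nbhd hτ hd
  obtain ⟨W, R, Θ, Ψ, A, hmono, H, hΨ0, hΨ, hA, hΨA⟩ := hP.exists_sectorChart hτ hd hVd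
  obtain ⟨m, hm⟩ := exists_nat_ge ((2 + τ.im) / τ.im)
  rw [div_le_iff₀ hτ] at hm
  -- the sector is smaller than the domain of the chart, so that orbits of the germ ending in it stay
  -- in that domain
  have hR : ∀ n, R n ≤ R (n + m) + 6 := fun n => by linarith [hmono (n.le_add_right m)]
  set D : Set (ℂ × ℂ) := EllipticNbhd.dom τ lam mu fun n => R (n + m) + 6 with hD
  have hDR : ∀ {x}, x ∈ D → x ∈ EllipticNbhd.dom τ lam mu R :=
    fun hx => EllipticNbhd.dom_mono hR hx
  have hasymp := fun k c hc ε hε => H.exists_asymptotic hτ hd hlam hΨ0 hΨ hA hΨA hR k (c := c)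
    (ε := ε) hc hε
  have hSV : EllipticNbhd.cover '' (Θ '' D) ⊆ EllipticNbhd.xiDomain V := by
    rintro _ ⟨_, ⟨x, hx, rfl⟩, rfl⟩
    exact H.mem_nbhd x (hDR hx)
  have horbit : ∀ p ∈ EllipticNbhd.cover '' (Θ '' D), ∀ p' ∈ EllipticNbhd.cover '' (Θ '' D),
      ∀ k : ℕ, EllipticNbhd.OrbitIn F V k p p' ↔
        (EllipticNbhd.modelMap (EllipticNbhd.expMap τ))^[k] (EllipticNbhd.descent Ψ p) =
          EllipticNbhd.descent Ψ p' := by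
    rintro _ ⟨_, ⟨x, hx, rfl⟩, rfl⟩ _ ⟨_, ⟨y, hy, rfl⟩, rfl⟩ k
    rw [H.descent_cover (hDR hx), H.descent_cover (hDR hy)]
    exact ⟨H.iterate_of_orbitIn hτ hd hmono hm hV (hDR hx) hy,
      H.orbitIn_of_iterate hτ hd (hDR hx) (hDR hy)⟩
  refine ⟨EllipticNbhd.cover '' (Θ '' D), EllipticNbhd.descent Ψ,
    fun p hp => ⟨(hSV hp).1, hVU (hSV hp).2⟩, ⟨⟨H.isOpen_image hR, ?_, fun c hc ε hε => ?_⟩,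
    H.differentiableOn_descent hR, H.injOn_descent hR, ?_, fun k c hc ε hε => ?_,
    fun k c hc ε hε => ?_⟩, fun p hp hFp => ?_, V, hVo, hVU, hVc, hSV, horbit⟩
  · rintro _ ⟨_, ⟨x, hx, rfl⟩, rfl⟩
    exact ⟨EllipticNbhd.expMap_ne_zero _, EllipticNbhd.argMem_of_im_pos hlam (H.im_pos x (hDR hx))⟩
  · obtain ⟨_, -, ρ, hρ, h⟩ := hasymp 0 c hc ε hε
    exact ⟨ρ, hρ, fun p hp => (h p hp).1⟩
  · exact fun p _ => EllipticNbhd.expMap_ne_zero _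
  · obtain ⟨C, hC, ρ, hρ, h⟩ := hasymp k c hc ε hε
    refine ⟨C, hC, ρ, hρ, fun p hp => (h p hp).1, fun p hp => ?_⟩
    have := (norm_fst_le _).trans (h p hp).2
    rwa [sub_sub]
  · obtain ⟨C, hC, ρ, hρ, h⟩ := hasymp k c hc ε hε
    refine ⟨C, hC, ρ, hρ, fun p hp => (h p hp).1, fun p hp => ?_⟩
    have := (norm_snd_le _).trans (h p hp).2
    rwa [sub_sub]
  · refine ((horbit p hp _ hFp 1).1 ⟨fun j hj => ?_, rfl⟩).symm
    obtain rfl | rfl := Nat.le_one_iff_eq_zero_or_eq_one.1 hj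
    exacts [hSV hp, hSV hFp]
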